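/- **Setting.** Let $\mathcal V$ be an infinite set of variables, $\mathcal A$ an infinite set of visible actions, $\tau\notin\mathcal A$ the invisible action, $\mathcal A_\tau=\mathcal A\cup\{\tau\}$. Expressions are $E::=\mathbf 0\mid X\mid a.E\mid E+E\mid \mu X.E$ with $a\in\mathcal A_\tau$, $X\in\mathcal V$; $\mu X$ binds $X$, $FV(E)$ is the set of free variables of $E$, and $E\{F_1/X_1,\dots,F_n/X_n\}$ is capture-free simultaneous substitution. The transitions $E\xrightarrow{a}E'$ are the least relation with: $a.E\xrightarrow{a}E$; if $E_1\xrightarrow{a}E'$ or $E_2\xrightarrow{a}E'$ then $E_1+E_2\xrightarrow{a}E'$; if $E\{\mu X.E/X\}\xrightarrow{a}E'$ then $\mu X.E\xrightarrow{a}E'$. The relation $E\vartriangleright X$ is the least one with: $X\vartriangleright X$; if $E_1\vartriangleright X$ or $E_2\vartriangleright X$ then $E_1+E_2\vartriangleright X$; if $E\{\mu Y.E/Y\}\vartriangleright X$ then $\mu Y.E\vartriangleright X$. Write $\Rightarrow$ for $(\xrightarrow{\tau})^*$, and $E\,\tilde\vartriangleright\,X$ if $E\Rightarrow E'\vartriangleright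 X$ for some $E'$. A variable $X$ is guarded in $E$ if every free occurrence of $X$ in $E$ lies within a subexpression $a.E'$ with $a\neq\tau$. A symmetric relation $R$ on expressions is a *divergence-preserving branching bisimulation* if for all $(E,F)\in R$: (i) if $E\xrightarrow{a}E'$, then either $a=\tau$ and $F\Rightarrow F'$ for some $F'$ with $(E,F'),(E',F')\in R$, or $F\Rightarrow F'\xrightarrow{a}F''$ for some $F',F''$ with $(E,F'),(E',F'')\in R$; (ii) if $E\vartriangleright X$, then $F\Rightarrow F'\vartriangleright X$ for some $F'$ with $(E,F')\in R$; (iii) if $E=E_0\xrightarrow{\tau}E_1\xrightarrow{\tau}\cdots$ is infinite, then there are $k$ and $F'$ with $F\xrightarrow{\tau}\Rightarrow F'$ and $(E_k,F')\in R$. Write $E\approx^{\vartriangle}_bF$ if some such $R$ contains $(E,F)$. Write $\vdash E=F$ if $E=F$ is derivable by equational reasoning (reflexivity, symmetry, transitivity, congruence for prefix, sum and $\mu X$) from: S1 $E+F=F+E$; S2 $E+(F+G)=(E+F)+G$; S3 $E+E=E$; S4 $E+\mathbf 0=E$; B $a.(\tau.(E+F)+F)=a.(E+F)$; R0 $\mu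 X.E=\mu Y.(E\{Y/X\})$ if $Y\notin FV(\mu X.E)$; R1 $\mu X.E=E\{\mu X.E/X\}$; R2 from $F=E\{F/X\}$ infer $F=\mu X.E$, if $X$ is guarded in $E$; R3 $\mu X.(X+E)=\mu X.E$; R4 $\mu X.(\tau.(\tau.E+F)+G)=\mu X.(\tau.(E+F)+G)$ if $E\,\tilde\vartriangleright\,X$; R5 $\mu X.(\tau.\mu Y.(\tau.Y+E)+F)=\mu X.(\tau.\mu Y.E+F)$ if $X\neq Y$ and $E\,\tilde\vartriangleright\,X$; R6 $\mu X.\tau.E=\tau.\mu X.(E\{\tau.X/X\})$; R7 $\mu X.(\tau.X+\mu Y.(\tau.Y+E))=\mu X.\mu Y.(\tau.Y+E)$; R8 $\mu X.\mu Y.(\tau.(X+E)+F)=\mu X.\mu Y.(\tau.(Y+E)+F)$. A *recursive equation system* is a finite set $S=\{X_i=F_i\mid i=1,\dots,n\}$ with distinct variables $X_i$ (its *formal variables*) and expressions $F_i$ (also written $F_{X_i}$). Expressions $E_1,\dots,E_n$ form a *solution* of $S$ if $\vdash E_i=F_i\{E_1/X_1,\dots,E_n/X_n\}$ for all $i$;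 then $E_i$ is called a *provable solution of $S$ for $X_i$*. Write $X_i\,\tilde\vartriangleright_S\,X_j$ if $F_i\,\tilde\vartriangleright\,X_j$; $S$ is *guarded* if there is no infinite sequence of formal variables $Y_0\,\tilde\vartriangleright_S\,Y_1\,\tilde\vartriangleright_S\cdots$. $S$ is *standard* if it is guarded and each right-hand side is of the form $G$ or $\tau^*G$, where $G$ is a finite, possibly empty sum of expressions $a.X$ with $X$ a formal variable of $S$ and of variables $W$ that are not formal variables of $S$, and $\tau^*G$ stands for $\mu Y.(\tau.Y+G)$ with $Y\notin FV(G)$. For formal variables, $X\approx_SX'$ means that $E\approx^{\vartriangle}_bE'$ whenever $E,E'$ are provable solutions of $S$ for $X,X'$ respectively. A formal variable $X$ is a *bottom variable* if $X\not\approx_SY$ for every formal variable $Y$ with $X\,\tilde\vartriangleright_S\,Y$. Let $\tau(S)=\{X=\tau.F_X\mid X=F_X\in S\}$. **Theorem (Quotienting).** Let $S$ be a standard equation system and $X,X'$ formal variables of $S$ with $X\approx_SX'$. Then $\tau(S)$ has a common provable solution for $X$ and $X'$, i.e. some expression is a provable solution of $\tau(S)$ for $X$ as well as for $X'$. Moreover,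 such a solution is obtained from the quotient system. The relation $\approx_S$ partitions the formal variables of $S$ into classes $C_1,\dots,C_m$, each of which contains a bottom variable, and there are distinct variables $Z_1,\dots,Z_m$ that are not formal variables of $S$ and not free in any right-hand side of $S$. For every such enumeration of the classes, every choice of bottom variables $X_k\in C_k$, and every choice of such $Z_1,\dots,Z_m$, write $\iota(Y)=k$ if $Y\in C_k$ and let $$S/{\approx_S}=\{Z_k=F_{X_k}\{Z_{\iota(Y)}/Y\mid Y\text{ a formal variable of }S\}\mid k=1,\dots,m\}.$$ Then $S/{\approx_S}$ has a solution $B_1,\dots,B_m$, and for every solution $B_1,\dots,B_m$ of it the family $(\tau.B_{\iota(Y)})_Y$, with $Y$ ranging over the formal variables of $S$, is a solution of $\tau(S)$; in particular $\tau.B_{\iota(X)}$, which is the same expression as $\tau.B_{\iota(X')}$, is a provable solution of $\tau(S)$ for $X$ and for $X'$. -/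

import Mathlib

universe u v

namespace FiniteState

/-- Actions: the invisible action `tau` and the visible actions, taken from `A`. -/
inductive Act (A : Type v) : Type v
  | tau : Act A
  | vis (a : A) : Act A

/-- Process expressions `E ::= 0 | X | a.E | E + E | μX.E` over the variables `V`. -/
inductive Expr (V : Type u) (A : Type v) : Type (max u v)
  | nil : Expr V A
  | var (X : V) : Expr V A
  | pre (a : Act A) (E : Expr V A) : Expr V A
  | sum (E F : Expr V A) : Expr V A
  | mu (X : V) (E : Expr V A) : Expr V A

/-- A variable outside a given finite set. -/
noncomputable def fresh {V : Type u} [Infinite V] (s : Finset V) : V :=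
  (Infinite.exists_notMem_finset s).choose

theorem fresh_notMem {V : Type u} [Infinite V] (s : Finset V) : fresh s ∉ s :=
  (Infinite.exists_notMem_finset s).choose_spec

namespace Expr

variable {V : Type u} {A : Type v}

/-- The free variables of an expression. -/
def FV [DecidableEq V] : Expr V A → Finset V
  | nil => ∅
  | var X => {X}
  | pre _ E => E.FV
  | sum E F => E.FV ∪ F.FV
  | mu X E => E.FV.erase X

/-- Capture-free simultaneous substitution of `σ Y` for the free occurrences of `Y`, for all `Y`.
Passing under a binder `μX`, the bound variable is renamed to one that is not free in any of the
expressions substituted for the free variables of `μX.E`. -/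
noncomputable def subst [DecidableEq V] [Infinite V] : Expr V A → (V → Expr V A) → Expr V A
  | nil, _ => nil
  | var X, σ => σ X
  | pre a E, σ => pre a (E.subst σ)
  | sum E F, σ => sum (E.subst σ) (F.subst σ)
  | mu X E, σ =>
      mu (fresh ((E.FV.erase X).biUnion fun Y => (σ Y).FV))
        (E.subst (Function.update σ X
          (var (fresh ((E.FV.erase X).biUnion fun Y => (σ Y).FV)))))

/-- `E.subst₁ X F` is `E{F/X}`. -/
noncomputable def subst₁ [DecidableEq V] [Infinite V] (E : Expr V A) (X : V) (F : Expr V A) :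
    Expr V A :=
  E.subst (Function.update var X F)

/-- `X` is guarded in `E`: every free occurrence of `X` in `E` lies within a subexpression `a.E'`
with `a ≠ τ`. -/
def GuardedIn (X : V) : Expr V A → Prop
  | nil => True
  | var Y => Y ≠ X
  | pre a E => a ≠ Act.tau ∨ GuardedIn X E
  | sum E F => GuardedIn X E ∧ GuardedIn X F
  | mu Y E => Y = X ∨ GuardedIn X E

/-- The transition relation: `Step E a E'` is `E —a→ E'`. -/
inductive Step [DecidableEq V] [Infinite V] : Expr V A → Act A → Expr V A → Prop
  | pre (a : Act A) (E : Expr V A) : Step (pre a E) a E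
  | sum_left {E₁ : Expr V A} {a : Act A} {E' : Expr V A} (E₂ : Expr V A) :
      Step E₁ a E' → Step (sum E₁ E₂) a E'
  | sum_right {E₂ : Expr V A} {a : Act A} {E' : Expr V A} (E₁ : Expr V A) :
      Step E₂ a E' → Step (sum E₁ E₂) a E'
  | mu {X : V} {E : Expr V A} {a : Act A} {E' : Expr V A} :
      Step (E.subst₁ X (mu X E)) a E' → Step (mu X E) a E'

/-- The relation `E ▷ X` between expressions and variables. -/
inductive Exposes [DecidableEq V] [Infinite V] : Expr V A → V → Prop
  | var (X : V) : Exposes (var X) X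
  | sum_left {E₁ : Expr V A} {X : V} (E₂ : Expr V A) : Exposes E₁ X → Exposes (sum E₁ E₂) X
  | sum_right {E₂ : Expr V A} {X : V} (E₁ : Expr V A) : Exposes E₂ X → Exposes (sum E₁ E₂) X
  | mu {Y : V} {E : Expr V A} {X : V} : Exposes (E.subst₁ Y (mu Y E)) X → Exposes (mu Y E) X

section Semantics

variable [DecidableEq V] [Infinite V]

/-- A single silent step. -/
def TauStep (E F : Expr V A) : Prop := Step E Act.tau F

/-- Zero or more silent steps, `E ⟹ F`. -/
def TauStar : Expr V A → Expr V A → Prop := Relation.ReflTransGen TauStep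

/-- One or more silent steps. -/
def TauPlus : Expr V A → Expr V A → Prop := Relation.TransGen TauStep

/-- `E ▷̃ X`: after some silent steps of `E` the variable `X` is exposed. -/
def WeaklyExposes (E : Expr V A) (X : V) : Prop := ∃ E', TauStar E E' ∧ Exposes E' X

/-- The pair `(E, F)` satisfies the transfer conditions of branching bisimulation
with respect to `R`. -/
def Branching (R : Expr V A → Expr V A → Prop) (E F : Expr V A) : Prop :=
  (∀ a E', Step E a E' →
      (a = Act.tau ∧ ∃ F', TauStar F F' ∧ R E F' ∧ R E' F') ∨
      (∃ F' F'', TauStar F F' ∧ Step F' a F'' ∧ R E F' ∧ R E' F'')) ∧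
  (∀ X, Exposes E X → ∃ F', TauStar F F' ∧ R E F' ∧ Exposes F' X)

/-- As `Branching`, with in addition the condition on the infinite `τ`-runs from `E`. -/
def DivBranching (R : Expr V A → Expr V A → Prop) (E F : Expr V A) : Prop :=
  Branching R E F ∧
  ∀ run : ℕ → Expr V A, run 0 = E → (∀ k, TauStep (run k) (run (k + 1))) →
    ∃ k F', TauPlus F F' ∧ R (run k) F'

/-- Divergence-preserving branching bisimulations. -/
def IsDivBranchingBisim (R : Expr V A → Expr V A → Prop) : Prop :=
  (∀ E F, R E F → R F E) ∧ ∀ E F, R E F → DivBranching R E F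

/-- Divergence-preserving branching bisimilarity. -/
def DivBisimilar (E F : Expr V A) : Prop := ∃ R, IsDivBranchingBisim R ∧ R E F

/-- `Provable E F` is `⊢ E = F`: derivability by equational reasoning from the axioms `S1`-`S4`,
`B`, `R0`, `R1`, `R3`-`R8` and the rule `R2`. -/
inductive Provable : Expr V A → Expr V A → Prop
  | refl (E : Expr V A) : Provable E E
  | symm {E F : Expr V A} : Provable E F → Provable F E
  | trans {E F G : Expr V A} : Provable E F → Provable F G → Provable E G
  | pre_congr (a : Act A) {E F : Expr V A} : Provable E F → Provable (pre a E) (pre a F)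
  | sum_congr {E E' F F' : Expr V A} :
      Provable E E' → Provable F F' → Provable (sum E F) (sum E' F')
  | mu_congr (X : V) {E F : Expr V A} : Provable E F → Provable (mu X E) (mu X F)
  | S1 (E F : Expr V A) : Provable (sum E F) (sum F E)
  | S2 (E F G : Expr V A) : Provable (sum E (sum F G)) (sum (sum E F) G)
  | S3 (E : Expr V A) : Provable (sum E E) E
  | S4 (E : Expr V A) : Provable (sum E nil) E
  | B (a : Act A) (E F : Expr V A) :
      Provable (pre a (sum (pre Act.tau (sum E F)) F)) (pre a (sum E F))
  | R0 (X Y : V) (E : Expr V A) : Y ∉ (mu X E).FV →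
      Provable (mu X E) (mu Y (E.subst₁ X (var Y)))
  | R1 (X : V) (E : Expr V A) : Provable (mu X E) (E.subst₁ X (mu X E))
  | R2 (X : V) (E F : Expr V A) : GuardedIn X E →
      Provable F (E.subst₁ X F) → Provable F (mu X E)
  | R3 (X : V) (E : Expr V A) : Provable (mu X (sum (var X) E)) (mu X E)
  | R4 (X : V) (E F G : Expr V A) : WeaklyExposes E X →
      Provable (mu X (sum (pre Act.tau (sum (pre Act.tau E) F)) G))
        (mu X (sum (pre Act.tau (sum E F)) G))
  | R5 (X Y : V) (E F : Expr V A) : X ≠ Y → WeaklyExposes E X →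
      Provable (mu X (sum (pre Act.tau (mu Y (sum (pre Act.tau (var Y)) E))) F))
        (mu X (sum (pre Act.tau (mu Y E)) F))
  | R6 (X : V) (E : Expr V A) :
      Provable (mu X (pre Act.tau E)) (pre Act.tau (mu X (E.subst₁ X (pre Act.tau (var X)))))
  | R7 (X Y : V) (E : Expr V A) :
      Provable (mu X (sum (pre Act.tau (var X)) (mu Y (sum (pre Act.tau (var Y)) E))))
        (mu X (mu Y (sum (pre Act.tau (var Y)) E)))
  | R8 (X Y : V) (E F : Expr V A) :
      Provable (mu X (mu Y (sum (pre Act.tau (sum (var X) E)) F)))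
        (mu X (mu Y (sum (pre Act.tau (sum (var Y) E)) F)))

end Semantics

/-- `IsSimpleSum P E`: `E` is a finite (possibly empty) sum, in any bracketing, of expressions
`a.X` with `X` a variable satisfying `P` and of variables `W` not satisfying `P`. -/
inductive IsSimpleSum (P : V → Prop) : Expr V A → Prop
  | nil : IsSimpleSum P nil
  | pre (a : Act A) {X : V} : P X → IsSimpleSum P (pre a (var X))
  | var {W : V} : ¬ P W → IsSimpleSum P (var W)
  | sum {E F : Expr V A} : IsSimpleSum P E → IsSimpleSum P F → IsSimpleSum P (sum E F)

/-- `IsLoopOf E F`: `F` is the loop expression `τ*E`, that is `μX.(τ.X + E)` with `X` not free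
in `E`. -/
def IsLoopOf [DecidableEq V] (E F : Expr V A) : Prop :=
  ∃ X, X ∉ E.FV ∧ F = mu X (sum (pre Act.tau (var X)) E)

end Expr

open _root_.FiniteState.Expr

/-- A recursive equation system `{X_i = F_i | i}` of `n` equations with distinct formal
variables `X_i`; the formal variables are referred to by their indices. -/
structure EqSystem (V : Type u) (A : Type v) (n : ℕ) where
  formal : Fin n → V
  formal_injective : Function.Injective formal
  rhs : Fin n → Expr V A

namespace EqSystem

variable {V : Type u} {A : Type v} [DecidableEq V] [Infinite V] {n : ℕ}

/-- The substitution `{D_i / X_i | i}`, which leaves all other variables alone. -/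
noncomputable def inst (S : EqSystem V A n) (D : Fin n → Expr V A) : V → Expr V A :=
  Function.extend S.formal D Expr.var

/-- The expressions `D_i` satisfy all equations of `S` provably. -/
def IsSolution (S : EqSystem V A n) (D : Fin n → Expr V A) : Prop :=
  ∀ i, Provable (D i) ((S.rhs i).subst (S.inst D))

/-- `E` provably solves `S` for the formal variable `X_i`. -/
def Solves (S : EqSystem V A n) (i : Fin n) (E : Expr V A) : Prop :=
  ∃ D, S.IsSolution D ∧ D i = E

/-- `X_j` is `S`-unguarded for `X_i`. -/
def Unguarded (S : EqSystem V A n) (i j : Fin n) : Prop :=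
  WeaklyExposes (S.rhs i) (S.formal j)

/-- `S` is guarded: there is no infinite chain in which each formal variable is followed by one
that is `S`-unguarded for it. -/
def IsGuarded (S : EqSystem V A n) : Prop := WellFounded fun j i => S.Unguarded i j

/-- Standard equation systems. -/
def IsStandard (S : EqSystem V A n) : Prop :=
  S.IsGuarded ∧
  ∀ i, IsSimpleSum (· ∈ Set.range S.formal) (S.rhs i) ∨
    ∃ E, IsSimpleSum (· ∈ Set.range S.formal) E ∧ IsLoopOf E (S.rhs i)

/-- `X_i ≈_S X_j`: all provable solutions of `S` for `X_i` and for `X_j` are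
divergence-preserving branching bisimilar. -/
def Equiv (S : EqSystem V A n) (i j : Fin n) : Prop :=
  ∀ E E', S.Solves i E → S.Solves j E' → DivBisimilar E E'

/-- `S` has a common provable solution for `X_i` and `X_j`. -/
def HasCommonSolution (S : EqSystem V A n) (i j : Fin n) : Prop :=
  ∃ E, S.Solves i E ∧ S.Solves j E

/-- `X_i` is a bottom variable of `S`. -/
def IsBottom (S : EqSystem V A n) (i : Fin n) : Prop :=
  ∀ j, S.Unguarded i j → ¬ S.Equiv i j

/-- The system `τ(S) = {X = τ.F_X | X = F_X ∈ S}`. -/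
def tau (S : EqSystem V A n) : EqSystem V A n where
  formal := S.formal
  formal_injective := S.formal_injective
  rhs i := pre Act.tau (S.rhs i)

/-- The choices that enter the quotient system: an enumeration of the `m` classes of `≈_S`, given
by the class number `idx i` of each formal variable `X_i`, a designated bottom variable in each
class, and a new formal variable `Z_k` for each class. -/
structure QuotientChoice (S : EqSystem V A n) (m : ℕ) where
  idx : Fin n → Fin m
  idx_eq_iff : ∀ i j, idx i = idx j ↔ S.Equiv i j
  rep : Fin m → Fin n
  idx_rep : ∀ k, idx (rep k) = k
  rep_bottom : ∀ k, S.IsBottom (rep k)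
  newVar : Fin m → V
  newVar_injective : Function.Injective newVar
  newVar_ne : ∀ k i, newVar k ≠ S.formal i
  newVar_notMem : ∀ k i, newVar k ∉ (S.rhs i).FV

/-- The quotient system `S/≈_S`: for each class, with designated bottom variable `X`, the equation
`Z_k = F_X{Z_{idx Y}/Y | Y formal variable of S}`. -/
noncomputable def QuotientChoice.system {S : EqSystem V A n} {m : ℕ} (q : S.QuotientChoice m) :
    EqSystem V A m where
  formal := q.newVar
  formal_injective := q.newVar_injective
  rhs k := (S.rhs (q.rep k)).subst (S.inst fun i => Expr.var (q.newVar (q.idx i)))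

end EqSystem

end FiniteState

/-! A standard system is a finite labelled graph: each right-hand side is a sum of prefixed formal
variables and other variables, possibly inside a silent loop. Soundness of the axioms
(`Provable.rooted`) turns a provable solution into a family that satisfies the equations up to
rooted bisimilarity. Guardedness makes the silent edges well-founded, and induction along them shows
that two such families are bisimilar componentwise (`model_unique`). Hence `≈_S` can be read off
from any one solution (`equiv_iff`), solutions exist by elimination of variables
(`exists_isSolution`), and `≈_S` is an equivalence relation. A minimal element of a class is a
bottom variable.

Let `X_i` be a bottom variable in the class of `X_j`. Call a silent edge inert if it stays inside
the class; `X_i` has none. By stuttering, the instance of the right-hand side of `X_i` can stay in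
its class by silent steps only by going round its own loop. So every non-inert edge of `X_j`, every
variable it exposes and its loop, if any, have a counterpart at `X_i` itself (`edge_of_equiv`,
`exposes_of_equiv`, `looping_of_equiv`).

Now replace the formal variables by the quotient values of their classes, and let `N` be the value
for `X_i` and `X_j`. If `X_j` has no inert edge either, the two sums have the same summands and are
equal by S1-S4. Otherwise the sum of `X_j` becomes `τ.N + H`, where `H` collects the non-inert
summands and is absorbed by the sum of `X_i`. If `X_j` does not loop, axiom B gives `τ.(τ.N + H) =
τ.N`. If it loops, then so does `X_i`, and `τ.τ*(τ.N + H) = τ.N` is `tau_loop_absorb`, which rests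
on B and R5-R7. The leading `τ` is what these identities need: without it the two sides are in
general bisimilar but not rooted bisimilar. This is why solutions of `τ(S)` result. Replacing values
`B` by `τ.B` under prefixes is harmless, since `a.τ.B = a.B`.

Much of the work is soundness: congruence under recursion, uniqueness of guarded solutions, and an
explicit bisimulation for each axiom on recursion. -/

namespace FiniteState

namespace Expr

/-! ### Capture-free substitution and normal forms up to renaming of bound variables -/

section Substitution

variable {V : Type u} {A : Type v} [DecidableEq V] [Infinite V]

theorem subst_congr : ∀ (E : Expr V A) {σ ρ : V → Expr V A},
    (∀ X ∈ E.FV, σ X = ρ X) → E.subst σ = E.subst ρ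
  | nil, _, _, _ => rfl
  | var X, _, _, h => h X (by simp [FV])
  | pre a E, _, _, h => by
      simp only [subst]; rw [subst_congr E h]
  | sum E F, _, _, h => by
      simp only [subst]
      rw [subst_congr E fun X hX => h X (by simp [FV, hX]),
        subst_congr F fun X hX => h X (by simp [FV, hX])]
  | mu X E, σ, ρ, h => by
      have hS : ((E.FV.erase X).biUnion fun Y => (σ Y).FV)
          = (E.FV.erase X).biUnion fun Y => (ρ Y).FV :=
        Finset.biUnion_congr rfl fun Y hY => by rw [h Y hY]
      simp only [subst, hS]
      congr 1
      refine subst_congr E fun Y hY => ?_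
      by_cases hYX : Y = X
      · subst hYX; simp
      · simp only [Function.update_of_ne hYX]
        exact h Y (Finset.mem_erase.2 ⟨hYX, hY⟩)

theorem FV_subst : ∀ (E : Expr V A) (σ : V → Expr V A),
    (E.subst σ).FV = E.FV.biUnion fun Y => (σ Y).FV
  | nil, _ => by simp [subst, FV]
  | var X, _ => by simp [subst, FV]
  | pre a E, σ => by simpa [subst, FV] using FV_subst E σ
  | sum E F, σ => by
      simp only [subst, FV, FV_subst E σ, FV_subst F σ]
      ext W; simp only [Finset.mem_union, Finset.mem_biUnion]; grind
  | mu X E, σ => by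
      have hZ := fresh_notMem ((E.FV.erase X).biUnion fun Y => (σ Y).FV)
      simp only [subst, FV]
      rw [FV_subst E]
      generalize fresh ((E.FV.erase X).biUnion fun Y => (σ Y).FV) = Z at hZ ⊢
      ext W
      simp only [Finset.mem_biUnion, Finset.mem_erase, not_exists, not_and] at hZ ⊢
      constructor
      · rintro ⟨hW, Y, hY, hWY⟩
        by_cases hYX : Y = X
        · subst hYX; simp [FV] at hWY; exact absurd hWY hW
        · exact ⟨Y, ⟨hYX, hY⟩, by simpa [Function.update_of_ne hYX] using hWY⟩
      · rintro ⟨Y, hY, hWY⟩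
        refine ⟨?_, Y, hY.2, by simpa [Function.update_of_ne hY.1] using hWY⟩
        rintro rfl
        exact hZ Y hY hWY

/-- The name chosen for a bound variable depends only on the free variables of the resulting
recursion, and these agree on both sides. Hence the composition law is an equality of expressions,
not merely one up to renaming. -/
theorem subst_subst : ∀ (E : Expr V A) (σ ρ : V → Expr V A),
    (E.subst σ).subst ρ = E.subst fun X => (σ X).subst ρ
  | nil, _, _ => rfl
  | var X, _, _ => rfl
  | pre a E, σ, ρ => by simp only [subst]; rw [subst_subst E]
  | sum E F, σ, ρ => by simp only [subst]; rw [subst_subst E, subst_subst F]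
  | mu X E, σ, ρ => by
      have hZ := fresh_notMem ((E.FV.erase X).biUnion fun Y => (σ Y).FV)
      have hFV := FV_subst (mu X E) σ
      simp only [subst, FV] at hFV
      simp only [subst]
      generalize fresh ((E.FV.erase X).biUnion fun Y => (σ Y).FV) = Z at hZ hFV ⊢
      have hS : (((E.subst (Function.update σ X (var Z))).FV.erase Z).biUnion fun Y => (ρ Y).FV)
          = (E.FV.erase X).biUnion fun Y => ((σ Y).subst ρ).FV := by
        rw [hFV]
        simp only [FV_subst, Finset.biUnion_biUnion]
      rw [hS]
      generalize fresh ((E.FV.erase X).biUnion fun Y => ((σ Y).subst ρ).FV) = Z'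
      rw [subst_subst E]
      congr 1
      refine subst_congr E fun Y hY => ?_
      by_cases hYX : Y = X
      · subst hYX; simp [subst]
      · simp only [Function.update_of_ne hYX]
        refine subst_congr _ fun W hW => ?_
        have : W ≠ Z := by
          rintro rfl
          exact hZ (Finset.mem_biUnion.2 ⟨Y, Finset.mem_erase.2 ⟨hYX, hY⟩, hW⟩)
        simp [Function.update_of_ne this]

/-- The `α`-normal form of an expression. -/
noncomputable def nf (E : Expr V A) : Expr V A := E.subst var

/-- All values of the substitution are `α`-normal forms. -/
def Normal (σ : V → Expr V A) : Prop := ∀ X, (σ X).nf = σ X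

theorem nf_nf (E : Expr V A) : E.nf.nf = E.nf := by
  unfold nf; rw [subst_subst]; rfl

theorem normal_var : Normal (var : V → Expr V A) := fun _ => rfl

theorem Normal.nf_subst {σ : V → Expr V A} (h : Normal σ) (E : Expr V A) :
    (E.subst σ).nf = E.subst σ := by
  unfold nf; rw [subst_subst]; exact subst_congr _ fun X _ => h X

theorem Normal.update {σ : V → Expr V A} (h : Normal σ) (X : V) {E : Expr V A}
    (hE : E.nf = E) : Normal (Function.update σ X E) := by
  intro Y
  by_cases hY : Y = X
  · subst hY; simpa using hE
  · simpa [Function.update_of_ne hY] using h Y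

theorem subst_subst₁ (E : Expr V A) (X : V) (F : Expr V A) (σ : V → Expr V A) :
    (E.subst₁ X F).subst σ = E.subst (Function.update σ X (F.subst σ)) := by
  unfold subst₁
  rw [subst_subst]
  refine subst_congr _ fun Y _ => ?_
  by_cases hY : Y = X
  · subst hY; simp
  · simp [Function.update_of_ne hY, subst]

theorem nf_subst₁ (E : Expr V A) (X : V) (F : Expr V A) :
    (E.subst₁ X F).nf = E.subst (Function.update var X F.nf) := subst_subst₁ E X F var

theorem subst₁_of_notMem {E : Expr V A} {X : V} (F : Expr V A) (h : X ∉ E.FV) :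
    E.subst₁ X F = E.nf := by
  refine subst_congr _ fun Y hY => ?_
  have : Y ≠ X := by rintro rfl; exact h hY
  simp [Function.update_of_ne this]

theorem fresh_notMem_subst {X : V} {E : Expr V A} {σ : V → Expr V A} {Y : V}
    (hY : Y ∈ E.FV) (hYX : Y ≠ X) :
    fresh ((E.FV.erase X).biUnion fun Y => (σ Y).FV) ∉ (σ Y).FV := fun h =>
  fresh_notMem ((E.FV.erase X).biUnion fun Y => (σ Y).FV)
    (Finset.mem_biUnion.2 ⟨Y, Finset.mem_erase.2 ⟨hYX, hY⟩, h⟩)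

/-- Unfolding the recursion and normal substitutions commute. -/
theorem unfold_mu_subst {σ : V → Expr V A} (hσ : Normal σ) (X : V) (E : Expr V A) (F : Expr V A) :
    (E.subst (Function.update σ X
      (var (fresh ((E.FV.erase X).biUnion fun Y => (σ Y).FV))))).subst₁
      (fresh ((E.FV.erase X).biUnion fun Y => (σ Y).FV)) F
      = E.subst (Function.update σ X F) := by
  unfold subst₁
  rw [subst_subst]
  refine subst_congr _ fun Y hY => ?_
  by_cases hYX : Y = X
  · subst hYX; simp [subst]
  · simp only [Function.update_of_ne hYX]
    exact (subst₁_of_notMem F (fresh_notMem_subst hY hYX)).trans (hσ Y)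

end Substitution

/-! ### Transitions and exposed variables of substitution instances -/

section Transitions

variable {V : Type u} {A : Type v} [DecidableEq V] [Infinite V]

/-- Transitions and exposed variables together, with a bound on the number of unfoldings. -/
inductive Fires : ℕ → Expr V A → (Act A × Expr V A) ⊕ V → Prop
  | var (X : V) : Fires 0 (var X) (Sum.inr X)
  | pre (a : Act A) (E : Expr V A) : Fires 0 (pre a E) (Sum.inl (a, E))
  | sum_left {n : ℕ} {E₁ : Expr V A} {o : (Act A × Expr V A) ⊕ V} (E₂ : Expr V A) :
      Fires n E₁ o → Fires n (sum E₁ E₂) o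
  | sum_right {n : ℕ} {E₂ : Expr V A} {o : (Act A × Expr V A) ⊕ V} (E₁ : Expr V A) :
      Fires n E₂ o → Fires n (sum E₁ E₂) o
  | mu {n : ℕ} {X : V} {E : Expr V A} {o : (Act A × Expr V A) ⊕ V} :
      Fires n (E.subst₁ X (mu X E)) o → Fires (n + 1) (mu X E) o

theorem Step.fires {E : Expr V A} {a : Act A} {E' : Expr V A} (h : Step E a E') :
    ∃ n, Fires n E (Sum.inl (a, E')) := by
  induction h with
  | pre a E => exact ⟨0, .pre a E⟩
  | sum_left E₂ _ ih => exact ih.imp fun _ h => .sum_left E₂ h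
  | sum_right E₁ _ ih => exact ih.imp fun _ h => .sum_right E₁ h
  | mu _ ih => obtain ⟨n, h⟩ := ih; exact ⟨n + 1, .mu h⟩

theorem Exposes.fires {E : Expr V A} {X : V} (h : Exposes E X) :
    ∃ n, Fires n E (Sum.inr X) := by
  induction h with
  | var X => exact ⟨0, .var X⟩
  | sum_left E₂ _ ih => exact ih.imp fun _ h => .sum_left E₂ h
  | sum_right E₁ _ ih => exact ih.imp fun _ h => .sum_right E₁ h
  | mu _ ih => obtain ⟨n, h⟩ := ih; exact ⟨n + 1, .mu h⟩

/-- What an outcome says about transitions and exposed variables. -/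
def Shows (E : Expr V A) : (Act A × Expr V A) ⊕ V → Prop
  | Sum.inl p => Step E p.1 p.2
  | Sum.inr X => Exposes E X

theorem Shows.sum_left {E₁ : Expr V A} (E₂ : Expr V A) :
    ∀ {o : (Act A × Expr V A) ⊕ V}, Shows E₁ o → Shows (sum E₁ E₂) o
  | Sum.inl _, h => Step.sum_left E₂ h
  | Sum.inr _, h => Exposes.sum_left E₂ h

theorem Shows.sum_right {E₂ : Expr V A} (E₁ : Expr V A) :
    ∀ {o : (Act A × Expr V A) ⊕ V}, Shows E₂ o → Shows (sum E₁ E₂) o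
  | Sum.inl _, h => Step.sum_right E₁ h
  | Sum.inr _, h => Exposes.sum_right E₁ h

theorem Shows.mu {X : V} {E : Expr V A} :
    ∀ {o : (Act A × Expr V A) ⊕ V}, Shows (E.subst₁ X (mu X E)) o → Shows (mu X E) o
  | Sum.inl _, h => Step.mu h
  | Sum.inr _, h => Exposes.mu h

theorem Fires.shows {n : ℕ} {E : Expr V A} {o : (Act A × Expr V A) ⊕ V} (h : Fires n E o) :
    Shows E o := by
  induction h with
  | var X => exact Exposes.var X
  | pre a E => exact Step.pre a E
  | sum_left E₂ _ ih => exact ih.sum_left E₂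
  | sum_right E₁ _ ih => exact ih.sum_right E₁
  | mu _ ih => exact ih.mu

/-- The induction runs over the firing of the instance and not over `G`, since unfolding a recursion
makes `G` grow. At a recursion, unfolding commutes with normal substitutions. The bound `m ≤ n` on
the unfoldings is what makes the induction in `Fires.of_mu_subst` possible. -/
theorem Fires.of_subst {σ : V → Expr V A} (hσ : Normal σ) {n : ℕ} {T : Expr V A}
    {o : (Act A × Expr V A) ⊕ V} (h : Fires n T o) :
    ∀ G : Expr V A, T = G.subst σ →
      (∃ a G', Step G a G' ∧ o = Sum.inl (a, G'.subst σ)) ∨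
      (∃ W, Exposes G W ∧ ∃ m ≤ n, Fires m (σ W) o) := by
  induction h with
  | var X =>
    intro G hG
    cases G with
    | var W => exact .inr ⟨W, .var W, 0, le_rfl, by simp only [subst] at hG; rw [← hG]; exact .var X⟩
    | _ => simp [subst] at hG
  | pre a E =>
    intro G hG
    cases G with
    | var W =>
      exact .inr ⟨W, .var W, 0, le_rfl, by simp only [subst] at hG; rw [← hG]; exact .pre a E⟩
    | pre b G' =>
      simp only [subst, pre.injEq] at hG
      obtain ⟨rfl, rfl⟩ := hG
      exact .inl ⟨a, G', .pre a G', rfl⟩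
    | _ => simp [subst] at hG
  | @sum_left n E₁ o E₂ h ih =>
    intro G hG
    cases G with
    | var W =>
      exact .inr ⟨W, .var W, n, le_rfl, by simp only [subst] at hG; rw [← hG]; exact .sum_left E₂ h⟩
    | sum G₁ G₂ =>
      simp only [subst, sum.injEq] at hG
      obtain ⟨h1, rfl⟩ := hG
      rcases ih G₁ h1 with ⟨a, G', hs, ho⟩ | ⟨W, hW, hm⟩
      · exact .inl ⟨a, G', hs.sum_left _, ho⟩
      · exact .inr ⟨W, hW.sum_left _, hm⟩
    | _ => simp [subst] at hG
  | @sum_right n E₂ o E₁ h ih =>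
    intro G hG
    cases G with
    | var W =>
      exact .inr ⟨W, .var W, n, le_rfl,
        by simp only [subst] at hG; rw [← hG]; exact .sum_right E₁ h⟩
    | sum G₁ G₂ =>
      simp only [subst, sum.injEq] at hG
      obtain ⟨rfl, h1⟩ := hG
      rcases ih G₂ h1 with ⟨a, G', hs, ho⟩ | ⟨W, hW, hm⟩
      · exact .inl ⟨a, G', hs.sum_right _, ho⟩
      · exact .inr ⟨W, hW.sum_right _, hm⟩
    | _ => simp [subst] at hG
  | @mu n X E o h ih =>
    intro G hG
    cases G with
    | var W =>
      exact .inr ⟨W, .var W, n + 1, le_rfl, by simp only [subst] at hG; rw [← hG]; exact .mu h⟩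
    | mu Y G₀ =>
      have key : E.subst₁ X (Expr.mu X E) = (G₀.subst₁ Y (Expr.mu Y G₀)).subst σ := by
        rw [subst_subst₁, hG]
        have hG' := hG
        simp only [subst, mu.injEq] at hG'
        obtain ⟨rfl, rfl⟩ := hG'
        exact unfold_mu_subst hσ Y G₀ _
      rcases ih _ key with ⟨a, G', hs, ho⟩ | ⟨W, hW, m, hm, hf⟩
      · exact .inl ⟨a, G', hs.mu, ho⟩
      · exact .inr ⟨W, hW.mu, m, hm.trans n.le_succ, hf⟩
    | _ => simp [subst] at hG

theorem Step.subst {σ : V → Expr V A} (hσ : Normal σ) {G : Expr V A} {a : Act A} {G' : Expr V A}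
    (h : Step G a G') : Step (G.subst σ) a (G'.subst σ) := by
  induction h with
  | pre a E => exact .pre a _
  | sum_left E₂ _ ih => exact .sum_left _ ih
  | sum_right E₁ _ ih => exact .sum_right _ ih
  | @mu X E a E' _ ih =>
    rw [subst_subst₁, ← unfold_mu_subst hσ] at ih
    exact .mu ih

theorem Exposes.shows_subst {σ : V → Expr V A} (hσ : Normal σ) {G : Expr V A} {W : V}
    {o : (Act A × Expr V A) ⊕ V} (h : Exposes G W) : Shows (σ W) o → Shows (G.subst σ) o := by
  induction h with
  | var X => exact id
  | sum_left E₂ _ ih => exact fun h => (ih h).sum_left _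
  | sum_right E₁ _ ih => exact fun h => (ih h).sum_right _
  | @mu Y E X _ ih =>
    intro h
    have ih := ih h
    rw [subst_subst₁, ← unfold_mu_subst hσ] at ih
    exact ih.mu

theorem step_subst_iff {σ : V → Expr V A} (hσ : Normal σ) {G : Expr V A} {a : Act A}
    {T : Expr V A} : Step (G.subst σ) a T ↔
      (∃ G', Step G a G' ∧ T = G'.subst σ) ∨ (∃ W, Exposes G W ∧ Step (σ W) a T) := by
  constructor
  · intro h
    obtain ⟨n, h⟩ := h.fires
    rcases h.of_subst hσ G rfl with ⟨b, G', hs, ho⟩ | ⟨W, hW, m, _, hf⟩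
    · simp only [Sum.inl.injEq, Prod.mk.injEq] at ho
      obtain ⟨rfl, rfl⟩ := ho
      exact .inl ⟨G', hs, rfl⟩
    · exact .inr ⟨W, hW, hf.shows⟩
  · rintro (⟨G', hs, rfl⟩ | ⟨W, hW, hf⟩)
    · exact hs.subst hσ
    · exact hW.shows_subst hσ (o := Sum.inl (a, T)) hf

theorem exposes_subst_iff {σ : V → Expr V A} (hσ : Normal σ) {G : Expr V A} {X : V} :
    Exposes (G.subst σ) X ↔ ∃ W, Exposes G W ∧ Exposes (σ W) X := by
  constructor
  · intro h
    obtain ⟨n, h⟩ := h.fires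
    rcases h.of_subst hσ G rfl with ⟨b, G', hs, ho⟩ | ⟨W, hW, m, _, hf⟩
    · simp at ho
    · exact ⟨W, hW, hf.shows⟩
  · rintro ⟨W, hW, hf⟩
    exact hW.shows_subst hσ (o := Sum.inr X) hf

/-- After one unfolding, an outcome obtained through an exposed `Y` is an outcome of the same
recursion with fewer unfoldings. Strong induction disposes of these cases, so unguarded
self-reference contributes nothing of its own. -/
theorem Fires.of_mu_subst {σ : V → Expr V A} (hσ : Normal σ) {Y : V} {E : Expr V A} :
    ∀ (n : ℕ) {o : (Act A × Expr V A) ⊕ V}, Fires n ((Expr.mu Y E).subst σ) o →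
      (∃ a E', Step E a E' ∧
        o = Sum.inl (a, E'.subst (Function.update σ Y ((Expr.mu Y E).subst σ)))) ∨
      (∃ W, W ≠ Y ∧ Exposes E W ∧ Shows (σ W) o) := by
  intro n
  induction n using Nat.strong_induction_on with
  | _ n ih =>
    intro o h
    have hρ : Normal (Function.update σ Y ((Expr.mu Y E).subst σ)) := hσ.update Y (hσ.nf_subst _)
    have h' : ∃ m, m < n ∧ Fires m (E.subst (Function.update σ Y ((Expr.mu Y E).subst σ))) o := by
      rw [← unfold_mu_subst hσ]
      cases h with
      | mu h => exact ⟨_, Nat.lt_succ_self _, h⟩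
    obtain ⟨m, hmn, hm⟩ := h'
    rcases hm.of_subst hρ E rfl with h1 | ⟨W, hW, k, hk, hf⟩
    · exact .inl h1
    · by_cases hWY : W = Y
      · subst hWY
        simp only [Function.update_self] at hf
        exact ih k (by omega) hf
      · simp only [Function.update_of_ne hWY] at hf
        exact .inr ⟨W, hWY, hW, hf.shows⟩

theorem shows_mu_subst {σ : V → Expr V A} (hσ : Normal σ) {Y : V} {E : Expr V A}
    {o : (Act A × Expr V A) ⊕ V}
    (h : Shows (E.subst (Function.update σ Y ((Expr.mu Y E).subst σ))) o) :
    Shows ((Expr.mu Y E).subst σ) o := by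
  rw [← unfold_mu_subst hσ] at h
  exact h.mu

theorem step_mu_subst_iff {σ : V → Expr V A} (hσ : Normal σ) {Y : V} {E : Expr V A} {a : Act A}
    {T : Expr V A} : Step ((mu Y E).subst σ) a T ↔
      (∃ E', Step E a E' ∧ T = E'.subst (Function.update σ Y ((mu Y E).subst σ))) ∨
      (∃ W, W ≠ Y ∧ Exposes E W ∧ Step (σ W) a T) := by
  have hρ : Normal (Function.update σ Y ((mu Y E).subst σ)) := hσ.update Y (hσ.nf_subst _)
  constructor
  · intro h
    obtain ⟨n, h⟩ := h.fires
    rcases h.of_mu_subst hσ n with ⟨b, E', hs, ho⟩ | h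
    · simp only [Sum.inl.injEq, Prod.mk.injEq] at ho
      obtain ⟨rfl, rfl⟩ := ho
      exact .inl ⟨E', hs, rfl⟩
    · exact .inr h
  · rintro (⟨E', hs, rfl⟩ | ⟨W, hWY, hW, hf⟩)
    · exact shows_mu_subst hσ (o := Sum.inl (a, _)) (hs.subst hρ)
    · exact shows_mu_subst hσ (o := Sum.inl (a, _))
        (hW.shows_subst hρ (by rw [Function.update_of_ne hWY]; exact hf))

theorem exposes_mu_subst_iff {σ : V → Expr V A} (hσ : Normal σ) {Y : V} {E : Expr V A} {X : V} :
    Exposes ((mu Y E).subst σ) X ↔ ∃ W, W ≠ Y ∧ Exposes E W ∧ Exposes (σ W) X := by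
  have hρ : Normal (Function.update σ Y ((mu Y E).subst σ)) := hσ.update Y (hσ.nf_subst _)
  constructor
  · intro h
    obtain ⟨n, h⟩ := h.fires
    rcases h.of_mu_subst hσ n with ⟨b, E', hs, ho⟩ | h
    · simp at ho
    · exact h
  · rintro ⟨W, hWY, hW, hf⟩
    exact shows_mu_subst hσ (o := Sum.inr X)
      (hW.shows_subst hρ (by rw [Function.update_of_ne hWY]; exact hf))

@[simp] theorem not_step_nil {a : Act A} {T : Expr V A} : ¬ Step nil a T := nofun

@[simp] theorem not_step_var {X : V} {a : Act A} {T : Expr V A} : ¬ Step (var X) a T := nofun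

@[simp] theorem step_pre_iff {a b : Act A} {E T : Expr V A} :
    Step (pre a E) b T ↔ b = a ∧ T = E :=
  ⟨fun h => by cases h; exact ⟨rfl, rfl⟩, by rintro ⟨rfl, rfl⟩; exact .pre _ _⟩

@[simp] theorem step_sum_iff {a : Act A} {E F T : Expr V A} :
    Step (sum E F) a T ↔ Step E a T ∨ Step F a T :=
  ⟨fun h => by cases h <;> simp_all, fun h => h.elim (.sum_left _) (.sum_right _)⟩

@[simp] theorem not_exposes_nil {X : V} : ¬ Exposes (nil : Expr V A) X := nofun

@[simp] theorem not_exposes_pre {a : Act A} {E : Expr V A} {X : V} : ¬ Exposes (pre a E) X := nofun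

@[simp] theorem exposes_var_iff {X Y : V} : Exposes (var X : Expr V A) Y ↔ Y = X :=
  ⟨fun h => by cases h; rfl, fun h => h ▸ .var X⟩

@[simp] theorem exposes_sum_iff {E F : Expr V A} {X : V} :
    Exposes (sum E F) X ↔ Exposes E X ∨ Exposes F X :=
  ⟨fun h => by cases h <;> simp_all, fun h => h.elim (.sum_left _) (.sum_right _)⟩

theorem step_nf_mu_iff {Y : V} {E : Expr V A} {a : Act A} {T : Expr V A} :
    Step (mu Y E).nf a T ↔
      ∃ E', Step E a E' ∧ T = E'.subst (Function.update var Y (mu Y E).nf) := by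
  unfold nf; rw [step_mu_subst_iff normal_var]; simp

theorem exposes_nf_mu_iff {Y : V} {E : Expr V A} {X : V} :
    Exposes (mu Y E).nf X ↔ Exposes E X ∧ X ≠ Y := by
  unfold nf; rw [exposes_mu_subst_iff normal_var]
  simp only [exposes_var_iff]
  exact ⟨fun ⟨W, h1, h2, h3⟩ => h3 ▸ ⟨h2, h1⟩, fun ⟨h1, h2⟩ => ⟨X, h2, h1, rfl⟩⟩

theorem step_nf_iff {E : Expr V A} {a : Act A} {T : Expr V A} :
    Step E.nf a T ↔ ∃ E', Step E a E' ∧ T = E'.nf := by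
  unfold nf; rw [step_subst_iff normal_var]; simp

theorem exposes_nf_iff {E : Expr V A} {X : V} : Exposes E.nf X ↔ Exposes E X := by
  unfold nf; rw [exposes_subst_iff normal_var]; simp

theorem TauStar.subst {σ : V → Expr V A} (hσ : Normal σ) {E F : Expr V A} (h : TauStar E F) :
    TauStar (E.subst σ) (F.subst σ) :=
  Relation.ReflTransGen.lift (r := TauStep) (p := TauStep) (fun E : Expr V A => E.subst σ)
    (fun _ _ h => Step.subst hσ h) _ _ h

theorem TauPlus.subst {σ : V → Expr V A} (hσ : Normal σ) {E F : Expr V A} (h : TauPlus E F) :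
    TauPlus (E.subst σ) (F.subst σ) :=
  Relation.TransGen.lift (r := TauStep) (p := TauStep) (fun E : Expr V A => E.subst σ)
    (fun _ _ h => Step.subst hσ h) _ _ h

end Transitions

theorem exists_run {α : Type*} {r : α → α → Prop} {p : ℕ → α → Prop}
    (h : ∀ n x, p n x → ∃ y, r x y ∧ p (n + 1) y) {x : α} (hx : p 0 x) :
    ∃ f : ℕ → α, f 0 = x ∧ ∀ n, r (f n) (f (n + 1)) ∧ p n (f n) := by
  choose! g hg using h
  let f : ℕ → α := fun n => Nat.rec x (fun n y => g n y) n
  have hp : ∀ n, p n (f n) := fun n => by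
    induction n with
    | zero => exact hx
    | succ n ih => exact (hg n _ ih).2
  exact ⟨f, rfl, fun n => ⟨(hg n _ (hp n)).1, hp n⟩⟩

/-! ### Divergence-preserving branching bisimilarity and its rooted version -/

section Bisimilarity

variable {V : Type u} {A : Type v} [DecidableEq V] [Infinite V]

/-- Every transition and every exposed variable of `E` is matched by `F` at once. -/
def StrongMatch (S : Expr V A → Expr V A → Prop) (E F : Expr V A) : Prop :=
  (∀ a E', Step E a E' → ∃ F', Step F a F' ∧ S E' F') ∧ ∀ X, Exposes E X → Exposes F X

/-- Every transition of `E` is matched by `F`, and not by staying idle. -/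
def ProgressMatch (S : Expr V A → Expr V A → Prop) (E F : Expr V A) : Prop :=
  (∀ a E', Step E a E' → ∃ F' F'', TauStar F F' ∧ Step F' a F'' ∧ S E F' ∧ S E' F'') ∧
  ∀ X, Exposes E X → ∃ F', TauStar F F' ∧ S E F' ∧ Exposes F' X

theorem TauStar.refl (E : Expr V A) : TauStar E E := Relation.ReflTransGen.refl

theorem TauStar.trans {E F G : Expr V A} (h : TauStar E F) (h' : TauStar F G) : TauStar E G :=
  Relation.ReflTransGen.trans h h'

theorem TauStar.single {E F : Expr V A} (h : Step E Act.tau F) : TauStar E F :=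
  Relation.ReflTransGen.single h

theorem TauPlus.single {E F : Expr V A} (h : Step E Act.tau F) : TauPlus E F :=
  Relation.TransGen.single h

theorem TauPlus.star {E F : Expr V A} (h : TauPlus E F) : TauStar E F :=
  Relation.TransGen.to_reflTransGen h

theorem TauStar.tail {E F G : Expr V A} (h : TauStar E F) (h' : Step F Act.tau G) : TauPlus E G :=
  Relation.TransGen.tail' h h'

theorem TauStar.head {E F G : Expr V A} (h : Step E Act.tau F) (h' : TauStar F G) : TauPlus E G :=
  Relation.TransGen.head' h h'

theorem TauStar.trans_plus {E F G : Expr V A} (h : TauStar E F) (h' : TauPlus F G) :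
    TauPlus E G := Relation.TransGen.trans_right h h'

theorem TauPlus.trans_star {E F G : Expr V A} (h : TauPlus E F) (h' : TauStar F G) :
    TauPlus E G := Relation.TransGen.trans_left h h'

theorem TauPlus.exists_head {E F : Expr V A} (h : TauPlus E F) :
    ∃ G, Step E Act.tau G ∧ TauStar G F := by
  obtain ⟨G, h1, h2⟩ := Relation.TransGen.head'_iff.1 h
  exact ⟨G, h1, h2⟩

theorem TauStar.eq_or_plus {E F : Expr V A} (h : TauStar E F) : E = F ∨ TauPlus E F := by
  rcases Relation.reflTransGen_iff_eq_or_transGen.1 h with h | h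
  · exact .inl h.symm
  · exact .inr h

theorem StrongMatch.mono {S S' : Expr V A → Expr V A → Prop} (h : ∀ E F, S E F → S' E F)
    {E F : Expr V A} (hm : StrongMatch S E F) : StrongMatch S' E F :=
  ⟨fun a E' hs => (hm.1 a E' hs).imp fun _ hf => ⟨hf.1, h _ _ hf.2⟩, hm.2⟩

theorem StrongMatch.progress {S : Expr V A → Expr V A → Prop} {E F : Expr V A}
    (hm : StrongMatch S E F) (h : S E F) : ProgressMatch S E F := by
  refine ⟨fun a E' hs => ?_, fun X hX => ⟨F, .refl _, h, hm.2 X hX⟩⟩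
  obtain ⟨F', hF, hS⟩ := hm.1 a E' hs
  exact ⟨F, F', .refl _, hF, h, hS⟩

/-- As no silent step is answered by idling, the first step of an infinite run already provides what
the divergence condition asks for. Only pairs with inert steps need a separate argument. -/
theorem ProgressMatch.divBranching {S : Expr V A → Expr V A → Prop} {E F : Expr V A}
    (hm : ProgressMatch S E F) : DivBranching S E F := by
  refine ⟨⟨fun a E' hs => .inr (hm.1 a E' hs), hm.2⟩, fun run h0 hr => ?_⟩
  have h1 := hr 0
  rw [h0] at h1
  obtain ⟨F', F'', h2, h3, _, h4⟩ := hm.1 _ _ h1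
  exact ⟨1, F'', h2.tail h3, h4⟩

theorem DivBranching.mono {S S' : Expr V A → Expr V A → Prop} (h : ∀ E F, S E F → S' E F)
    {E F : Expr V A} (hm : DivBranching S E F) : DivBranching S' E F := by
  obtain ⟨⟨h1, h2⟩, h3⟩ := hm
  refine ⟨⟨fun a E' hs => ?_, fun X hX => ?_⟩, fun run h0 hr => ?_⟩
  · rcases h1 a E' hs with ⟨ha, F', hF, h4, h5⟩ | ⟨F', F'', hF, h4, h5, h6⟩
    · exact .inl ⟨ha, F', hF, h _ _ h4, h _ _ h5⟩
    · exact .inr ⟨F', F'', hF, h4, h _ _ h5, h _ _ h6⟩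
  · obtain ⟨F', hF, h4, h5⟩ := h2 X hX
    exact ⟨F', hF, h _ _ h4, h5⟩
  · obtain ⟨k, F', hF, h4⟩ := h3 run h0 hr
    exact ⟨k, F', hF, h _ _ h4⟩

theorem IsDivBranchingBisim.star {R : Expr V A → Expr V A → Prop} (hR : IsDivBranchingBisim R)
    {E F E' : Expr V A} (h : R E F) (hE : TauStar E E') : ∃ F', TauStar F F' ∧ R E' F' := by
  induction hE with
  | refl => exact ⟨F, .refl _, h⟩
  | tail _ hs ih =>
    obtain ⟨F', hF, hR'⟩ := ih
    rcases (hR.2 _ _ hR').1.1 _ _ hs with ⟨_, F'', h1, _, h2⟩ | ⟨F'', F''', h1, h2, _, h3⟩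
    · exact ⟨F'', hF.trans h1, h2⟩
    · exact ⟨F''', hF.trans (h1.tail h2).star, h3⟩

/-- An infinite silent run can be followed by a run from which one can always get, silently,
to expressions related to those of the given run. -/
theorem IsDivBranchingBisim.run {R : Expr V A → Expr V A → Prop} (hR : IsDivBranchingBisim R)
    {F : Expr V A} {run : ℕ → Expr V A} (hr : ∀ k, TauStep (run k) (run (k + 1)))
    (h : R (run 0) F) : ∃ run' : ℕ → Expr V A, run' 0 = F ∧
      ∀ n, TauStep (run' n) (run' (n + 1)) ∧ ∃ k T, TauPlus (run' n) T ∧ R (run k) T := by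
  have key : ∀ k F, R (run k) F → ∃ l T, TauPlus F T ∧ R (run l) T := by
    intro k F h
    obtain ⟨l, T, h1, h2⟩ := (hR.2 _ _ h).2 (fun n => run (k + n)) rfl fun n => hr (k + n)
    exact ⟨k + l, T, h1, h2⟩
  refine exists_run (r := TauStep) (p := fun _ F => ∃ k T, TauPlus F T ∧ R (run k) T) ?_
    (key 0 F h)
  rintro - F ⟨k, T, h1, h2⟩
  obtain ⟨G, h3, h4⟩ := h1.exists_head
  refine ⟨G, h3, ?_⟩
  -- Either the target `T` is still ahead, or it has just been reached and the divergence condition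
  -- supplies a new one.
  rcases h4.eq_or_plus with rfl | h5
  · exact key k G h2
  · exact ⟨k, T, h5, h2⟩

theorem divBisimilar_isBisim : IsDivBranchingBisim (DivBisimilar (V := V) (A := A)) := by
  constructor
  · rintro E F ⟨R, hR, h⟩
    exact ⟨R, hR, hR.1 _ _ h⟩
  · rintro E F ⟨R, hR, h⟩
    exact (hR.2 E F h).mono fun _ _ h => ⟨R, hR, h⟩

theorem DivBisimilar.symm {E F : Expr V A} (h : DivBisimilar E F) : DivBisimilar F E :=
  divBisimilar_isBisim.1 _ _ h

theorem DivBisimilar.divBranching {E F : Expr V A} (h : DivBisimilar E F) :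
    DivBranching DivBisimilar E F := divBisimilar_isBisim.2 _ _ h

theorem DivBisimilar.star {E F E' : Expr V A} (h : DivBisimilar E F) (hE : TauStar E E') :
    ∃ F', TauStar F F' ∧ DivBisimilar E' F' := divBisimilar_isBisim.star h hE

/-- The union of a relation, its converse and bisimilarity. -/
def Bis (R : Expr V A → Expr V A → Prop) (E F : Expr V A) : Prop :=
  R E F ∨ R F E ∨ DivBisimilar E F

theorem Bis.symm {R : Expr V A → Expr V A → Prop} {E F : Expr V A} (h : Bis R E F) :
    Bis R F E := by
  rcases h with h | h | h
  · exact .inr (.inl h)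
  · exact .inl h
  · exact .inr (.inr h.symm)

/-- Coinduction up to symmetry and bisimilarity: the answers may be related by `R`, by its converse,
or by bisimilarity already established. -/
theorem divBisimilar_of_bis {R : Expr V A → Expr V A → Prop}
    (h : ∀ E F, R E F → DivBranching (Bis R) E F ∧ DivBranching (Bis R) F E) {E F : Expr V A}
    (hEF : Bis R E F) : DivBisimilar E F := by
  refine ⟨Bis R, ⟨fun E F h => h.symm, ?_⟩, hEF⟩
  rintro E F (hR | hR | hb)
  · exact (h E F hR).1
  · exact (h F E hR).2
  · exact hb.divBranching.mono fun _ _ h => .inr (.inr h)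

theorem DivBisimilar.refl (E : Expr V A) : DivBisimilar E E := by
  refine divBisimilar_of_bis (R := Eq) ?_ (.inl rfl)
  rintro E _ rfl
  have : StrongMatch (Bis Eq) E E := ⟨fun a E' h => ⟨E', h, .inl rfl⟩, fun _ h => h⟩
  exact ⟨(this.progress (.inl rfl)).divBranching, (this.progress (.inl rfl)).divBranching⟩

theorem Bis.refl (R : Expr V A → Expr V A → Prop) (E : Expr V A) : Bis R E E :=
  .inr (.inr (.refl E))

theorem DivBisimilar.trans {E F G : Expr V A} (h : DivBisimilar E F) (h' : DivBisimilar F G) :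
    DivBisimilar E G := by
  refine ⟨fun E G => ∃ F, DivBisimilar E F ∧ DivBisimilar F G, ⟨?_, ?_⟩, F, h, h'⟩
  · rintro E G ⟨F, h, h'⟩
    exact ⟨F, h'.symm, h.symm⟩
  · rintro E G ⟨F, h, h'⟩
    refine ⟨⟨fun a E' hs => ?_, fun X hX => ?_⟩, ?_⟩
    · rcases h.divBranching.1.1 a E' hs with ⟨ha, F', hF, h1, h2⟩ | ⟨F', F'', hF, h1, h2, h3⟩
      · obtain ⟨G', hG, h3⟩ := h'.star hF
        exact .inl ⟨ha, G', hG, ⟨F', h1, h3⟩, ⟨F', h2, h3⟩⟩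
      · obtain ⟨G', hG, h4⟩ := h'.star hF
        rcases h4.divBranching.1.1 a F'' h1 with ⟨ha, G'', h5, h6, h7⟩ | ⟨G'', G''', h5, h6, h7, h8⟩
        · exact .inl ⟨ha, G'', hG.trans h5, ⟨F', h2, h6⟩, ⟨F'', h3, h7⟩⟩
        · exact .inr ⟨G'', G''', hG.trans h5, h6, ⟨F', h2, h7⟩, ⟨F'', h3, h8⟩⟩
    · obtain ⟨F', hF, h1, h2⟩ := h.divBranching.1.2 X hX
      obtain ⟨G', hG, h3⟩ := h'.star hF
      obtain ⟨G'', hG', h4, h5⟩ := h3.divBranching.1.2 X h2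
      exact ⟨G'', hG.trans hG', ⟨F', h1, h4⟩, h5⟩
    · rintro run rfl hr
      -- The divergence condition for `E` and `F` yields single expressions only, while the one for
      -- `F` and `G` needs a run. The run of `F` built here never loses silent access to partners of
      -- the original run, so an answer of `G` can be prolonged to such a partner.
      obtain ⟨run', h0, hr'⟩ := divBisimilar_isBisim.run hr h
      obtain ⟨m, G', hG, h1⟩ := h'.divBranching.2 run' h0 fun n => (hr' n).1
      obtain ⟨k, T, h2, h3⟩ := (hr' m).2
      obtain ⟨G'', h4, h5⟩ := h1.star h2.star
      exact ⟨k, G'', hG.trans_star h4, T, h3, h5⟩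

/-- Stuttering. -/
theorem DivBisimilar.stutter {E F G : Expr V A} (hEF : TauStar E F) (hFG : TauStar F G)
    (h : DivBisimilar E G) : DivBisimilar E F := by
  refine divBisimilar_of_bis (R := fun E F => TauStar E F ∧ ∃ G, TauStar F G ∧ DivBisimilar E G)
    ?_ (.inl ⟨hEF, G, hFG, h⟩)
  clear hEF hFG h E F G
  rintro E F ⟨hEF, G, hFG, h⟩
  obtain ⟨⟨h1, h2⟩, h3⟩ := h.divBranching.mono
    (S' := Bis fun E F => TauStar E F ∧ ∃ G, TauStar F G ∧ DivBisimilar E G)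
    fun _ _ h => .inr (.inr h)
  refine ⟨⟨⟨fun a E' hs => ?_, fun X hX => ?_⟩, fun run h0 hr => ?_⟩, ?_⟩
  · rcases h1 a E' hs with ⟨ha, G', hG, h4⟩ | ⟨G', G'', hG, h4⟩
    · exact .inl ⟨ha, G', hFG.trans hG, h4⟩
    · exact .inr ⟨G', G'', hFG.trans hG, h4⟩
  · obtain ⟨G', hG, h4⟩ := h2 X hX
    exact ⟨G', hFG.trans hG, h4⟩
  · obtain ⟨k, G', hG, h4⟩ := h3 run h0 hr
    exact ⟨k, G', hFG.trans_plus hG, h4⟩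
  -- Whatever `F` does, `E` answers by first going silently to `F`.
  · refine ProgressMatch.divBranching ⟨fun a F' hs => ?_, fun X hX => ?_⟩
    · exact ⟨F, F', hEF, hs, .refl _ _, .refl _ _⟩
    · exact ⟨F, hEF, .refl _ _, hX⟩

/-- Rooted divergence-preserving branching bisimilarity. -/
def Rooted (E F : Expr V A) : Prop :=
  StrongMatch DivBisimilar E F ∧ StrongMatch DivBisimilar F E

theorem Rooted.refl (E : Expr V A) : Rooted E E :=
  ⟨⟨fun _ E' h => ⟨E', h, .refl _⟩, fun _ h => h⟩, ⟨fun _ E' h => ⟨E', h, .refl _⟩, fun _ h => h⟩⟩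

theorem Rooted.symm {E F : Expr V A} (h : Rooted E F) : Rooted F E := ⟨h.2, h.1⟩

theorem StrongMatch.trans {E F G : Expr V A} (h : StrongMatch DivBisimilar E F)
    (h' : StrongMatch DivBisimilar F G) : StrongMatch DivBisimilar E G := by
  refine ⟨fun a E' hs => ?_, fun X hX => h'.2 X (h.2 X hX)⟩
  obtain ⟨F', h1, h2⟩ := h.1 a E' hs
  obtain ⟨G', h3, h4⟩ := h'.1 a F' h1
  exact ⟨G', h3, h2.trans h4⟩

theorem Rooted.trans {E F G : Expr V A} (h : Rooted E F) (h' : Rooted F G) : Rooted E G :=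
  ⟨h.1.trans h'.1, h'.2.trans h.2⟩

theorem Rooted.divBisimilar {E F : Expr V A} (h : Rooted E F) : DivBisimilar E F := by
  refine divBisimilar_of_bis (R := Rooted) ?_ (.inl h)
  intro E F h
  exact ⟨((h.1.mono fun _ _ h => .inr (.inr h)).progress (.inl h)).divBranching,
    ((h.2.mono fun _ _ h => .inr (.inr h)).progress (.inr (.inl h))).divBranching⟩

theorem Rooted.nf (E : Expr V A) : Rooted E E.nf := by
  have key : ∀ {E F : Expr V A},
      Bis (fun E F => F = E.nf) E F → DivBisimilar E F := by
    refine fun {_ _} h => divBisimilar_of_bis ?_ h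
    rintro E F rfl
    constructor
    · refine (StrongMatch.progress ⟨fun a E' h => ?_, fun X h => exposes_nf_iff.2 h⟩
        (.inl rfl)).divBranching
      exact ⟨E'.nf, step_nf_iff.2 ⟨E', h, rfl⟩, .inl rfl⟩
    · refine (StrongMatch.progress ⟨fun a E' h => ?_, fun X h => exposes_nf_iff.1 h⟩
        (.inr (.inl rfl))).divBranching
      obtain ⟨T, hT, rfl⟩ := step_nf_iff.1 h
      exact ⟨T, hT, .inr (.inl rfl)⟩
  refine ⟨⟨fun a E' h => ?_, fun X h => exposes_nf_iff.2 h⟩,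
    ⟨fun a E' h => ?_, fun X h => exposes_nf_iff.1 h⟩⟩
  · exact ⟨E'.nf, step_nf_iff.2 ⟨E', h, rfl⟩, key (.inl rfl)⟩
  · obtain ⟨T, hT, rfl⟩ := step_nf_iff.1 h
    exact ⟨T, hT, key (.inr (.inl rfl))⟩

theorem Rooted.of_nf {E F : Expr V A} (h : Rooted E.nf F.nf) : Rooted E F :=
  (Rooted.nf E).trans (h.trans (Rooted.nf F).symm)

/-- Matching extends from the values of two substitutions to all instances. -/
theorem StrongMatch.subst {S : Expr V A → Expr V A → Prop} {σ ρ : V → Expr V A} (hσ : Normal σ)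
    (hρ : Normal ρ) (hK : ∀ K : Expr V A, S (K.subst σ) (K.subst ρ))
    (h : ∀ W, StrongMatch S (σ W) (ρ W)) (K : Expr V A) :
    StrongMatch S (K.subst σ) (K.subst ρ) := by
  refine ⟨fun a T hs => ?_, fun X hX => ?_⟩
  · rcases (step_subst_iff hσ).1 hs with ⟨K', h1, rfl⟩ | ⟨W, h1, h2⟩
    · exact ⟨_, h1.subst hρ, hK K'⟩
    · obtain ⟨F', h3, h4⟩ := (h W).1 a T h2
      exact ⟨F', (step_subst_iff hρ).2 (.inr ⟨W, h1, h3⟩), h4⟩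
  · obtain ⟨W, h1, h2⟩ := (exposes_subst_iff hσ).1 hX
    exact (exposes_subst_iff hρ).2 ⟨W, h1, (h W).2 X h2⟩

/-- Pairs of instances under normal substitutions with pointwise equal or related values. -/
def Instances (R : Expr V A → Expr V A → Prop) (E F : Expr V A) : Prop :=
  ∃ (K : Expr V A) (σ ρ : V → Expr V A), Normal σ ∧ Normal ρ ∧
    (∀ W, σ W = ρ W ∨ R (σ W) (ρ W)) ∧ E = K.subst σ ∧ F = K.subst ρ

theorem StrongMatch.refl {S : Expr V A → Expr V A → Prop} (hS : ∀ E, S E E) (E : Expr V A) :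
    StrongMatch S E E := ⟨fun _ E' h => ⟨E', h, hS E'⟩, fun _ h => h⟩

/-- It suffices to match the substituted values: a context hands on the transitions of the values it
exposes, and its own transitions lead to instances of the same two substitutions. Each axiom for
recursion treated through this lemma reduces to comparing a few unfoldings. -/
theorem Instances.bisimilar {R : Expr V A → Expr V A → Prop}
    (h : ∀ E F, R E F → StrongMatch (Bis (Instances R)) E F ∧ StrongMatch (Bis (Instances R)) F E)
    {E F : Expr V A} (hEF : Instances R E F) : DivBisimilar E F := by
  refine divBisimilar_of_bis (R := Instances R) ?_ (.inl hEF)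
  rintro _ _ ⟨K, σ, ρ, hσ, hρ, hR, rfl, rfl⟩
  have hK : ∀ K : Expr V A, Bis (Instances R) (K.subst σ) (K.subst ρ) := fun K =>
    .inl ⟨K, σ, ρ, hσ, hρ, hR, rfl, rfl⟩
  constructor
  · refine ((StrongMatch.subst hσ hρ hK (fun W => ?_) K).progress (hK K)).divBranching
    rcases hR W with h1 | h1
    · rw [h1]; exact .refl (Bis.refl _) _
    · exact (h _ _ h1).1
  · refine ((StrongMatch.subst hρ hσ (fun K => (hK K).symm) (fun W => ?_) K).progress
      (hK K).symm).divBranching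
    rcases hR W with h1 | h1
    · rw [h1]; exact .refl (Bis.refl _) _
    · exact (h _ _ h1).2

theorem Instances.rooted {R : Expr V A → Expr V A → Prop}
    (h : ∀ E F, R E F → StrongMatch (Bis (Instances R)) E F ∧ StrongMatch (Bis (Instances R)) F E)
    {E F : Expr V A} (hEF : R E F) : Rooted E F := by
  have key : ∀ E F, Bis (Instances R) E F → DivBisimilar E F := by
    rintro E F (h1 | h1 | h1)
    · exact h1.bisimilar h
    · exact (h1.bisimilar h).symm
    · exact h1
  exact ⟨(h E F hEF).1.mono key, (h E F hEF).2.mono key⟩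

/-- Rooted bisimilarity is preserved when rooted bisimilar expressions are substituted. -/
theorem Rooted.subst {σ ρ : V → Expr V A} (hσ : Normal σ) (hρ : Normal ρ)
    (h : ∀ W, Rooted (σ W) (ρ W)) (K : Expr V A) : Rooted (K.subst σ) (K.subst ρ) := by
  let R : Expr V A → Expr V A → Prop := fun E F =>
    (∃ K : Expr V A, E = K.subst σ ∧ F = K.subst ρ)
  have hB : ∀ K : Expr V A, Bis R (K.subst σ) (K.subst ρ) := fun K => .inl ⟨K, rfl, rfl⟩
  have h1 : ∀ K : Expr V A, StrongMatch (Bis R) (K.subst σ) (K.subst ρ) :=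
    StrongMatch.subst hσ hρ hB fun W => (h W).1.mono fun _ _ h => .inr (.inr h)
  have h2 : ∀ K : Expr V A, StrongMatch (Bis R) (K.subst ρ) (K.subst σ) :=
    StrongMatch.subst hρ hσ (fun K => (hB K).symm) fun W =>
      (h W).2.mono fun _ _ h => .inr (.inr h)
  have key : ∀ E F, Bis R E F → DivBisimilar E F := fun E F => divBisimilar_of_bis (by
    rintro _ _ ⟨K, rfl, rfl⟩
    exact ⟨((h1 K).progress (hB K)).divBranching, ((h2 K).progress (hB K).symm).divBranching⟩)
  exact ⟨(h1 K).mono key, (h2 K).mono key⟩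

end Bisimilarity

/-! ### Congruence under recursion, axiom B and unique solution of guarded equations -/

section Soundness

variable {V : Type u} {A : Type v} [DecidableEq V] [Infinite V]

theorem Rooted.pre (a : Act A) {E F : Expr V A} (h : DivBisimilar E F) :
    Rooted (pre a E) (pre a F) := by
  refine ⟨⟨fun b T hs => ?_, fun X hX => by simp at hX⟩, ⟨fun b T hs => ?_, fun X hX => by simp at hX⟩⟩
  · obtain ⟨rfl, rfl⟩ := step_pre_iff.1 hs
    exact ⟨F, .pre _ _, h⟩
  · obtain ⟨rfl, rfl⟩ := step_pre_iff.1 hs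
    exact ⟨E, .pre _ _, h.symm⟩

theorem StrongMatch.sum {S : Expr V A → Expr V A → Prop} {E E' F F' : Expr V A}
    (h : StrongMatch S E E') (h' : StrongMatch S F F') :
    StrongMatch S (sum E F) (sum E' F') := by
  refine ⟨fun a T hs => ?_, fun X hX => ?_⟩
  · rcases step_sum_iff.1 hs with hs | hs
    · exact (h.1 a T hs).imp fun _ h => ⟨h.1.sum_left _, h.2⟩
    · exact (h'.1 a T hs).imp fun _ h => ⟨h.1.sum_right _, h.2⟩
  · rcases exposes_sum_iff.1 hX with hX | hX
    · exact (h.2 X hX).sum_left _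
    · exact (h'.2 X hX).sum_right _

theorem Rooted.sum {E E' F F' : Expr V A} (h : Rooted E E') (h' : Rooted F F') :
    Rooted (sum E F) (sum E' F') := ⟨h.1.sum h'.1, h.2.sum h'.2⟩

/-- Expressions with the same transitions and the same exposed variables are rooted bisimilar. -/
theorem Rooted.of_iff {E F : Expr V A} (h1 : ∀ a T, Step E a T ↔ Step F a T)
    (h2 : ∀ X, Exposes E X ↔ Exposes F X) : Rooted E F :=
  ⟨⟨fun a T h => ⟨T, (h1 a T).1 h, .refl _⟩, fun X h => (h2 X).1 h⟩,
    ⟨fun a T h => ⟨T, (h1 a T).2 h, .refl _⟩, fun X h => (h2 X).2 h⟩⟩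

theorem Rooted.unfold (X : V) (E : Expr V A) : Rooted (Expr.mu X E) (E.subst₁ X (Expr.mu X E)) :=
  .of_iff (fun _ _ => ⟨fun h => by cases h; assumption, .mu⟩)
    (fun _ => ⟨fun h => by cases h; assumption, .mu⟩)

theorem nf_mu_rename {X Y : V} {E : Expr V A} (h : Y ∉ (mu X E).FV) :
    (mu Y (E.subst₁ X (var Y))).nf = (mu X E).nf := by
  have hE : ∀ W ∈ E.FV, W ≠ X → W ≠ Y := by
    rintro W hW hWX rfl
    exact h (Finset.mem_erase.2 ⟨hWX, hW⟩)
  have hFV : (E.subst₁ X (var Y)).FV.erase Y = E.FV.erase X := by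
    ext W
    simp only [subst₁, FV_subst, Finset.mem_erase, Finset.mem_biUnion]
    constructor
    · rintro ⟨hWY, U, hU, hWU⟩
      by_cases hUX : U = X
      · subst hUX; simp [FV] at hWU; exact absurd hWU hWY
      · simp [Function.update_of_ne hUX, FV] at hWU; subst hWU; exact ⟨hUX, hU⟩
    · rintro ⟨hWX, hW⟩
      exact ⟨hE W hW hWX, W, hW, by simp [Function.update_of_ne hWX, FV]⟩
  simp only [nf, subst, hFV]
  congr 1
  rw [subst_subst₁]
  refine subst_congr _ fun W hW => ?_
  by_cases hWX : W = X
  · subst hWX; simp [subst]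
  · simp [Function.update_of_ne hWX, Function.update_of_ne (hE W hW hWX)]

/-- If `G` moves by itself, its bisimilarity with `H` gives the answer. If it moves through an
exposed `X`, then `H` silently reaches an expression exposing `X` (the condition on exposed
variables), and rootedness lets `μX.F` answer the move of `μX.E` at once. -/
theorem mu_congr_half {X : V} {E F : Expr V A} (h : StrongMatch DivBisimilar E F)
    {G H : Expr V A} (hGH : DivBisimilar G H) :
    DivBranching (fun U W => ∃ G H : Expr V A, DivBisimilar G H ∧
      U = G.subst (Function.update var X (mu X E).nf) ∧
      W = H.subst (Function.update var X (mu X F).nf))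
      (G.subst (Function.update var X (mu X E).nf))
      (H.subst (Function.update var X (mu X F).nf)) := by
  have hσ : Normal (Function.update var X (mu X E).nf) := normal_var.update X (nf_nf _)
  have hρ : Normal (Function.update var X (mu X F).nf) := normal_var.update X (nf_nf _)
  have hstep : ∀ {G : Expr V A} {a T}, Step (G.subst (Function.update var X (mu X E).nf)) a T →
      (∃ G', Step G a G' ∧ T = G'.subst (Function.update var X (mu X E).nf)) ∨
      (Exposes G X ∧ ∃ E', Step E a E' ∧ T = E'.subst (Function.update var X (mu X E).nf)) := by
    intro G a T hs
    rcases (step_subst_iff hσ).1 hs with h1 | ⟨W, h1, h2⟩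
    · exact .inl h1
    · by_cases hW : W = X
      · subst hW
        rw [Function.update_self, step_nf_mu_iff] at h2
        exact .inr ⟨h1, h2⟩
      · simp [Function.update_of_ne hW] at h2
  have hroot : ∀ {G H : Expr V A} {a E'}, DivBisimilar G H → Exposes G X → Step E a E' →
      ∃ H' F', TauStar H H' ∧ DivBisimilar G H' ∧ DivBisimilar E' F' ∧
        Step (H'.subst (Function.update var X (mu X F).nf)) a
          (F'.subst (Function.update var X (mu X F).nf)) := by
    intro G H a E' hGH hG hE
    obtain ⟨H', h1, h2, h3⟩ := hGH.divBranching.1.2 X hG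
    obtain ⟨F', h4, h5⟩ := h.1 a E' hE
    refine ⟨H', F', h1, h2, h5, (step_subst_iff hρ).2 (.inr ⟨X, h3, ?_⟩)⟩
    rw [Function.update_self, step_nf_mu_iff]
    exact ⟨F', h4, rfl⟩
  refine ⟨⟨fun a T hs => ?_, fun Y hY => ?_⟩, fun run h0 hr => ?_⟩
  · rcases hstep hs with ⟨G', h1, rfl⟩ | ⟨h1, E', h2, rfl⟩
    · rcases hGH.divBranching.1.1 a G' h1 with ⟨ha, H', h3, h4, h5⟩ | ⟨H', H'', h3, h4, h5, h6⟩
      · exact .inl ⟨ha, _, h3.subst hρ, ⟨G, H', h4, rfl, rfl⟩, ⟨G', H', h5, rfl, rfl⟩⟩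
      · exact .inr ⟨_, _, h3.subst hρ, h4.subst hρ, ⟨G, H', h5, rfl, rfl⟩, ⟨G', H'', h6, rfl, rfl⟩⟩
    · obtain ⟨H', F', h3, h4, h5, h6⟩ := hroot hGH h1 h2
      exact .inr ⟨_, _, h3.subst hρ, h6, ⟨G, H', h4, rfl, rfl⟩, ⟨E', F', h5, rfl, rfl⟩⟩
  · obtain ⟨W, h1, h2⟩ := (exposes_subst_iff hσ).1 hY
    obtain ⟨H', h3, h4, h5⟩ := hGH.divBranching.1.2 W h1
    refine ⟨_, h3.subst hρ, ⟨G, H', h4, rfl, rfl⟩, (exposes_subst_iff hρ).2 ⟨W, h5, ?_⟩⟩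
    by_cases hW : W = X
    · subst hW
      rw [Function.update_self, exposes_nf_mu_iff] at h2 ⊢
      exact ⟨h.2 _ h2.1, h2.2⟩
    · rw [Function.update_of_ne hW] at h2 ⊢
      exact h2
  -- If no member of the run could be answered, the run would never unfold `X`, because such a step
  -- is answered by `hroot`. So it would come from a run of `G` alone, and that run is answered by
  -- `H`.
  · by_contra hcon
    obtain ⟨f, hf0, hf⟩ := exists_run (r := TauStep)
      (p := fun n G' => TauStar G G' ∧ run n = G'.subst (Function.update var X (mu X E).nf))
      (fun n G' hG' => by
        have hn := hr n
        rw [hG'.2] at hn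
        rcases hstep hn with ⟨G'', h1, h2⟩ | ⟨h1, E', h2, h3⟩
        · exact ⟨G'', h1, (hG'.1.tail h1).star, h2⟩
        · exfalso
          obtain ⟨H₁, h4, h5⟩ := hGH.star hG'.1
          obtain ⟨H', F', h6, _, h8, h9⟩ := hroot h5 h1 h2
          exact hcon ⟨n + 1, _, ((h4.trans h6).subst hρ).tail h9, E', F', h8, h3, rfl⟩)
      (x := G) ⟨.refl _, h0⟩
    obtain ⟨k, H', h1, h2⟩ := hGH.divBranching.2 f hf0 fun n => (hf n).1
    exact hcon ⟨k, _, h1.subst hρ, f k, H', h2, (hf k).2.2, rfl⟩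

theorem Rooted.mu (X : V) {E F : Expr V A} (h : Rooted E F) :
    Rooted (Expr.mu X E) (Expr.mu X F) := by
  have key : ∀ {G H : Expr V A}, DivBisimilar G H →
      DivBisimilar (G.subst (Function.update var X (Expr.mu X E).nf))
        (H.subst (Function.update var X (Expr.mu X F).nf)) := by
    intro G H hGH
    refine divBisimilar_of_bis (R := fun U W => ∃ G H : Expr V A, DivBisimilar G H ∧
      U = G.subst (Function.update var X (Expr.mu X E).nf) ∧
      W = H.subst (Function.update var X (Expr.mu X F).nf)) ?_ (.inl ⟨G, H, hGH, rfl, rfl⟩)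
    rintro _ _ ⟨G, H, hGH, rfl, rfl⟩
    refine ⟨(mu_congr_half h.1 hGH).mono fun _ _ h => .inl h,
      (mu_congr_half h.2 hGH.symm).mono ?_⟩
    rintro _ _ ⟨G, H, hGH, rfl, rfl⟩
    exact .inr (.inl ⟨H, G, hGH.symm, rfl, rfl⟩)
  refine Rooted.of_nf ⟨⟨fun a T hs => ?_, fun Y hY => ?_⟩, ⟨fun a T hs => ?_, fun Y hY => ?_⟩⟩
  · obtain ⟨E', h1, rfl⟩ := step_nf_mu_iff.1 hs
    obtain ⟨F', h2, h3⟩ := h.1.1 a E' h1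
    exact ⟨_, step_nf_mu_iff.2 ⟨F', h2, rfl⟩, key h3⟩
  · rw [exposes_nf_mu_iff] at hY ⊢
    exact ⟨h.1.2 _ hY.1, hY.2⟩
  · obtain ⟨E', h1, rfl⟩ := step_nf_mu_iff.1 hs
    obtain ⟨F', h2, h3⟩ := h.2.1 a E' h1
    exact ⟨_, step_nf_mu_iff.2 ⟨F', h2, rfl⟩, (key h3.symm).symm⟩
  · rw [exposes_nf_mu_iff] at hY ⊢
    exact ⟨h.2.2 _ hY.1, hY.2⟩

/-- Behind the prefix, the silent step to `E + F` is inert, since `F` remains available after it: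
one side answers it by idling, the other may take it before every move. -/
theorem rooted_branching_axiom (a : Act A) (E F : Expr V A) :
    Rooted (pre a (sum (pre Act.tau (sum E F)) F)) (pre a (sum E F)) := by
  refine Rooted.pre a (divBisimilar_of_bis
    (R := fun U W => U = sum (Expr.pre Act.tau (sum E F)) F ∧ W = sum E F) ?_ (.inl ⟨rfl, rfl⟩))
  rintro _ _ ⟨rfl, rfl⟩
  constructor
  · refine ⟨⟨fun b T hs => ?_, fun X hX => ?_⟩, fun run h0 hr => ?_⟩
    · rcases step_sum_iff.1 hs with hs | hs
      · obtain ⟨rfl, rfl⟩ := step_pre_iff.1 hs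
        exact .inl ⟨rfl, _, .refl _, .inl ⟨rfl, rfl⟩, Bis.refl _ _⟩
      · exact .inr ⟨_, T, .refl _, hs.sum_right _, .inl ⟨rfl, rfl⟩, Bis.refl _ _⟩
    · simp only [exposes_sum_iff, not_exposes_pre, false_or] at hX
      exact ⟨_, .refl _, .inl ⟨rfl, rfl⟩, hX.sum_right _⟩
    · have h1 := hr 0
      rw [h0] at h1
      rcases step_sum_iff.1 h1 with hs | hs
      · obtain ⟨-, h2⟩ := step_pre_iff.1 hs
        have h3 := hr 1
        rw [h2] at h3
        -- The first step of the run is inert and leads to `E + F` itself, which then performs the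
        -- second step; hence the index 2.
        exact ⟨2, _, .single h3, Bis.refl _ _⟩
      · exact ⟨1, _, .single (hs.sum_right _), Bis.refl _ _⟩
  · refine ProgressMatch.divBranching ⟨fun b T hs => ?_, fun X hX => ?_⟩
    · exact ⟨_, T, .single (.sum_left _ (.pre _ _)), hs, Bis.refl _ _, Bis.refl _ _⟩
    · exact ⟨_, .single (.sum_left _ (.pre _ _)), Bis.refl _ _, hX⟩

theorem GuardedIn.subst {X : V} : ∀ {G : Expr V A} {σ : V → Expr V A},
    (∀ W, GuardedIn X (σ W) ∨ GuardedIn W G) → GuardedIn X (G.subst σ)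
  | nil, _, _ => trivial
  | var Y, σ, h => by
      rcases h Y with h | h
      · exact h
      · exact absurd rfl h
  | Expr.pre a E, σ, h => by
      by_cases ha : a = Act.tau
      · refine .inr (GuardedIn.subst fun W => (h W).imp_right fun h => h.resolve_left ?_)
        exact fun h => h ha
      · exact .inl ha
  | Expr.sum E F, σ, h =>
      ⟨GuardedIn.subst fun W => (h W).imp_right fun h => h.1,
        GuardedIn.subst fun W => (h W).imp_right fun h => h.2⟩
  | Expr.mu Y E, σ, h => by
      simp only [Expr.subst]
      generalize fresh ((E.FV.erase Y).biUnion fun Y => (σ Y).FV) = Z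
      by_cases hZ : Z = X
      · exact .inl hZ
      · refine .inr (GuardedIn.subst fun W => ?_)
        by_cases hW : W = Y
        · subst hW; left; simpa [GuardedIn] using hZ
        · rw [Function.update_of_ne hW]
          exact (h W).imp_right fun h => h.resolve_left (Ne.symm hW)

theorem GuardedIn.unfold {X Y : V} {E : Expr V A} (h : GuardedIn X (Expr.mu Y E)) :
    GuardedIn X (E.subst₁ Y (Expr.mu Y E)) := by
  refine GuardedIn.subst fun W => ?_
  by_cases hW : W = Y
  · subst hW; left; simpa using h
  · rw [Function.update_of_ne hW]
    by_cases hWX : W = X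
    · subst hWX; exact .inr (h.resolve_left (Ne.symm hW))
    · exact .inl hWX

theorem GuardedIn.step {X : V} {E E' : Expr V A} {a : Act A} (hs : Step E a E')
    (ha : a = Act.tau) (h : GuardedIn X E) : GuardedIn X E' := by
  induction hs with
  | pre a E => exact h.resolve_left fun h => h ha
  | sum_left _ _ ih => exact ih ha h.1
  | sum_right _ _ ih => exact ih ha h.2
  | mu _ ih => exact ih ha h.unfold

theorem GuardedIn.not_exposes {X Y : V} {E : Expr V A} (hs : Exposes E Y)
    (h : GuardedIn X E) : Y ≠ X := by
  induction hs with
  | var Y => exact h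
  | sum_left _ _ ih => exact ih h.1
  | sum_right _ _ ih => exact ih h.2
  | mu _ ih => exact ih h.unfold

theorem Normal.single (X : V) {P : Expr V A} (hP : P.nf = P) :
    Normal (Function.update var X P) := normal_var.update X hP

/-- Guarded instances move without the help of the substituted expression. -/
theorem GuardedIn.of_step_subst {X : V} {P G T : Expr V A} {a : Act A} (hP : P.nf = P)
    (hG : GuardedIn X G) (hs : Step (G.subst (Function.update var X P)) a T) :
    ∃ G', Step G a G' ∧ T = G'.subst (Function.update var X P) := by
  rcases (step_subst_iff (.single X hP)).1 hs with h1 | ⟨W, h1, h2⟩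
  · exact h1
  · simp [Function.update_of_ne (hG.not_exposes h1)] at h2

theorem GuardedIn.of_tauStar_subst {X : V} {P G T : Expr V A} (hP : P.nf = P)
    (hG : GuardedIn X G) (hs : TauStar (G.subst (Function.update var X P)) T) :
    ∃ G', TauStar G G' ∧ GuardedIn X G' ∧ T = G'.subst (Function.update var X P) := by
  induction hs with
  | refl => exact ⟨G, .refl _, hG, rfl⟩
  | tail _ hs ih =>
    obtain ⟨G', h1, h2, rfl⟩ := ih
    obtain ⟨G'', h3, rfl⟩ := h2.of_step_subst hP hs
    exact ⟨G'', (h1.tail h3).star, h2.step h3 rfl, rfl⟩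

theorem GuardedIn.subst₁ {X : V} {E : Expr V A} (hE : GuardedIn X E) (G : Expr V A) :
    GuardedIn X (G.subst₁ X E) := by
  refine GuardedIn.subst fun W => .inl ?_
  by_cases hW : W = X
  · subst hW; simpa using hE
  · rw [Function.update_of_ne hW]; exact hW

/-- Unfolding an equation inside an instance. -/
theorem Rooted.expand {X : V} {E P : Expr V A} (hP : P.nf = P)
    (hPE : Rooted P (E.subst (Function.update var X P))) (G : Expr V A) :
    DivBisimilar (G.subst (Function.update var X P))
      ((G.subst₁ X E).subst (Function.update var X P)) := by
  rw [subst_subst₁]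
  have hn := Normal.single X hP
  refine (Rooted.subst hn (hn.update X (hn.nf_subst _)) (fun W => ?_) G).divBisimilar
  by_cases hW : W = X
  · subst hW; simpa using hPE
  · simpa [Function.update_of_ne hW] using Rooted.refl _

/-- An instance `G{P/X}` with `X` guarded in `G` moves without the help of `P`, and silent steps
keep `X` guarded. So its silent behaviour is that of `G` and can be replayed in `G{Q/X}`. The
relation is closed under bisimilarity on both sides, so that instances can be replaced by unfolded
ones. -/
theorem guarded_half {X : V} {E P Q : Expr V A} (hP : P.nf = P) (hQ : Q.nf = Q)
    (hE : GuardedIn X E) (hPE : Rooted P (E.subst (Function.update var X P)))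
    (hQE : Rooted Q (E.subst (Function.update var X Q))) {U W : Expr V A}
    (h : ∃ G, GuardedIn X G ∧ DivBisimilar U (G.subst (Function.update var X P)) ∧
      DivBisimilar W (G.subst (Function.update var X Q))) :
    DivBranching (fun U W => ∃ G, GuardedIn X G ∧
      DivBisimilar U (G.subst (Function.update var X P)) ∧
      DivBisimilar W (G.subst (Function.update var X Q))) U W := by
  obtain ⟨G, hG, hU, hW⟩ := h
  refine ⟨⟨fun a U' hs => ?_, fun Y hY => ?_⟩, fun run h0 hr => ?_⟩
  · rcases hU.divBranching.1.1 a U' hs with ⟨rfl, K, h1, h2, h3⟩ | ⟨K, K', h1, h2, h3, h4⟩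
    · obtain ⟨G', h4, h5, rfl⟩ := hG.of_tauStar_subst hP h1
      obtain ⟨W', h6, h7⟩ := hW.symm.star (h4.subst (.single X hQ))
      exact .inl ⟨rfl, W', h6, ⟨G', h5, h2, h7.symm⟩, ⟨G', h5, h3, h7.symm⟩⟩
    · obtain ⟨G', h5, h6, rfl⟩ := hG.of_tauStar_subst hP h1
      obtain ⟨G'', h7, rfl⟩ := h6.of_step_subst hP h2
      obtain ⟨W', h8, h9⟩ := hW.symm.star (h5.subst (.single X hQ))
      -- A visible step may leave `X` unguarded in `G''`. Replacing `X` by `E` restores guardedness,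
      -- and `Rooted.expand` shows that this does not change the instances up to bisimilarity.
      rcases h9.divBranching.1.1 a _ (h7.subst (.single X hQ)) with
        ⟨ha, W'', h10, h11, h12⟩ | ⟨W'', W''', h10, h11, h12, h13⟩
      · exact .inl ⟨ha, W'', h8.trans h10, ⟨G', h6, h3, h11.symm⟩,
          ⟨G''.subst₁ X E, hE.subst₁ _, h4.trans (hPE.expand hP _), h12.symm.trans (hQE.expand hQ _)⟩⟩
      · exact .inr ⟨W'', W''', h8.trans h10, h11, ⟨G', h6, h3, h12.symm⟩,
          ⟨G''.subst₁ X E, hE.subst₁ _, h4.trans (hPE.expand hP _), h13.symm.trans (hQE.expand hQ _)⟩⟩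
  · obtain ⟨K, h1, h2, h3⟩ := hU.divBranching.1.2 Y hY
    obtain ⟨G', h4, h5, rfl⟩ := hG.of_tauStar_subst hP h1
    obtain ⟨Z, h6, h7⟩ := (exposes_subst_iff (.single X hP)).1 h3
    have hZ := h5.not_exposes h6
    rw [Function.update_of_ne hZ] at h7
    obtain ⟨W', h8, h9⟩ := hW.symm.star (h4.subst (.single X hQ))
    obtain ⟨W'', h10, h11, h12⟩ := h9.divBranching.1.2 Y
      ((exposes_subst_iff (.single X hQ)).2 ⟨Z, h6, by rwa [Function.update_of_ne hZ]⟩)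
    exact ⟨W'', h8.trans h10, ⟨G', h5, h2, h11.symm⟩, h12⟩
  · subst h0
    obtain ⟨run', h1, h2⟩ := divBisimilar_isBisim.run hr hU
    -- The infinite run lifts from the instance under `P` to `G`, and is then replayed under `Q`,
    -- where `W` can answer it.
    obtain ⟨f, hf0, hf⟩ := exists_run (r := TauStep)
      (p := fun n G' => GuardedIn X G' ∧ run' n = G'.subst (Function.update var X P))
      (fun n G' hG' => by
        have hn := (h2 n).1
        rw [hG'.2] at hn
        obtain ⟨G'', h3, h4⟩ := hG'.1.of_step_subst hP hn
        exact ⟨G'', h3, hG'.1.step h3 rfl, h4⟩) (x := G) ⟨hG, h1⟩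
    obtain ⟨m, W', h3, h4⟩ := hW.symm.divBranching.2
      (fun n => (f n).subst (Function.update var X Q)) (by rw [hf0])
      fun n => (hf n).1.subst (.single X hQ)
    obtain ⟨k, T, h5, h6⟩ := (h2 m).2
    rw [(hf m).2.2] at h5
    obtain ⟨G', h7, h8, rfl⟩ := (hf m).2.1.of_tauStar_subst hP h5.star
    obtain ⟨W'', h9, h10⟩ := h4.star (h7.subst (.single X hQ))
    exact ⟨k, W'', h3.trans_star h9, G', h8, h6, h10.symm⟩

/-- Guarded equations have unique solutions up to rooted bisimilarity. -/
theorem Rooted.unique {X : V} {E P Q : Expr V A} (hE : GuardedIn X E)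
    (hPE : Rooted P (E.subst₁ X P)) (hQE : Rooted Q (E.subst₁ X Q)) : Rooted P Q := by
  have hP : Rooted P.nf (E.subst (Function.update var X P.nf)) := by
    rw [← nf_subst₁]; exact (Rooted.nf P).symm.trans (hPE.trans (Rooted.nf _))
  have hQ : Rooted Q.nf (E.subst (Function.update var X Q.nf)) := by
    rw [← nf_subst₁]; exact (Rooted.nf Q).symm.trans (hQE.trans (Rooted.nf _))
  have key : ∀ G, GuardedIn X G → DivBisimilar (G.subst (Function.update var X P.nf))
      (G.subst (Function.update var X Q.nf)) := by
    intro G hG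
    refine divBisimilar_of_bis (R := fun U W => ∃ G, GuardedIn X G ∧
      DivBisimilar U (G.subst (Function.update var X P.nf)) ∧
      DivBisimilar W (G.subst (Function.update var X Q.nf))) ?_ (.inl ⟨G, hG, .refl _, .refl _⟩)
    intro U W h
    refine ⟨(guarded_half (nf_nf P) (nf_nf Q) hE hP hQ h).mono fun _ _ h => .inl h,
      (guarded_half (nf_nf Q) (nf_nf P) hE hQ hP ?_).mono ?_⟩
    · obtain ⟨G, h1, h2, h3⟩ := h; exact ⟨G, h1, h3, h2⟩
    · rintro U W ⟨G, h1, h2, h3⟩; exact .inr (.inl ⟨G, h1, h3, h2⟩)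
  have hmid : ∀ {P Q : Expr V A}, P.nf = P → Q.nf = Q →
      Rooted P (E.subst (Function.update var X P)) → Rooted Q (E.subst (Function.update var X Q)) →
      (∀ G, GuardedIn X G → DivBisimilar (G.subst (Function.update var X P))
        (G.subst (Function.update var X Q))) →
      StrongMatch DivBisimilar (E.subst (Function.update var X P))
        (E.subst (Function.update var X Q)) := by
    intro P Q hP hQ hPE hQE key
    refine ⟨fun a T hs => ?_, fun Y hY => ?_⟩
    · obtain ⟨G', h1, rfl⟩ := hE.of_step_subst hP hs
      refine ⟨_, h1.subst (.single X hQ), ?_⟩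
      exact (hPE.expand hP G').trans ((key _ (hE.subst₁ G')).trans (hQE.expand hQ G').symm)
    · obtain ⟨W, h1, h2⟩ := (exposes_subst_iff (.single X hP)).1 hY
      have hW := hE.not_exposes h1
      rw [Function.update_of_ne hW] at h2
      exact (exposes_subst_iff (.single X hQ)).2 ⟨W, h1, by rwa [Function.update_of_ne hW]⟩
  refine Rooted.of_nf (hP.trans (Rooted.trans ?_ hQ.symm))
  exact ⟨hmid (nf_nf P) (nf_nf Q) hP hQ key,
    hmid (nf_nf Q) (nf_nf P) hQ hP fun G hG => (key G hG).symm⟩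

end Soundness

theorem rel_update {V : Type u} {A : Type v} [DecidableEq V]
    {R : Expr V A → Expr V A → Prop} {σ ρ : V → Expr V A} {X : V}
    {E F : Expr V A} (h : ∀ W, σ W = ρ W ∨ R (σ W) (ρ W)) (hEF : R E F) (W : V) :
    Function.update σ X E W = Function.update ρ X F W ∨
      R (Function.update σ X E W) (Function.update ρ X F W) := by
  by_cases hW : W = X
  · subst hW; simpa using .inr hEF
  · simpa [Function.update_of_ne hW] using h W

/-! ### Soundness of R3, R6 and R7 -/

section Axioms

variable {V : Type u} {A : Type v} [DecidableEq V] [Infinite V]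

theorem nf_subst (E : Expr V A) (σ : V → Expr V A) : E.nf.subst σ = E.subst σ := by
  unfold nf; rw [subst_subst]; rfl

theorem step_mu_then_subst_iff {Y : V} {E : Expr V A} {a : Act A} {T : Expr V A}
    {σ : V → Expr V A} : (∃ E', Step (mu Y E) a E' ∧ T = E'.subst σ) ↔
      ∃ E', Step E a E' ∧ T = E'.subst (Function.update σ Y ((mu Y E).subst σ)) := by
  have h : ∀ E' : Expr V A, (E'.subst (Function.update var Y (mu Y E).nf)).subst σ
      = E'.subst (Function.update σ Y ((mu Y E).subst σ)) := by
    intro E'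
    rw [← nf_subst (mu Y E), ← subst_subst₁]; rfl
  constructor
  · rintro ⟨E', h1, rfl⟩
    obtain ⟨E'', h2, h3⟩ := step_nf_mu_iff.1 (step_nf_iff.2 ⟨E', h1, rfl⟩)
    exact ⟨E'', h2, by rw [← h, ← h3, nf_subst]⟩
  · rintro ⟨E', h1, rfl⟩
    obtain ⟨E'', h2, h3⟩ := step_nf_iff.1 (step_nf_mu_iff.2 ⟨E', h1, rfl⟩)
    exact ⟨E'', h2, by rw [← h, h3, nf_subst]⟩

theorem exposes_mu_iff {Y X : V} {E : Expr V A} :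
    Exposes (mu Y E) X ↔ Exposes E X ∧ X ≠ Y := by
  rw [← exposes_nf_iff, exposes_nf_mu_iff]

theorem shows_nf_mu_unfold {X : V} {E : Expr V A} {o : (Act A × Expr V A) ⊕ V} :
    Shows (E.subst (Function.update var X (mu X E).nf)) o → Shows (mu X E).nf o := by
  exact shows_mu_subst (E := E) normal_var

theorem step_nf_mu_unfold {X : V} {E : Expr V A} {a : Act A} {T : Expr V A} :
    Step (mu X E).nf a T ↔ Step (E.subst (Function.update var X (mu X E).nf)) a T := by
  refine ⟨fun h => ?_, fun h => shows_nf_mu_unfold (o := Sum.inl (a, T)) h⟩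
  obtain ⟨E', h1, rfl⟩ := step_nf_mu_iff.1 h
  exact h1.subst (.single X (nf_nf _))

theorem exposes_nf_mu_unfold {X Y : V} {E : Expr V A} :
    Exposes (mu X E).nf Y ↔ Exposes (E.subst (Function.update var X (mu X E).nf)) Y := by
  refine ⟨fun h => ?_, fun h => shows_nf_mu_unfold (o := Sum.inr Y) h⟩
  obtain ⟨h1, h2⟩ := exposes_nf_mu_iff.1 h
  exact (exposes_subst_iff (.single X (nf_nf _))).2 ⟨Y, h1, by simp [Function.update_of_ne h2]⟩

theorem Instances.of_rel {R : Expr V A → Expr V A → Prop} {E F : Expr V A} (hE : E.nf = E)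
    (hF : F.nf = F) (h : R E F) : Instances R E F :=
  ⟨var (Classical.arbitrary V), fun _ => E, fun _ => F, fun _ => hE, fun _ => hF,
    fun _ => .inr h, rfl, rfl⟩

theorem StrongMatch.update {S : Expr V A → Expr V A → Prop} {σ ρ : V → Expr V A} {X : V}
    {E F : Expr V A} (h : ∀ W, StrongMatch S (σ W) (ρ W)) (hEF : StrongMatch S E F) (W : V) :
    StrongMatch S (Function.update σ X E W) (Function.update ρ X F W) := by
  by_cases hW : W = X
  · subst hW; simpa using hEF
  · simpa [Function.update_of_ne hW] using h W

/-- Unguarded occurrences of the recursion variable are redundant. -/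
theorem rooted_mu_unguarded (X : V) (E : Expr V A) :
    Rooted (mu X (sum (var X) E)) (mu X E) := by
  refine Rooted.of_nf ?_
  have hP := nf_nf (mu X (sum (var X) E))
  have hQ := nf_nf (mu X E)
  have h1 : ∀ {a T}, Step (mu X (sum (var X) E)).nf a T ↔ ∃ E', Step E a E' ∧
      T = E'.subst (Function.update var X (mu X (sum (var X) E)).nf) := by simp [step_nf_mu_iff]
  have h2 : ∀ {a T}, Step (mu X E).nf a T ↔ ∃ E', Step E a E' ∧
      T = E'.subst (Function.update var X (mu X E).nf) := by simp [step_nf_mu_iff]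
  have h3 : ∀ {Y}, Exposes (mu X (sum (var X) E)).nf Y ↔ Exposes (mu X E).nf Y := by
    intro Y; simp only [exposes_nf_mu_iff, exposes_sum_iff, exposes_var_iff]; tauto
  generalize (mu X (sum (var X) E)).nf = P at *
  generalize (mu X E).nf = Q at *
  let R : Expr V A → Expr V A → Prop := fun U W => U = P ∧ W = Q
  have hK : ∀ K : Expr V A, Bis (Instances R)
      (K.subst (Function.update var X P)) (K.subst (Function.update var X Q)) := fun K =>
    .inl ⟨K, _, _, .single X hP, .single X hQ,
      rel_update (fun _ => .inl rfl) ⟨rfl, rfl⟩, rfl, rfl⟩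
  refine Instances.rooted (R := R) ?_ ⟨rfl, rfl⟩
  rintro _ _ ⟨rfl, rfl⟩
  refine ⟨⟨fun a T h₀ => ?_, fun Y => h3.1⟩, ⟨fun a T h₀ => ?_, fun Y => h3.2⟩⟩
  · obtain ⟨E', h, rfl⟩ := h1.1 h₀
    exact ⟨_, h2.2 ⟨E', h, rfl⟩, hK E'⟩
  · obtain ⟨E', h, rfl⟩ := h2.1 h₀
    exact ⟨_, h1.2 ⟨E', h, rfl⟩, (hK E').symm⟩

/-- Both sides alternate a silent step with a move of `E`. With `P` and `τ.Q` the two sides, the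
pairs `(P, τ.Q)` and `(E{P/X}, Q)` match each other step by step, up to instances. -/
theorem rooted_mu_tau (X : V) (E : Expr V A) :
    Rooted (mu X (pre Act.tau E)) (pre Act.tau (mu X (E.subst₁ X (pre Act.tau (var X))))) := by
  refine Rooted.of_nf ?_
  have hP := nf_nf (mu X (pre Act.tau E))
  have hQ := nf_nf (mu X (E.subst₁ X (pre Act.tau (var X))))
  have hν : Normal (Function.update (var : V → Expr V A) X (pre Act.tau (var X))) :=
    .single X rfl
  have h1 : ∀ {a T}, Step (mu X (pre Act.tau E)).nf a T ↔ a = Act.tau ∧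
      T = E.subst (Function.update var X (mu X (pre Act.tau E)).nf) := by
    intro a T
    rw [step_nf_mu_iff]
    simp
  have h1' : ∀ {Y}, ¬ Exposes (mu X (pre Act.tau E)).nf Y := by simp [exposes_nf_mu_iff]
  have h2 : ∀ {a T}, Step (mu X (E.subst₁ X (pre Act.tau (var X)))).nf a T ↔
      (∃ E', Step E a E' ∧ T = E'.subst (Function.update var X
        (pre Act.tau (mu X (E.subst₁ X (pre Act.tau (var X)))).nf))) ∨
      (Exposes E X ∧ a = Act.tau ∧ T = (mu X (E.subst₁ X (pre Act.tau (var X)))).nf) := by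
    intro a T
    rw [step_nf_mu_iff]
    constructor
    · rintro ⟨E₁, h₀, rfl⟩
      rcases (step_subst_iff hν).1 h₀ with ⟨E', h, rfl⟩ | ⟨W, h, h'⟩
      · refine .inl ⟨E', h, ?_⟩
        exact (subst_subst₁ E' X _ _).trans (by simp [Expr.subst])
      · by_cases hW : W = X
        · subst hW
          rw [Function.update_self] at h'
          obtain ⟨rfl, rfl⟩ := step_pre_iff.1 h'
          exact .inr ⟨h, rfl, by simp [Expr.subst]⟩
        · simp [Function.update_of_ne hW] at h'
    · rintro (⟨E', h, rfl⟩ | ⟨h, rfl, rfl⟩)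
      · refine ⟨_, h.subst hν, ?_⟩
        exact ((subst_subst₁ E' X _ _).trans (by simp [Expr.subst])).symm
      · refine ⟨var X, (step_subst_iff hν).2 (.inr ⟨X, h, ?_⟩), by simp [Expr.subst]⟩
        rw [Function.update_self]; exact .pre _ _
  have h2' : ∀ {Y}, Exposes (mu X (E.subst₁ X (pre Act.tau (var X)))).nf Y ↔
      Exposes E Y ∧ Y ≠ X := by
    intro Y
    rw [exposes_nf_mu_iff, subst₁, exposes_subst_iff hν]
    refine and_congr_left fun hY => ⟨?_, fun h => ⟨Y, h, by simp [Function.update_of_ne hY]⟩⟩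
    rintro ⟨W, h, h'⟩
    by_cases hW : W = X
    · subst hW; simp at h'
    · simp only [Function.update_of_ne hW, exposes_var_iff] at h'
      exact h' ▸ h
  change Rooted _ (pre Act.tau (mu X (E.subst₁ X (pre Act.tau (var X)))).nf)
  generalize (mu X (pre Act.tau E)).nf = P at *
  generalize (mu X (E.subst₁ X (pre Act.tau (var X)))).nf = Q at *
  have hτQ : (pre Act.tau Q).nf = pre Act.tau Q := congrArg (pre Act.tau) hQ
  have hσ := Normal.single X hP
  have hρ := Normal.single X hτQ
  let R : Expr V A → Expr V A → Prop := fun U W => (U = P ∧ W = pre Act.tau Q) ∨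
    (U = E.subst (Function.update var X P) ∧ W = Q)
  have hK : ∀ K : Expr V A, Bis (Instances R)
      (K.subst (Function.update var X P)) (K.subst (Function.update var X (pre Act.tau Q))) :=
    fun K => .inl ⟨K, _, _, hσ, hρ, rel_update (fun _ => .inl rfl) (.inl ⟨rfl, rfl⟩), rfl, rfl⟩
  have hEQ : Bis (Instances R) (E.subst (Function.update var X P)) Q :=
    .inl (.of_rel (hσ.nf_subst _) hQ (.inr ⟨rfl, rfl⟩))
  refine Instances.rooted (R := R) ?_ (.inl ⟨rfl, rfl⟩)
  rintro _ _ (⟨rfl, rfl⟩ | ⟨rfl, rfl⟩)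
  · refine ⟨⟨fun a T h => ?_, fun Y h => absurd h h1'⟩, ⟨fun a T h => ?_, fun Y h => by simp at h⟩⟩
    · obtain ⟨rfl, rfl⟩ := h1.1 h
      exact ⟨_, .pre _ _, hEQ⟩
    · obtain ⟨rfl, rfl⟩ := step_pre_iff.1 h
      exact ⟨_, h1.2 ⟨rfl, rfl⟩, hEQ.symm⟩
  · refine ⟨⟨fun a T h₀ => ?_, fun Y h => ?_⟩, ⟨fun a T h₀ => ?_, fun Y h => ?_⟩⟩
    · rcases (step_subst_iff hσ).1 h₀ with ⟨E', h, rfl⟩ | ⟨Z, h, h'⟩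
      · exact ⟨_, h2.2 (.inl ⟨E', h, rfl⟩), hK E'⟩
      · by_cases hZ : Z = X
        · subst hZ
          rw [Function.update_self] at h'
          obtain ⟨rfl, rfl⟩ := h1.1 h'
          exact ⟨_, h2.2 (.inr ⟨h, rfl, rfl⟩), hEQ⟩
        · simp [Function.update_of_ne hZ] at h'
    · obtain ⟨Z, h, h'⟩ := (exposes_subst_iff hσ).1 h
      by_cases hZ : Z = X
      · subst hZ
        rw [Function.update_self] at h'
        exact absurd h' h1'
      · simp only [Function.update_of_ne hZ, exposes_var_iff] at h'
        subst h'
        exact h2'.2 ⟨h, hZ⟩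
    · rcases h2.1 h₀ with ⟨E', h, rfl⟩ | ⟨h, rfl, rfl⟩
      · exact ⟨_, h.subst hσ, (hK E').symm⟩
      · refine ⟨_, (step_subst_iff hσ).2 (.inr ⟨X, h, ?_⟩), hEQ.symm⟩
        rw [Function.update_self]; exact h1.2 ⟨rfl, rfl⟩
    · obtain ⟨h, hY⟩ := h2'.1 h
      exact (exposes_subst_iff hσ).2 ⟨Y, h, by simp [Function.update_of_ne hY]⟩

/-- The recursion `L` already has a silent loop, which matches the extra loop at `X`. Each side
consists of a recursion and its instance of `L`; all four cross pairs are related, so it does not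
matter to which of the two a silent loop returns. -/
theorem rooted_mu_loop (X Y : V) (E : Expr V A) :
    Rooted (mu X (sum (pre Act.tau (var X)) (mu Y (sum (pre Act.tau (var Y)) E))))
      (mu X (mu Y (sum (pre Act.tau (var Y)) E))) := by
  refine Rooted.of_nf ?_
  generalize hL : mu Y (sum (pre Act.tau (var Y)) E) = L
  have hP := nf_nf (mu X (sum (pre Act.tau (var X)) L))
  have hQ := nf_nf (mu X L)
  have hLs : ∀ {σ : V → Expr V A} {a T}, (∃ E', Step L a E' ∧ T = E'.subst σ) ↔
      (a = Act.tau ∧ T = L.subst σ) ∨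
      ∃ E', Step E a E' ∧ T = E'.subst (Function.update σ Y (L.subst σ)) := by
    intro σ a T
    subst hL
    rw [step_mu_then_subst_iff]
    constructor
    · rintro ⟨E', h, rfl⟩
      rcases step_sum_iff.1 h with h | h
      · obtain ⟨rfl, rfl⟩ := step_pre_iff.1 h
        exact .inl ⟨rfl, by simp [Expr.subst]⟩
      · exact .inr ⟨E', h, rfl⟩
    · rintro (⟨rfl, rfl⟩ | ⟨E', h, rfl⟩)
      · exact ⟨var Y, .sum_left _ (.pre _ _), by simp [Expr.subst]⟩
      · exact ⟨E', .sum_right _ h, rfl⟩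
  have hLe : ∀ {Z}, Exposes L Z ↔ Exposes E Z ∧ Z ≠ Y := by
    intro Z; subst hL; simp [exposes_mu_iff]
  have h1 : ∀ {a T}, Step (mu X (sum (pre Act.tau (var X)) L)).nf a T ↔
      (a = Act.tau ∧ T = (mu X (sum (pre Act.tau (var X)) L)).nf) ∨
      ∃ E', Step L a E' ∧
        T = E'.subst (Function.update var X (mu X (sum (pre Act.tau (var X)) L)).nf) := by
    intro a T
    rw [step_nf_mu_iff]
    constructor
    · rintro ⟨E', h, rfl⟩
      rcases step_sum_iff.1 h with h | h
      · obtain ⟨rfl, rfl⟩ := step_pre_iff.1 h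
        exact .inl ⟨rfl, by simp [Expr.subst]⟩
      · exact .inr ⟨E', h, rfl⟩
    · rintro (⟨rfl, h⟩ | ⟨E', h, rfl⟩)
      · exact ⟨var X, .sum_left _ (.pre _ _), by simp [Expr.subst, h]⟩
      · exact ⟨E', .sum_right _ h, rfl⟩
  have h1' : ∀ {Z}, Exposes (mu X (sum (pre Act.tau (var X)) L)).nf Z ↔ Exposes L Z ∧ Z ≠ X := by
    simp [exposes_nf_mu_iff]
  have h2 : ∀ {a T}, Step (mu X L).nf a T ↔
      ∃ E', Step L a E' ∧ T = E'.subst (Function.update var X (mu X L).nf) := step_nf_mu_iff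
  have h2' : ∀ {Z}, Exposes (mu X L).nf Z ↔ Exposes L Z ∧ Z ≠ X := exposes_nf_mu_iff
  clear hL
  generalize (mu X (sum (pre Act.tau (var X)) L)).nf = P at *
  have h3 : ∀ {a T}, Step (L.subst (Function.update var X P)) a T →
      (∃ E', Step L a E' ∧ T = E'.subst (Function.update var X P)) ∨ Step P a T := by
    intro a T h
    rcases (step_subst_iff (.single X hP)).1 h with h | ⟨W, h, h'⟩
    · exact .inl h
    · by_cases hW : W = X
      · subst hW; rw [Function.update_self] at h'; exact .inr h'
      · simp [Function.update_of_ne hW] at h'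
  have h3' : ∀ {Z}, Exposes (L.subst (Function.update var X P)) Z ↔ Exposes L Z ∧ Z ≠ X := by
    intro Z
    rw [exposes_subst_iff (.single X hP)]
    constructor
    · rintro ⟨W, h, h'⟩
      by_cases hW : W = X
      · subst hW; rw [Function.update_self] at h'; exact h1'.1 h'
      · simp only [Function.update_of_ne hW, exposes_var_iff] at h'
        subst h'; exact ⟨h, hW⟩
    · rintro ⟨h, h'⟩
      exact ⟨Z, h, by simp [Function.update_of_ne h']⟩
  have h5 : ∀ {a T}, (∃ E', Step L a E' ∧ T = E'.subst (Function.update var X P)) →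
      Step (L.subst (Function.update var X P)) a T := by
    rintro a _ ⟨E', h, rfl⟩
    exact h.subst (.single X hP)
  have h4 : ∀ {a T}, Step (L.subst (Function.update var X (mu X L).nf)) a T ↔
      Step (mu X L).nf a T := step_nf_mu_unfold.symm
  have h4' : ∀ {Z}, Exposes (L.subst (Function.update var X (mu X L).nf)) Z ↔
      Exposes (mu X L).nf Z := exposes_nf_mu_unfold.symm
  generalize (mu X L).nf = Q at *
  have hσ := Normal.single X hP
  have hρ := Normal.single X hQ
  have hL' := hσ.nf_subst L
  have hM' := hρ.nf_subst L
  simp only [hLs] at h1 h2 h3 h5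
  simp only [h2] at h4
  simp only [h2'] at h4'
  generalize L.subst (Function.update var X P) = L' at *
  generalize L.subst (Function.update var X Q) = M' at *
  let R : Expr V A → Expr V A → Prop := fun U W => (U = P ∨ U = L') ∧ (W = Q ∨ W = M')
  have hK : ∀ K : Expr V A, Bis (Instances R)
      (K.subst (Function.update (Function.update var X P) Y L'))
      (K.subst (Function.update (Function.update var X Q) Y M')) := fun K =>
    .inl ⟨K, _, _, hσ.update Y hL', hρ.update Y hM',
      rel_update (rel_update (fun _ => .inl rfl) ⟨.inl rfl, .inl rfl⟩) ⟨.inr rfl, .inr rfl⟩,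
      rfl, rfl⟩
  have hR : ∀ {U W}, R U W → Bis (Instances R) U W := by
    rintro U W h
    refine .inl (.of_rel ?_ ?_ h)
    · rcases h.1 with rfl | rfl <;> assumption
    · rcases h.2 with rfl | rfl <;> assumption
  refine Instances.rooted (R := R) ?_ ⟨.inl rfl, .inl rfl⟩
  rintro U W hUW
  have hP1 : ∀ {a T}, Step U a T → (a = Act.tau ∧ (T = P ∨ T = L')) ∨ ∃ E', Step E a E' ∧
      T = E'.subst (Function.update (Function.update var X P) Y L') := by
    intro a T h
    rcases hUW.1 with rfl | rfl
    · rw [h1] at h; tauto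
    · have h := h3 h
      rw [h1] at h; tauto
  have hP2 : ∀ {a T}, ((a = Act.tau ∧ T = L') ∨ ∃ E', Step E a E' ∧
      T = E'.subst (Function.update (Function.update var X P) Y L')) → Step U a T := by
    intro a T h
    rcases hUW.1 with rfl | rfl
    · rw [h1]; tauto
    · exact h5 h
  have hQ1 : ∀ {a T}, Step W a T ↔ (a = Act.tau ∧ T = M') ∨ ∃ E', Step E a E' ∧
      T = E'.subst (Function.update (Function.update var X Q) Y M') := by
    intro a T
    rcases hUW.2 with rfl | rfl
    · exact h2
    · exact h4
  have hex : ∀ {Z}, Exposes U Z ↔ Exposes W Z := by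
    intro Z
    rcases hUW.1 with rfl | rfl <;> rcases hUW.2 with rfl | rfl <;> simp only [h1', h2', h3', h4']
  refine ⟨⟨fun a T h₀ => ?_, fun Z => hex.1⟩, ⟨fun a T h₀ => ?_, fun Z => hex.2⟩⟩
  · rcases hP1 h₀ with ⟨rfl, h⟩ | ⟨E', h, rfl⟩
    · exact ⟨M', hQ1.2 (.inl ⟨rfl, rfl⟩), hR ⟨h, .inr rfl⟩⟩
    · exact ⟨_, hQ1.2 (.inr ⟨E', h, rfl⟩), hK E'⟩
  · rcases hQ1.1 h₀ with ⟨rfl, rfl⟩ | ⟨E', h, rfl⟩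
    · exact ⟨L', hP2 (.inl ⟨rfl, rfl⟩), (hR ⟨.inr rfl, .inr rfl⟩).symm⟩
    · exact ⟨_, hP2 (.inr ⟨E', h, rfl⟩), (hK E').symm⟩

end Axioms

/-! ### Soundness of R8, R4 and R5, and of the whole system -/

section Axioms

variable {V : Type u} {A : Type v} [DecidableEq V] [Infinite V]

/-- The transitions of a double recursion. -/
theorem step_nf_mu_mu_iff {X Y : V} {E : Expr V A} {a : Act A} {T : Expr V A} :
    Step (mu X (mu Y E)).nf a T ↔ ∃ E', Step E a E' ∧ T = E'.subst
      (Function.update (Function.update var X (mu X (mu Y E)).nf) Y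
        ((mu Y E).subst (Function.update var X (mu X (mu Y E)).nf))) := by
  rw [step_nf_mu_iff, step_mu_then_subst_iff]

theorem exposes_nf_mu_mu_iff {X Y Z : V} {E : Expr V A} :
    Exposes (mu X (mu Y E)).nf Z ↔ (Exposes E Z ∧ Z ≠ Y) ∧ Z ≠ X := by
  rw [exposes_nf_mu_iff, exposes_mu_iff]

/-- The recursion over `X` and its inner recursion over `Y` unfold to the same transitions, so it is
immaterial which of them the summand under `τ` refers to. Besides the four cross pairs, the two
targets of that silent summand are related. -/
theorem rooted_mu_mu (X Y : V) (E F : Expr V A) :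
    Rooted (mu X (mu Y (sum (pre Act.tau (sum (var X) E)) F)))
      (mu X (mu Y (sum (pre Act.tau (sum (var Y) E)) F))) := by
  by_cases hXY : X = Y
  · subst hXY; exact .refl _
  refine Rooted.of_nf ?_
  have hP := nf_nf (mu X (mu Y (sum (pre Act.tau (sum (var X) E)) F)))
  have hQ := nf_nf (mu X (mu Y (sum (pre Act.tau (sum (var Y) E)) F)))
  have h1 := fun a T => step_nf_mu_mu_iff (X := X) (Y := Y)
    (E := sum (pre Act.tau (sum (var X) E)) F) (a := a) (T := T)
  have h2 := fun a T => step_nf_mu_mu_iff (X := X) (Y := Y)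
    (E := sum (pre Act.tau (sum (var Y) E)) F) (a := a) (T := T)
  have h1' := fun Z => exposes_nf_mu_mu_iff (X := X) (Y := Y)
    (E := sum (pre Act.tau (sum (var X) E)) F) (Z := Z)
  have h2' := fun Z => exposes_nf_mu_mu_iff (X := X) (Y := Y)
    (E := sum (pre Act.tau (sum (var Y) E)) F) (Z := Z)
  have h3 := fun a T => step_nf_mu_unfold (X := X)
    (E := mu Y (sum (pre Act.tau (sum (var X) E)) F)) (a := a) (T := T)
  have h3' := fun Z => exposes_nf_mu_unfold (X := X)
    (E := mu Y (sum (pre Act.tau (sum (var X) E)) F)) (Y := Z)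
  have h4 := fun a T => step_nf_mu_unfold (X := X)
    (E := mu Y (sum (pre Act.tau (sum (var Y) E)) F)) (a := a) (T := T)
  have h4' := fun Z => exposes_nf_mu_unfold (X := X)
    (E := mu Y (sum (pre Act.tau (sum (var Y) E)) F)) (Y := Z)
  have hL := (Normal.single X hP).nf_subst (mu Y (sum (pre Act.tau (sum (var X) E)) F))
  have hM := (Normal.single X hQ).nf_subst (mu Y (sum (pre Act.tau (sum (var Y) E)) F))
  generalize (mu Y (sum (pre Act.tau (sum (var X) E)) F)).subst
    (Function.update var X (mu X (mu Y (sum (pre Act.tau (sum (var X) E)) F))).nf) = L at *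
  generalize (mu Y (sum (pre Act.tau (sum (var Y) E)) F)).subst
    (Function.update var X (mu X (mu Y (sum (pre Act.tau (sum (var Y) E)) F))).nf) = M at *
  generalize (mu X (mu Y (sum (pre Act.tau (sum (var X) E)) F))).nf = P at *
  generalize (mu X (mu Y (sum (pre Act.tau (sum (var Y) E)) F))).nf = Q at *
  have hσ := (Normal.single X hP).update Y hL
  have hρ := (Normal.single X hQ).update Y hM
  have hσX : Function.update (Function.update var X P) Y L X = P := by
    simp [Function.update_of_ne hXY]
  have hρY : Function.update (Function.update var X Q) Y M Y = M := by simp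
  have h1 : ∀ a T, Step P a T ↔ (a = Act.tau ∧ T = sum P
      (E.subst (Function.update (Function.update var X P) Y L))) ∨
      ∃ F', Step F a F' ∧ T = F'.subst (Function.update (Function.update var X P) Y L) := by
    intro a T
    rw [h1 a T]
    constructor
    · rintro ⟨E', h, rfl⟩
      rcases step_sum_iff.1 h with h | h
      · obtain ⟨rfl, rfl⟩ := step_pre_iff.1 h
        exact .inl ⟨rfl, by simp only [Expr.subst, hσX]⟩
      · exact .inr ⟨E', h, rfl⟩
    · rintro (⟨rfl, h⟩ | ⟨E', h, rfl⟩)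
      · exact ⟨_, .sum_left _ (.pre _ _), by simp only [Expr.subst, hσX, h]⟩
      · exact ⟨E', .sum_right _ h, rfl⟩
  have h2 : ∀ a T, Step Q a T ↔ (a = Act.tau ∧ T = sum M
      (E.subst (Function.update (Function.update var X Q) Y M))) ∨
      ∃ F', Step F a F' ∧ T = F'.subst (Function.update (Function.update var X Q) Y M) := by
    intro a T
    rw [h2 a T]
    constructor
    · rintro ⟨E', h, rfl⟩
      rcases step_sum_iff.1 h with h | h
      · obtain ⟨rfl, rfl⟩ := step_pre_iff.1 h
        exact .inl ⟨rfl, by simp only [Expr.subst, hρY]⟩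
      · exact .inr ⟨E', h, rfl⟩
    · rintro (⟨rfl, h⟩ | ⟨E', h, rfl⟩)
      · exact ⟨_, .sum_left _ (.pre _ _), by simp only [Expr.subst, hρY, h]⟩
      · exact ⟨E', .sum_right _ h, rfl⟩
  clear hσX hρY
  have hex : ∀ Z, Exposes P Z ↔ Exposes Q Z := by simp [h1', h2']
  let R : Expr V A → Expr V A → Prop := fun U W => ((U = P ∨ U = L) ∧ (W = Q ∨ W = M)) ∨
    (U = sum P (E.subst (Function.update (Function.update var X P) Y L)) ∧
      W = sum M (E.subst (Function.update (Function.update var X Q) Y M)))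
  have hrel : ∀ W, Function.update (Function.update var X P) Y L W =
      Function.update (Function.update var X Q) Y M W ∨
      R (Function.update (Function.update var X P) Y L W)
        (Function.update (Function.update var X Q) Y M W) :=
    rel_update (rel_update (fun _ => .inl rfl) (.inl ⟨.inl rfl, .inl rfl⟩))
      (.inl ⟨.inr rfl, .inr rfl⟩)
  have hK : ∀ K : Expr V A, Bis (Instances R)
      (K.subst (Function.update (Function.update var X P) Y L))
      (K.subst (Function.update (Function.update var X Q) Y M)) := fun K =>
    .inl ⟨K, _, _, hσ, hρ, hrel, rfl, rfl⟩
  have hsum : Bis (Instances R)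
      (sum P (E.subst (Function.update (Function.update var X P) Y L)))
      (sum M (E.subst (Function.update (Function.update var X Q) Y M))) := by
    refine .inl (.of_rel ?_ ?_ (.inr ⟨rfl, rfl⟩))
    · exact congrArg₂ sum hP (hσ.nf_subst E)
    · exact congrArg₂ sum hM (hρ.nf_subst E)
  have hm : ∀ {U W}, (U = P ∨ U = L) → (W = Q ∨ W = M) →
      StrongMatch (Bis (Instances R)) U W ∧ StrongMatch (Bis (Instances R)) W U := by
    intro U W hU hW
    have hU1 : ∀ a T, Step U a T ↔ Step P a T := by
      rcases hU with rfl | rfl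
      · exact fun _ _ => Iff.rfl
      · exact fun a T => (h3 a T).symm
    have hW1 : ∀ a T, Step W a T ↔ Step Q a T := by
      rcases hW with rfl | rfl
      · exact fun _ _ => Iff.rfl
      · exact fun a T => (h4 a T).symm
    have hU2 : ∀ Z, Exposes U Z ↔ Exposes P Z := by
      rcases hU with rfl | rfl
      · exact fun _ => Iff.rfl
      · exact fun Z => (h3' Z).symm
    have hW2 : ∀ Z, Exposes W Z ↔ Exposes Q Z := by
      rcases hW with rfl | rfl
      · exact fun _ => Iff.rfl
      · exact fun Z => (h4' Z).symm
    refine ⟨⟨fun a T h₀ => ?_, fun Z => by rw [hU2, hW2, hex]; exact id⟩,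
      ⟨fun a T h₀ => ?_, fun Z => by rw [hU2, hW2, hex]; exact id⟩⟩
    · rw [hU1, h1] at h₀
      rcases h₀ with ⟨rfl, rfl⟩ | ⟨F', h, rfl⟩
      · exact ⟨_, (hW1 _ _).2 ((h2 _ _).2 (.inl ⟨rfl, rfl⟩)), hsum⟩
      · exact ⟨_, (hW1 _ _).2 ((h2 _ _).2 (.inr ⟨F', h, rfl⟩)), hK F'⟩
    · rw [hW1, h2] at h₀
      rcases h₀ with ⟨rfl, rfl⟩ | ⟨F', h, rfl⟩
      · exact ⟨_, (hU1 _ _).2 ((h1 _ _).2 (.inl ⟨rfl, rfl⟩)), hsum.symm⟩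
      · exact ⟨_, (hU1 _ _).2 ((h1 _ _).2 (.inr ⟨F', h, rfl⟩)), (hK F').symm⟩
  refine Instances.rooted (R := R) ?_ (.inl ⟨.inl rfl, .inl rfl⟩)
  rintro U W (⟨hU, hW⟩ | ⟨hU, hW⟩)
  · exact hm hU hW
  · rw [hU, hW]
    constructor
    · exact (hm (.inl rfl) (.inr rfl)).1.sum (StrongMatch.subst hσ hρ hK (StrongMatch.update
        (StrongMatch.update (fun _ => .refl (Bis.refl _) _) (hm (.inl rfl) (.inl rfl)).1)
        (hm (.inr rfl) (.inr rfl)).1) E)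
    · exact (hm (.inl rfl) (.inr rfl)).2.sum (StrongMatch.subst hρ hσ (fun K => (hK K).symm)
        (StrongMatch.update
        (StrongMatch.update (fun _ => .refl (Bis.refl _) _) (hm (.inl rfl) (.inl rfl)).2)
        (hm (.inr rfl) (.inr rfl)).2) E)

/-- Because `E` silently reaches an exposed `X`, the instances of `E` and of `τ.E + F` on the left
lie on a common silent cycle. Both are related to the instance of `E + F`, and the moves of `F` that
`E` lacks are found by going round the cycle. -/
theorem rooted_mu_tau_tau {X : V} {E : Expr V A} (F G : Expr V A) (hE : WeaklyExposes E X) :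
    Rooted (mu X (sum (pre Act.tau (sum (pre Act.tau E) F)) G))
      (mu X (sum (pre Act.tau (sum E F)) G)) := by
  refine Rooted.of_nf ?_
  obtain ⟨E₁, hE₁, hX⟩ := hE
  have hP := nf_nf (mu X (sum (pre Act.tau (sum (pre Act.tau E) F)) G))
  have hQ := nf_nf (mu X (sum (pre Act.tau (sum E F)) G))
  have key : ∀ {H : Expr V A} {a T}, Step (mu X (sum (pre Act.tau H) G)).nf a T ↔
      (a = Act.tau ∧ T = H.subst (Function.update var X (mu X (sum (pre Act.tau H) G)).nf)) ∨
      ∃ G', Step G a G' ∧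
        T = G'.subst (Function.update var X (mu X (sum (pre Act.tau H) G)).nf) := by
    intro H a T
    rw [step_nf_mu_iff]
    constructor
    · rintro ⟨E', h, rfl⟩
      rcases step_sum_iff.1 h with h | h
      · obtain ⟨rfl, rfl⟩ := step_pre_iff.1 h
        exact .inl ⟨rfl, rfl⟩
      · exact .inr ⟨E', h, rfl⟩
    · rintro (⟨rfl, rfl⟩ | ⟨E', h, rfl⟩)
      · exact ⟨_, .sum_left _ (.pre _ _), rfl⟩
      · exact ⟨E', .sum_right _ h, rfl⟩
  have h1 := fun a T => key (H := sum (pre Act.tau E) F) (a := a) (T := T)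
  have h2 := fun a T => key (H := sum E F) (a := a) (T := T)
  have hex : ∀ Z, Exposes (mu X (sum (pre Act.tau (sum (pre Act.tau E) F)) G)).nf Z ↔
      Exposes (mu X (sum (pre Act.tau (sum E F)) G)).nf Z := by simp [exposes_nf_mu_iff]
  clear key
  generalize (mu X (sum (pre Act.tau (sum (pre Act.tau E) F)) G)).nf = P at *
  generalize (mu X (sum (pre Act.tau (sum E F)) G)).nf = Q at *
  have hσ := Normal.single X hP
  have hρ := Normal.single X hQ
  have hσX : Function.update var X P X = P := by simp
  have hρX : Function.update var X Q X = Q := by simp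
  have hrefl : ∀ W, W ≠ X → Function.update var X P W = Function.update var X Q W := by
    intro W hW; simp [Function.update_of_ne hW]
  generalize Function.update var X P = σ at *
  generalize Function.update var X Q = ρ at *
  let R : Expr V A → Expr V A → Prop := fun U W =>
    (∃ K : Expr V A, U = K.subst σ ∧ W = K.subst ρ) ∨
    (U = (sum (pre Act.tau E) F).subst σ ∧ W = (sum E F).subst ρ) ∨
    (U = E.subst σ ∧ W = (sum E F).subst ρ)
  have hK : ∀ K : Expr V A, Bis R (K.subst σ) (K.subst ρ) := fun K => .inl (.inl ⟨K, rfl, rfl⟩)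
  have hN : Bis R ((sum (pre Act.tau E) F).subst σ) ((sum E F).subst ρ) :=
    .inl (.inr (.inl ⟨rfl, rfl⟩))
  have hE' : Bis R (E.subst σ) ((sum E F).subst ρ) := .inl (.inr (.inr ⟨rfl, rfl⟩))
  have hPQ : StrongMatch (Bis R) P Q ∧ StrongMatch (Bis R) Q P := by
    refine ⟨⟨fun a T h₀ => ?_, fun Z => (hex Z).1⟩, ⟨fun a T h₀ => ?_, fun Z => (hex Z).2⟩⟩
    · rcases (h1 a T).1 h₀ with ⟨rfl, rfl⟩ | ⟨G', h, rfl⟩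
      · exact ⟨_, (h2 _ _).2 (.inl ⟨rfl, rfl⟩), hN⟩
      · exact ⟨_, (h2 _ _).2 (.inr ⟨G', h, rfl⟩), hK G'⟩
    · rcases (h2 a T).1 h₀ with ⟨rfl, rfl⟩ | ⟨G', h, rfl⟩
      · exact ⟨_, (h1 _ _).2 (.inl ⟨rfl, rfl⟩), hN.symm⟩
      · exact ⟨_, (h1 _ _).2 (.inr ⟨G', h, rfl⟩), (hK G').symm⟩
  have hm : ∀ K : Expr V A, StrongMatch (Bis R) (K.subst σ) (K.subst ρ) := by
    refine StrongMatch.subst hσ hρ hK fun W => ?_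
    by_cases hW : W = X
    · subst hW; rw [hσX, hρX]; exact hPQ.1
    · rw [hrefl W hW]; exact .refl (Bis.refl _) _
  have hm' : ∀ K : Expr V A, StrongMatch (Bis R) (K.subst ρ) (K.subst σ) := by
    refine StrongMatch.subst hρ hσ (fun K => (hK K).symm) fun W => ?_
    by_cases hW : W = X
    · subst hW; rw [hσX, hρX]; exact hPQ.2
    · rw [hrefl W hW]; exact .refl (Bis.refl _) _
  have hcycle : TauPlus (E.subst σ) ((sum (pre Act.tau E) F).subst σ) :=
    (hE₁.subst hσ).tail ((step_subst_iff hσ).2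
      (.inr ⟨X, hX, by rw [hσX]; exact (h1 _ _).2 (.inl ⟨rfl, rfl⟩)⟩))
  have hR : ∀ U W, Bis R U W → DivBisimilar U W := by
    refine fun U W => divBisimilar_of_bis ?_
    rintro U W (⟨K, rfl, rfl⟩ | ⟨rfl, rfl⟩ | ⟨rfl, rfl⟩)
    · exact ⟨((hm K).progress (hK K)).divBranching, ((hm' K).progress (hK K).symm).divBranching⟩
    · constructor
      · refine ⟨⟨fun a T h₀ => ?_, fun Z hZ => ?_⟩, fun run h0 hr => ?_⟩
        · rcases step_sum_iff.1 h₀ with h | h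
          · obtain ⟨rfl, rfl⟩ := step_pre_iff.1 h
            exact .inl ⟨rfl, _, .refl _, hN, hE'⟩
          · obtain ⟨T', h3, h4⟩ := (hm F).1 a T h
            exact .inr ⟨_, T', .refl _, h3.sum_right _, hN, h4⟩
        · refine ⟨_, .refl _, hN, ?_⟩
          rcases exposes_sum_iff.1 hZ with h | h
          · exact absurd h not_exposes_pre
          · exact ((hm F).2 Z h).sum_right _
        · have h3 := hr 0
          rw [h0] at h3
          rcases step_sum_iff.1 h3 with h | h
          · obtain ⟨-, h4⟩ := step_pre_iff.1 h
            have h5 := hr 1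
            rw [h4] at h5
            obtain ⟨T', h6, h7⟩ := (hm E).1 _ _ h5
            exact ⟨2, T', .single (h6.sum_left _), h7⟩
          · obtain ⟨T', h6, h7⟩ := (hm F).1 _ _ h
            exact ⟨1, T', .single (h6.sum_right _), h7⟩
      · have hτ : TauStar ((sum (pre Act.tau E) F).subst σ) (E.subst σ) :=
          .single (.sum_left _ (.pre _ _))
        refine ProgressMatch.divBranching ⟨fun a T h₀ => ?_, fun Z hZ => ?_⟩
        · rcases step_sum_iff.1 h₀ with h | h
          · obtain ⟨T', h3, h4⟩ := (hm' E).1 a T h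
            exact ⟨_, T', hτ, h3, hE'.symm, h4⟩
          · obtain ⟨T', h3, h4⟩ := (hm' F).1 a T h
            exact ⟨_, T', .refl _, h3.sum_right _, hN.symm, h4⟩
        · rcases exposes_sum_iff.1 hZ with h | h
          · exact ⟨_, hτ, hE'.symm, (hm' E).2 Z h⟩
          · exact ⟨_, .refl _, hN.symm, ((hm' F).2 Z h).sum_right _⟩
    · constructor
      · refine ProgressMatch.divBranching ⟨fun a T h₀ => ?_, fun Z hZ => ?_⟩
        · obtain ⟨T', h3, h4⟩ := (hm E).1 a T h₀
          exact ⟨_, T', .refl _, h3.sum_left _, hE', h4⟩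
        · exact ⟨_, .refl _, hE', ((hm E).2 Z hZ).sum_left _⟩
      · refine ProgressMatch.divBranching ⟨fun a T h₀ => ?_, fun Z hZ => ?_⟩
        · rcases step_sum_iff.1 h₀ with h | h
          · obtain ⟨T', h3, h4⟩ := (hm' E).1 a T h
            exact ⟨_, T', .refl _, h3, hE'.symm, h4⟩
          · obtain ⟨T', h3, h4⟩ := (hm' F).1 a T h
            exact ⟨_, T', hcycle.star, h3.sum_right _, hN.symm, h4⟩
        · rcases exposes_sum_iff.1 hZ with h | h
          · exact ⟨_, .refl _, hE'.symm, (hm' E).2 Z h⟩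
          · exact ⟨_, hcycle.star, hN.symm, ((hm' F).2 Z h).sum_right _⟩
  exact ⟨hPQ.1.mono hR, hPQ.2.mono hR⟩

/-- Without its loop the inner recursion `M` still diverges: `E` silently reaches an exposed `X`,
and the next silent step leads back to `M`. The loop `L` is related to all expressions on this
cycle, so a turn of its silent loop is answered by one step along the cycle. -/
theorem rooted_mu_tau_loop {X Y : V} {E : Expr V A} (F : Expr V A) (hXY : X ≠ Y)
    (hE : WeaklyExposes E X) :
    Rooted (mu X (sum (pre Act.tau (mu Y (sum (pre Act.tau (var Y)) E))) F))
      (mu X (sum (pre Act.tau (mu Y E)) F)) := by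
  refine Rooted.of_nf ?_
  obtain ⟨E₁, hE₁, hX⟩ := hE
  have hP := nf_nf (mu X (sum (pre Act.tau (mu Y (sum (pre Act.tau (var Y)) E))) F))
  have hQ := nf_nf (mu X (sum (pre Act.tau (mu Y E)) F))
  have key : ∀ {H : Expr V A} {a T}, Step (mu X (sum (pre Act.tau H) F)).nf a T ↔
      (a = Act.tau ∧ T = H.subst (Function.update var X (mu X (sum (pre Act.tau H) F)).nf)) ∨
      ∃ G', Step F a G' ∧
        T = G'.subst (Function.update var X (mu X (sum (pre Act.tau H) F)).nf) := by
    intro H a T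
    rw [step_nf_mu_iff]
    constructor
    · rintro ⟨E', h, rfl⟩
      rcases step_sum_iff.1 h with h | h
      · obtain ⟨rfl, rfl⟩ := step_pre_iff.1 h
        exact .inl ⟨rfl, rfl⟩
      · exact .inr ⟨E', h, rfl⟩
    · rintro (⟨rfl, rfl⟩ | ⟨E', h, rfl⟩)
      · exact ⟨_, .sum_left _ (.pre _ _), rfl⟩
      · exact ⟨E', .sum_right _ h, rfl⟩
  have h1 := fun a T => key (H := mu Y (sum (pre Act.tau (var Y)) E)) (a := a) (T := T)
  have h2 := fun a T => key (H := mu Y E) (a := a) (T := T)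
  have hex : ∀ Z, Exposes (mu X (sum (pre Act.tau (mu Y (sum (pre Act.tau (var Y)) E))) F)).nf Z ↔
      Exposes (mu X (sum (pre Act.tau (mu Y E)) F)).nf Z := by simp [exposes_nf_mu_iff]
  clear key
  generalize (mu X (sum (pre Act.tau (mu Y (sum (pre Act.tau (var Y)) E))) F)).nf = P at *
  generalize (mu X (sum (pre Act.tau (mu Y E)) F)).nf = Q at *
  have hσ₀ := Normal.single X hP
  have hρ₀ := Normal.single X hQ
  have hL := hσ₀.nf_subst (mu Y (sum (pre Act.tau (var Y)) E))
  have hM := hρ₀.nf_subst (mu Y E)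
  have h3 := fun a T => step_mu_subst_iff hσ₀ (Y := Y) (E := sum (pre Act.tau (var Y)) E)
    (a := a) (T := T)
  have h3' := fun Z => exposes_mu_subst_iff hσ₀ (Y := Y) (E := sum (pre Act.tau (var Y)) E)
    (X := Z)
  have h4 := fun a T => step_mu_subst_iff hρ₀ (Y := Y) (E := E) (a := a) (T := T)
  have h4' := fun Z => exposes_mu_subst_iff hρ₀ (Y := Y) (E := E) (X := Z)
  generalize (mu Y (sum (pre Act.tau (var Y)) E)).subst (Function.update var X P) = L at *
  generalize (mu Y E).subst (Function.update var X Q) = M at *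
  have hσ := hσ₀.update Y hL
  have hρ := hρ₀.update Y hM
  have hσX : Function.update var X P X = P := by simp
  have hρX : Function.update (Function.update var X Q) Y M X = Q := by
    simp [Function.update_of_ne hXY]
  have hρX₀ : Function.update var X Q X = Q := by simp
  have hrefl : ∀ W, W ≠ X → Function.update var X P W = Function.update var X Q W := by
    intro W hW; simp [Function.update_of_ne hW]
  let R₀ : Expr V A → Expr V A → Prop := fun U W => (U = P ∧ W = Q) ∨ (U = L ∧ W = M)
  let R : Expr V A → Expr V A → Prop := fun U W => Instances R₀ U W ∨
    (∃ K, U = L ∧ W = K.subst (Function.update (Function.update var X Q) Y M) ∧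
      TauPlus E K ∧ TauStar K E₁)
  have hrel₀ : ∀ W, Function.update var X P W = Function.update var X Q W ∨
      R₀ (Function.update var X P W) (Function.update var X Q W) :=
    rel_update (fun _ => .inl rfl) (.inl ⟨rfl, rfl⟩)
  have hrel : ∀ W, Function.update (Function.update var X P) Y L W =
      Function.update (Function.update var X Q) Y M W ∨
      R₀ (Function.update (Function.update var X P) Y L W)
        (Function.update (Function.update var X Q) Y M W) :=
    rel_update hrel₀ (.inr ⟨rfl, rfl⟩)
  have hI : ∀ {U W}, Instances R₀ U W → Bis R U W := fun h => .inl (.inl h)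
  have hK₀ : ∀ K : Expr V A, Bis R (K.subst (Function.update var X P))
      (K.subst (Function.update var X Q)) := fun K =>
    hI ⟨K, _, _, hσ₀, hρ₀, hrel₀, rfl, rfl⟩
  have hK : ∀ K : Expr V A, Bis R (K.subst (Function.update (Function.update var X P) Y L))
      (K.subst (Function.update (Function.update var X Q) Y M)) := fun K =>
    hI ⟨K, _, _, hσ, hρ, hrel, rfl, rfl⟩
  have hLM : Bis R L M := hI (.of_rel hL hM (.inr ⟨rfl, rfl⟩))
  have hPQ : StrongMatch (Bis R) P Q ∧ StrongMatch (Bis R) Q P := by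
    refine ⟨⟨fun a T h₀ => ?_, fun Z => (hex Z).1⟩, ⟨fun a T h₀ => ?_, fun Z => (hex Z).2⟩⟩
    · rcases (h1 a T).1 h₀ with ⟨rfl, rfl⟩ | ⟨G', h, rfl⟩
      · exact ⟨_, (h2 _ _).2 (.inl ⟨rfl, rfl⟩), hLM⟩
      · exact ⟨_, (h2 _ _).2 (.inr ⟨G', h, rfl⟩), hK₀ G'⟩
    · rcases (h2 a T).1 h₀ with ⟨rfl, rfl⟩ | ⟨G', h, rfl⟩
      · exact ⟨_, (h1 _ _).2 (.inl ⟨rfl, rfl⟩), hLM.symm⟩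
      · exact ⟨_, (h1 _ _).2 (.inr ⟨G', h, rfl⟩), (hK₀ G').symm⟩
  have hvar : ∀ W, StrongMatch (Bis R) (Function.update var X P W) (Function.update var X Q W) ∧
      StrongMatch (Bis R) (Function.update var X Q W) (Function.update var X P W) := by
    intro W
    by_cases hW : W = X
    · subst hW; rw [hσX, hρX₀]; exact hPQ
    · rw [hrefl W hW]; exact ⟨.refl (Bis.refl _) _, .refl (Bis.refl _) _⟩
  have hLself : Step L Act.tau L :=
    (h3 _ _).2 (.inl ⟨var Y, .sum_left _ (.pre _ _), by simp [Expr.subst]⟩)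
  have hLstep : ∀ {a E'}, Step E a E' →
      Step L a (E'.subst (Function.update (Function.update var X P) Y L)) := fun h =>
    (h3 _ _).2 (.inl ⟨_, .sum_right _ h, rfl⟩)
  have hMstep : ∀ {a E'}, Step E a E' →
      Step M a (E'.subst (Function.update (Function.update var X Q) Y M)) := fun h =>
    (h4 _ _).2 (.inl ⟨_, h, rfl⟩)
  have hback : Step (E₁.subst (Function.update (Function.update var X Q) Y M)) Act.tau M :=
    (step_subst_iff hρ).2 (.inr ⟨X, hX, by rw [hρX]; exact (h2 _ _).2 (.inl ⟨rfl, rfl⟩)⟩)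
  have hLMm : StrongMatch (Bis R) L M ∧ StrongMatch (Bis R) M L := by
    refine ⟨⟨fun a T h₀ => ?_, fun Z hZ => ?_⟩, ⟨fun a T h₀ => ?_, fun Z hZ => ?_⟩⟩
    · rcases (h3 a T).1 h₀ with ⟨E', h, rfl⟩ | ⟨W, hW, h5, h6⟩
      · rcases step_sum_iff.1 h with h | h
        · obtain ⟨rfl, rfl⟩ := step_pre_iff.1 h
          have hT : (var Y).subst (Function.update (Function.update var X P) Y L) = L := by
            simp [Expr.subst]
          rw [hT]
          -- If `E` exposes `X` immediately, the cycle has length one and `M` steps to itself.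
          -- Otherwise `M` takes the first step of the path to `E₁`.
          rcases hE₁.eq_or_plus with rfl | h7
          · refine ⟨M, (h4 _ _).2 (.inr ⟨X, hXY, hX, ?_⟩), hLM⟩
            rw [hρX₀]; exact (h2 _ _).2 (.inl ⟨rfl, rfl⟩)
          · obtain ⟨K, h8, h9⟩ := h7.exists_head
            exact ⟨_, hMstep h8, .inl (.inr ⟨K, rfl, rfl, .single h8, h9⟩)⟩
        · exact ⟨_, hMstep h, hK E'⟩
      · obtain ⟨T', h7, h8⟩ := (hvar W).1.1 a T h6
        refine ⟨T', (h4 _ _).2 (.inr ⟨W, hW, ?_, h7⟩), h8⟩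
        simpa using h5
    · obtain ⟨W, h5, h6, h7⟩ := (h3' Z).1 hZ
      exact (h4' Z).2 ⟨W, h5, by simpa using h6, (hvar W).1.2 Z h7⟩
    · rcases (h4 a T).1 h₀ with ⟨E', h, rfl⟩ | ⟨W, hW, h5, h6⟩
      · exact ⟨_, hLstep h, (hK E').symm⟩
      · obtain ⟨T', h7, h8⟩ := (hvar W).2.1 a T h6
        exact ⟨T', (h3 _ _).2 (.inr ⟨W, hW, h5.sum_right _, h7⟩), h8⟩
    · obtain ⟨W, h5, h6, h7⟩ := (h4' Z).1 hZ
      exact (h3' Z).2 ⟨W, h5, h6.sum_right _, (hvar W).2.2 Z h7⟩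
  have hrel_m : ∀ {U W}, U = W ∨ R₀ U W → StrongMatch (Bis R) U W ∧ StrongMatch (Bis R) W U := by
    rintro U W (h | ⟨hU, hW⟩ | ⟨hU, hW⟩)
    · rw [h]; exact ⟨.refl (Bis.refl _) _, .refl (Bis.refl _) _⟩
    · rw [hU, hW]; exact hPQ
    · rw [hU, hW]; exact hLMm
  have hinst : ∀ {U W}, Instances R₀ U W →
      StrongMatch (Bis R) U W ∧ StrongMatch (Bis R) W U := by
    rintro _ _ ⟨K, α, β, hα, hβ, hαβ, rfl, rfl⟩
    have hK : ∀ K : Expr V A, Bis R (K.subst α) (K.subst β) := fun K =>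
      hI ⟨K, α, β, hα, hβ, hαβ, rfl, rfl⟩
    exact ⟨StrongMatch.subst hα hβ hK (fun W => (hrel_m (hαβ W)).1) K,
      StrongMatch.subst hβ hα (fun K => (hK K).symm) (fun W => (hrel_m (hαβ W)).2) K⟩
  have hR : ∀ U W, Bis R U W → DivBisimilar U W := by
    refine fun U W => divBisimilar_of_bis ?_
    rintro U W (h | ⟨K, rfl, rfl, h5, h6⟩)
    · exact ⟨((hinst h).1.progress (hI h)).divBranching,
        ((hinst h).2.progress (hI h).symm).divBranching⟩
    · constructor
      · have h7 := ((h6.subst hρ).tail hback).star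
        refine ProgressMatch.divBranching ⟨fun a T h₀ => ?_, fun Z hZ => ?_⟩
        · obtain ⟨T', h8, h9⟩ := hLMm.1.1 a T h₀
          exact ⟨M, T', h7, h8, hLM, h9⟩
        · exact ⟨M, h7, hLM, hLMm.1.2 Z hZ⟩
      · obtain ⟨E₂, h7, h8⟩ := h5.exists_head
        have h9 := (TauStar.head (hLstep h7) (h8.subst hσ)).star
        have hKm := (hinst (U := K.subst _) ⟨K, _, _, hσ, hρ, hrel, rfl, rfl⟩).2
        refine ProgressMatch.divBranching ⟨fun a T h₀ => ?_, fun Z hZ => ?_⟩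
        · obtain ⟨T', h10, h11⟩ := hKm.1 a T h₀
          exact ⟨_, T', h9, h10, (hK K).symm, h11⟩
        · exact ⟨_, h9, (hK K).symm, hKm.2 Z hZ⟩
  exact ⟨hPQ.1.mono hR, hPQ.2.mono hR⟩

/-- Soundness. -/
theorem Provable.rooted {E F : Expr V A} (h : Provable E F) : Rooted E F := by
  induction h with
  | refl E => exact .refl E
  | symm _ ih => exact ih.symm
  | trans _ _ ih ih' => exact ih.trans ih'
  | pre_congr a _ ih => exact .pre a ih.divBisimilar
  | sum_congr _ _ ih ih' => exact ih.sum ih'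
  | mu_congr X _ ih => exact ih.mu X
  | S1 E F => exact .of_iff (by simp [or_comm]) (by simp [or_comm])
  | S2 E F G => exact .of_iff (by simp [or_assoc]) (by simp [or_assoc])
  | S3 E => exact .of_iff (by simp) (by simp)
  | S4 E => exact .of_iff (by simp) (by simp)
  | B a E F => exact rooted_branching_axiom a E F
  | R0 X Y E h => exact .of_nf (nf_mu_rename h ▸ .refl _)
  | R1 X E => exact .unfold X E
  | R2 X E F hE _ ih => exact .unique hE ih (.unfold X E)
  | R3 X E => exact rooted_mu_unguarded X E
  | R4 X E F G h => exact rooted_mu_tau_tau F G h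
  | R5 X Y E F hXY h => exact rooted_mu_tau_loop F hXY h
  | R6 X E => exact rooted_mu_tau X E
  | R7 X Y E => exact rooted_mu_loop X Y E
  | R8 X Y E F => exact rooted_mu_mu X Y E F

end Axioms

/-- `μY.(τ.Y + G)`, to be used with `Y` not free in `G`. -/
def loop {V : Type u} {A : Type v} (Y : V) (G : Expr V A) : Expr V A :=
  mu Y (sum (pre Act.tau (var Y)) G)

theorem FV_loop {V : Type u} {A : Type v} [DecidableEq V] (Y : V) (G : Expr V A) :
    (loop Y G).FV = G.FV.erase Y := by
  simp only [loop, FV]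
  ext W
  simp only [Finset.mem_erase, Finset.mem_union, Finset.mem_singleton]
  tauto

/-! ### Derived equations: substitution, absorption and silent loops -/

section Derivations

variable {V : Type u} {A : Type v} [DecidableEq V] [Infinite V]

theorem Provable.nf : ∀ E : Expr V A, Provable E E.nf
  | nil => .refl _
  | var _ => .refl _
  | pre a E => .pre_congr a (Provable.nf E)
  | sum E F => .sum_congr (Provable.nf E) (Provable.nf F)
  | mu X E => by
      refine .R0 X _ E ?_
      have h := fresh_notMem ((E.FV.erase X).biUnion fun Y => (var Y : Expr V A).FV)
      intro h'
      exact h (Finset.mem_biUnion.2 ⟨_, h', by simp [FV]⟩)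

theorem Provable.of_eq {E F : Expr V A} (h : E = F) : Provable E F := h ▸ .refl E

/-- This frees derivations from the bound name fixed by `subst`. The normal forms on the right
appear because the renaming in R0 is itself a substitution and acts on the values of `σ`. -/
theorem Provable.mu_rename {X Y : V} {E : Expr V A} (σ : V → Expr V A)
    (hY : ∀ W ∈ E.FV, W ≠ X → Y ∉ (σ W).FV) : Provable ((mu X E).subst σ)
      (mu Y (E.subst (Function.update (fun W => (σ W).nf) X (var Y)))) := by
  have hFV := FV_subst (mu X E) σ
  simp only [Expr.subst] at hFV ⊢
  have hfr : ∀ {W}, W ∈ E.FV → W ≠ X → _ := fun {W} => fresh_notMem_subst (σ := σ) (E := E)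
  generalize fresh ((E.FV.erase X).biUnion fun Y => (σ Y).FV) = Z at *
  refine .trans (.R0 Z Y _ ?_) (.of_eq ?_)
  · rw [hFV]
    intro h
    obtain ⟨W, h1, h2⟩ := Finset.mem_biUnion.1 h
    obtain ⟨h3, h4⟩ := Finset.mem_erase.1 h1
    exact hY W h4 h3 h2
  · congr 1
    unfold subst₁
    rw [subst_subst]
    refine subst_congr _ fun W hW => ?_
    by_cases hWX : W = X
    · subst hWX; simp [Expr.subst]
    · simp only [Function.update_of_ne hWX]
      exact subst₁_of_notMem _ (hfr hW hWX)

theorem Provable.subst : ∀ (E : Expr V A) {σ ρ : V → Expr V A},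
    (∀ W, Provable (σ W) (ρ W)) → Provable (E.subst σ) (E.subst ρ)
  | nil, _, _, _ => .refl _
  | var X, _, _, h => h X
  | pre a E, _, _, h => .pre_congr a (Provable.subst E h)
  | sum E F, _, _, h => .sum_congr (Provable.subst E h) (Provable.subst F h)
  | mu X E, σ, ρ, h => by
      -- The two instances have unrelated bound names. A name fresh for both makes the congruence
      -- rule for a single `μY` applicable.
      obtain ⟨Y, hY⟩ := Infinite.exists_notMem_finset
        ((E.FV.biUnion fun W => (σ W).FV) ∪ (E.FV.biUnion fun W => (ρ W).FV))
      simp only [Finset.mem_union, Finset.mem_biUnion, not_or, not_exists, not_and] at hY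
      refine (Provable.mu_rename σ fun W hW _ => hY.1 W hW).trans
        (Provable.trans ?_ (Provable.mu_rename ρ fun W hW _ => hY.2 W hW).symm)
      refine .mu_congr Y (Provable.subst E fun W => ?_)
      by_cases hW : W = X
      · subst hW; simpa using .refl _
      · simpa only [Function.update_of_ne hW] using (Provable.nf _).symm.trans ((h W).trans (.nf _))

/-- `E` absorbs `F`. -/
def Absorbs (E F : Expr V A) : Prop := Provable (sum E F) E

theorem Absorbs.refl (E : Expr V A) : Absorbs E E := .S3 E

theorem Absorbs.trans {E F G : Expr V A} (h : Absorbs E F) (h' : Absorbs F G) : Absorbs E G :=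
  (Provable.sum_congr h.symm (.refl G)).trans <| (Provable.S2 E F G).symm.trans <|
    (Provable.sum_congr (.refl E) h').trans h

theorem Absorbs.antisymm {E F : Expr V A} (h : Absorbs E F) (h' : Absorbs F E) : Provable E F :=
  Provable.trans (.symm h) <| (Provable.S1 E F).trans h'

theorem Absorbs.sum_left (E F : Expr V A) : Absorbs (sum E F) E :=
  (Provable.S1 (sum E F) E).trans <| (Provable.S2 E E F).trans <|
    .sum_congr (.S3 E) (.refl F)

theorem Absorbs.of_provable {E F : Expr V A} (h : Provable E F) : Absorbs E F :=
  (Provable.sum_congr (.refl E) h.symm).trans (.S3 E)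

theorem Absorbs.sum_right (E F : Expr V A) : Absorbs (sum E F) F :=
  (Absorbs.of_provable (.S1 E F)).trans (.sum_left F E)

theorem Absorbs.sum {E F G : Expr V A} (h : Absorbs E F) (h' : Absorbs E G) :
    Absorbs E (sum F G) :=
  (Provable.S2 E F G).trans <| (Provable.sum_congr h (.refl G)).trans h'

theorem Absorbs.nil (E : Expr V A) : Absorbs E nil := .S4 E

/-- Consequence of the branching axiom. -/
theorem Provable.tau_absorb {a : Act A} {N H : Expr V A} (h : Absorbs N H) :
    Provable (pre a (sum (pre Act.tau N) H)) (pre a N) :=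
  (Provable.pre_congr a (.sum_congr (.pre_congr _ (.symm h)) (.refl H))).trans <|
    (Provable.B a N H).trans (.pre_congr a h)

theorem Provable.pre_tau (a : Act A) (N : Expr V A) :
    Provable (pre a (pre Act.tau N)) (pre a N) :=
  (Provable.pre_congr a (.symm (.S4 _))).trans (.tau_absorb (.nil N))

theorem Provable.loop (Y : V) {G H : Expr V A} (h : Provable G H) :
    Provable (loop Y G) (Expr.loop Y H) := .mu_congr Y (.sum_congr (.refl _) h)

theorem Provable.loop_subst {Y Z : V} {G : Expr V A} (σ : V → Expr V A) (hY : Y ∉ G.FV)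
    (hZ : Z ∉ (G.subst σ).FV) : Provable ((Expr.loop Y G).subst σ) (Expr.loop Z (G.subst σ)) := by
  rw [FV_subst] at hZ
  refine (Provable.mu_rename (Y := Z) σ fun W hW hWY h => hZ ?_).trans ?_
  · have : W ∈ (Expr.loop Y G).FV := Finset.mem_erase.2 ⟨hWY, hW⟩
    rw [FV_loop] at this
    exact Finset.mem_biUnion.2 ⟨W, (Finset.mem_erase.1 this).2, h⟩
  · simp only [Expr.subst, Function.update_self]
    refine .loop Z (.trans (.of_eq (subst_congr _ fun W hW => ?_))
      (Provable.subst G fun W => (Provable.nf (σ W)).symm))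
    exact Function.update_of_ne (fun h => hY (by rwa [← h])) _ _

theorem Provable.loop_rename {Y Z : V} {G : Expr V A} (hY : Y ∉ G.FV) (hZ : Z ∉ G.FV) :
    Provable (Expr.loop Y G) (Expr.loop Z G) := by
  refine (Provable.nf _).trans ((Provable.loop_subst (Z := Z) var hY ?_).trans
    (.loop Z (Provable.nf G).symm))
  simpa [FV_subst, FV] using hZ

theorem Provable.subst₁_of_notMem {Y : V} {G : Expr V A} (F : Expr V A) (hY : Y ∉ G.FV) :
    Provable (G.subst₁ Y F) G := by
  rw [Expr.subst₁_of_notMem F hY]; exact (Provable.nf G).symm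

theorem Provable.mu_dummy {Y : V} {G : Expr V A} (hY : Y ∉ G.FV) : Provable (mu Y G) G :=
  (Provable.R1 Y G).trans (.subst₁_of_notMem _ hY)

theorem Provable.loop_unfold {Y : V} {G : Expr V A} (hY : Y ∉ G.FV) :
    Provable (Expr.loop Y G) (sum (pre Act.tau (Expr.loop Y G)) G) := by
  refine (Provable.R1 Y _).trans ?_
  change Provable (sum (pre Act.tau (Function.update var Y (Expr.loop Y G) Y))
    (G.subst₁ Y (Expr.loop Y G))) _
  rw [Function.update_self]
  exact .sum_congr (.refl _) (.subst₁_of_notMem _ hY)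

/-- R7 removes the outer silent loop, and the recursion over `X` that remains is vacuous. -/
theorem Provable.loop_loop {X Y : V} {G : Expr V A} (hX : X ∉ G.FV) :
    Provable (Expr.loop X (Expr.loop Y G)) (Expr.loop Y G) := by
  refine (Provable.R7 X Y G).trans (.mu_dummy (G := Expr.loop Y G) ?_)
  rw [FV_loop]
  exact fun h => hX (Finset.mem_of_mem_erase h)

theorem Provable.mu_tau_loop {X Y : V} {E : Expr V A} (hXY : X ≠ Y) (hE : WeaklyExposes E X)
    (hY : Y ∉ E.FV) :
    Provable (mu X (pre Act.tau (Expr.loop Y E))) (mu X (pre Act.tau E)) :=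
  (Provable.mu_congr X (.symm (.S4 _))).trans <| (Provable.R5 X Y E nil hXY hE).trans <|
    .mu_congr X <| (Provable.S4 _).trans <| .pre_congr _ (.mu_dummy hY)

theorem Provable.mu_tau_sum_var {X : V} {G : Expr V A} (hX : X ∉ G.FV) :
    Provable (mu X (pre Act.tau (sum (var X) G))) (pre Act.tau (Expr.loop X G)) := by
  refine (Provable.R6 X _).trans (.pre_congr _ ?_)
  change Provable (mu X (sum (Function.update var X (pre Act.tau (var X)) X)
    (G.subst₁ X (pre Act.tau (var X))))) _
  rw [Function.update_self]
  exact .loop X (.subst₁_of_notMem _ hX)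

/-- A silent loop from which one can escape to the loop `N` that absorbs the rest. -/
theorem Provable.tau_loop_absorb {U Y : V} {G H N : Expr V A} (hY : Y ∉ G.FV)
    (hN : Provable N (Expr.loop Y G)) (hGH : Absorbs G H) (hUN : U ∉ N.FV) (hUH : U ∉ H.FV) :
    Provable (pre Act.tau (Expr.loop U (sum (pre Act.tau N) H))) (pre Act.tau N) := by
  obtain ⟨W, hW⟩ := Infinite.exists_notMem_finset (G.FV ∪ H.FV ∪ N.FV)
  obtain ⟨X, hX⟩ := Infinite.exists_notMem_finset (insert W (G.FV ∪ H.FV ∪ N.FV))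
  obtain ⟨Z, hZ⟩ := Infinite.exists_notMem_finset (insert W (G.FV ∪ H.FV ∪ N.FV))
  simp only [Finset.mem_insert, Finset.mem_union, not_or] at hW hX hZ
  obtain ⟨⟨hWG, hWH⟩, hWN⟩ := hW
  obtain ⟨hXW, ⟨hXG, hXH⟩, hXN⟩ := hX
  obtain ⟨hZW, ⟨hZG, hZH⟩, hZN⟩ := hZ
  -- R5 deletes silent loops only where the recursion variable is weakly exposed. So `N` is opened
  -- up by an extra summand `W`, and `W₀` ties `W` back to the whole expression. Evaluating `W₀` in
  -- two ways proves the claim.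
  set NW := Expr.loop X (sum (var W) G) with hNW
  set E := sum (pre Act.tau NW) H with hE
  set W₀ := mu W (pre Act.tau (Expr.loop Z E)) with hW₀
  have hXWG : X ∉ (sum (var W) G).FV := by simp [FV, hXW, hXG]
  have hZNW : Z ∉ NW.FV := by
    rw [hNW, FV_loop]; simp [FV, hZW, hZG]
  have hZE : Z ∉ E.FV := by
    rw [hE]; simp only [FV, Finset.mem_union, not_or]; exact ⟨hZNW, hZH⟩
  have hNWexp : Exposes NW W := exposes_mu_iff.2 ⟨by simp, Ne.symm hXW⟩
  have hNWH : Absorbs NW H :=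
    (Absorbs.of_provable (.loop_unfold hXWG)).trans <| (Absorbs.sum_right _ _).trans <|
      (Absorbs.sum_right _ _).trans hGH
  have hNX : Provable (Expr.loop X G) N := (Provable.loop_rename hXG hY).trans hN.symm
  -- First evaluation: R5 drops the outer loop, B absorbs `H`, R5 drops the loop of `NW`, and R6
  -- turns `μW.τ.(W + G)` into `τ.τ*G`.
  have h1 : Provable W₀ (pre Act.tau N) :=
    (Provable.mu_tau_loop (Ne.symm hZW)
      ⟨NW, .single (.sum_left _ (.pre _ _)), hNWexp⟩ hZE).trans <|
    (Provable.mu_congr W (.tau_absorb hNWH)).trans <|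
    (Provable.mu_tau_loop (Ne.symm hXW) ⟨_, .refl _, .sum_left _ (.var W)⟩ hXWG).trans <|
    (Provable.mu_tau_sum_var hWG).trans <|
    .pre_congr _ ((Provable.loop_rename hWG hXG).trans hNX)
  have hsub : ∀ {K : Expr V A}, W ∉ K.FV → Provable (K.subst₁ W W₀) K := fun h =>
    .subst₁_of_notMem _ h
  -- Second evaluation: unfolding `W₀` puts `τ.N` for `W`. Since `τ.N + G` is the unfolding of `N`,
  -- the instance of `NW` is a loop around a loop, hence `N` again.
  have h2 : Provable (NW.subst₁ W W₀) N := by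
    obtain ⟨X', hX'⟩ := Infinite.exists_notMem_finset
      (((sum (var W) G).subst₁ W W₀).FV ∪ (G.FV ∪ N.FV))
    simp only [Finset.mem_union, not_or] at hX'
    refine (Provable.loop_subst _ hXWG hX'.1).trans ?_
    refine Provable.trans (.loop X' ?_) ((Provable.loop_loop (Y := Y) hX'.2.1).trans hN.symm)
    change Provable (sum (Function.update var W W₀ W) (G.subst₁ W W₀)) _
    rw [Function.update_self]
    refine (Provable.sum_congr (h1.trans (.pre_congr _ hN)) (hsub hWG)).trans ?_
    exact (Provable.loop_unfold hY).symm
  obtain ⟨Z', hZ'⟩ := Infinite.exists_notMem_finset ((E.subst₁ W W₀).FV ∪ (H.FV ∪ N.FV))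
  simp only [Finset.mem_union, not_or] at hZ'
  have h3 : Provable W₀ (pre Act.tau (Expr.loop Z' (sum (pre Act.tau N) H))) := by
    refine (Provable.R1 W _).trans (.pre_congr _ ?_)
    refine (Provable.loop_subst _ hZE hZ'.1).trans (.loop Z' ?_)
    exact .sum_congr (.pre_congr _ h2) (hsub hWH)
  refine Provable.trans (.pre_congr _ (.loop_rename ?_ ?_)) (h3.symm.trans h1)
  · simp [FV, hUN, hUH]
  · simp [FV, hZ'.2.1, hZ'.2.2]

end Derivations

/-! ### Sums of prefixed variables and of variables -/

section SimpleSums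

variable {V : Type u} {A : Type v} {P : V → Prop}

theorem IsSimpleSum.mem_FV_of_pre [DecidableEq V] [Infinite V] {G : Expr V A}
    (hG : IsSimpleSum P G) {a : Act A} {K : Expr V A} (h : Step G a K) :
    ∃ X, P X ∧ X ∈ G.FV ∧ K = Expr.var X := by
  induction hG with
  | nil => simp at h
  | pre b hX => obtain ⟨_, rfl⟩ := step_pre_iff.1 h; exact ⟨_, hX, by simp [FV], rfl⟩
  | var => simp at h
  | sum _ _ ih ih' =>
    rcases step_sum_iff.1 h with h | h
    · obtain ⟨X, h1, h2, h3⟩ := ih h; exact ⟨X, h1, by simp [FV, h2], h3⟩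
    · obtain ⟨X, h1, h2, h3⟩ := ih' h; exact ⟨X, h1, by simp [FV, h2], h3⟩

theorem IsSimpleSum.of_exposes [DecidableEq V] [Infinite V] {G : Expr V A}
    (hG : IsSimpleSum P G) {X : V} (h : Exposes G X) : ¬ P X ∧ X ∈ G.FV := by
  induction hG with
  | nil => simp at h
  | pre b hX => simp at h
  | var hW => rw [exposes_var_iff] at h; subst h; exact ⟨hW, by simp [FV]⟩
  | sum _ _ ih ih' =>
    rcases exposes_sum_iff.1 h with h | h
    · exact ⟨(ih h).1, by simp [FV, (ih h).2]⟩
    · exact ⟨(ih' h).1, by simp [FV, (ih' h).2]⟩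

theorem IsSimpleSum.step_subst [DecidableEq V] [Infinite V] {G : Expr V A}
    (hG : IsSimpleSum P G) {a : Act A} {X : V} (σ : V → Expr V A) (h : Step G a (Expr.var X)) :
    Step (G.subst σ) a (σ X) := by
  induction hG with
  | nil => simp at h
  | pre b hX => obtain ⟨rfl, h⟩ := step_pre_iff.1 h; cases h; exact .pre _ _
  | var => simp at h
  | sum _ _ ih ih' =>
    rcases step_sum_iff.1 h with h | h
    · exact (ih h).sum_left _
    · exact (ih' h).sum_right _

/-- An expression absorbs an instance of a simple sum if it absorbs that of each summand. -/
theorem IsSimpleSum.absorbs [DecidableEq V] [Infinite V] {G : Expr V A} (hG : IsSimpleSum P G)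
    {σ : V → Expr V A} {T : Expr V A}
    (h : ∀ a X, Step G a (Expr.var X) → Absorbs T (Expr.pre a (σ X)))
    (h' : ∀ X, Exposes G X → Absorbs T (σ X)) : Absorbs T (G.subst σ) := by
  induction hG with
  | nil => exact .nil T
  | pre b hX => exact h b _ (.pre _ _)
  | var hW => exact h' _ (.var _)
  | sum _ _ ih ih' =>
    exact .sum (ih (fun a X hs => h a X (hs.sum_left _)) fun X hX => h' X (hX.sum_left _))
      (ih' (fun a X hs => h a X (hs.sum_right _)) fun X hX => h' X (hX.sum_right _))

theorem IsSimpleSum.absorbs_pre [DecidableEq V] [Infinite V] {G : Expr V A}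
    (hG : IsSimpleSum P G) (σ : V → Expr V A) {a : Act A} {X : V}
    (h : Step G a (Expr.var X)) : Absorbs (G.subst σ) (Expr.pre a (σ X)) := by
  induction hG with
  | nil => simp at h
  | pre b hX => obtain ⟨rfl, h⟩ := step_pre_iff.1 h; cases h; exact .refl _
  | var => simp at h
  | sum _ _ ih ih' =>
    rcases step_sum_iff.1 h with h | h
    · exact (Absorbs.sum_left _ _).trans (ih h)
    · exact (Absorbs.sum_right _ _).trans (ih' h)

theorem IsSimpleSum.absorbs_var [DecidableEq V] [Infinite V] {G : Expr V A}
    (hG : IsSimpleSum P G) (σ : V → Expr V A) {X : V}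
    (h : Exposes G X) : Absorbs (G.subst σ) (σ X) := by
  induction hG with
  | nil => simp at h
  | pre b hX => simp at h
  | var => rw [exposes_var_iff] at h; subst h; exact .refl _
  | sum _ _ ih ih' =>
    rcases exposes_sum_iff.1 h with h | h
    · exact (Absorbs.sum_left _ _).trans (ih h)
    · exact (Absorbs.sum_right _ _).trans (ih' h)

/-- The part of a simple sum outside a set of prefixed summands. -/
theorem IsSimpleSum.exists_filter [DecidableEq V] [Infinite V] {G : Expr V A}
    (hG : IsSimpleSum P G) (p : Act A → V → Prop) : ∃ H, IsSimpleSum P H ∧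
      (∀ a X, Step H a (Expr.var X) ↔ Step G a (Expr.var X) ∧ ¬ p a X) ∧
      ∀ X, Exposes H X ↔ Exposes G X := by
  induction hG with
  | nil => exact ⟨Expr.nil, .nil, by simp, by simp⟩
  | @pre b X hX =>
    by_cases hp : p b X
    · refine ⟨Expr.nil, .nil, ?_, by simp⟩
      intro a Y
      simp only [not_step_nil, step_pre_iff, false_iff, not_and, not_not, Expr.var.injEq]
      rintro ⟨rfl, rfl⟩; exact hp
    · refine ⟨_, .pre b hX, ?_, by simp⟩
      intro a Y
      simp only [step_pre_iff, Expr.var.injEq]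
      refine ⟨?_, fun h => h.1⟩
      rintro ⟨rfl, rfl⟩; exact ⟨⟨rfl, rfl⟩, hp⟩
  | var hW => exact ⟨_, .var hW, by simp, by simp⟩
  | sum _ _ ih ih' =>
    obtain ⟨H, h1, h2, h3⟩ := ih
    obtain ⟨H', h1', h2', h3'⟩ := ih'
    refine ⟨_, .sum h1 h1', ?_, by simp [h3, h3']⟩
    intro a X
    simp only [step_sum_iff, h2, h2']
    tauto

end SimpleSums

end Expr

open _root_.FiniteState.Expr

namespace EqSystem

/-! ### Equation systems: existence of solutions, standard form, models -/

section Instantiation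

variable {V : Type u} {A : Type v} {n : ℕ}

theorem inst_formal (S : EqSystem V A n) (D : Fin n → Expr V A) (i : Fin n) :
    S.inst D (S.formal i) = D i := S.formal_injective.extend_apply _ _ _

theorem inst_of_notMem (S : EqSystem V A n) (D : Fin n → Expr V A) {X : V}
    (h : X ∉ Set.range S.formal) : S.inst D X = Expr.var X :=
  Function.extend_apply' _ _ _ fun ⟨i, hi⟩ => h ⟨i, hi⟩

end Instantiation

variable {V : Type u} {A : Type v} [DecidableEq V] [Infinite V] {n : ℕ}

theorem inst_nf (S : EqSystem V A n) (D : Fin n → Expr V A) (X : V) :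
    (S.inst D X).nf = S.inst (fun i => (D i).nf) X := by
  by_cases h : X ∈ Set.range S.formal
  · obtain ⟨i, rfl⟩ := h; rw [inst_formal, inst_formal]
  · rw [S.inst_of_notMem _ h, S.inst_of_notMem _ h]; rfl

theorem normal_inst (S : EqSystem V A n) {D : Fin n → Expr V A} (h : ∀ i, (D i).nf = D i) :
    Normal (S.inst D) := by
  intro X
  rw [inst_nf]; simp only [h]

/-- Every recursive equation system has a solution. -/
theorem exists_isSolution : ∀ {n : ℕ} (S : EqSystem V A n), ∃ D, S.IsSolution D
  | 0, _ => ⟨fun i => i.elim0, fun i => i.elim0⟩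
  | n + 1, S => by
      -- Elimination: the first equation is solved by a recursion over its own variable, the result
      -- is substituted in the others, and the smaller system is solved by induction.
      let X := S.formal 0
      let M := Expr.mu X (S.rhs 0)
      let S' : EqSystem V A n :=
        { formal := fun i => S.formal i.succ
          formal_injective := S.formal_injective.comp (Fin.succ_injective n)
          rhs := fun i => (S.rhs i.succ).subst₁ X M }
      obtain ⟨D', hD'⟩ := exists_isSolution S'
      let D : Fin (n + 1) → Expr V A := Fin.cons (M.subst (S'.inst D')) D'
      have hinst : Function.update (S'.inst D') X (M.subst (S'.inst D')) = S.inst D := by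
        funext W
        by_cases hW : W ∈ Set.range S.formal
        · obtain ⟨i, rfl⟩ := hW
          rw [inst_formal]
          refine Fin.cases ?_ (fun i => ?_) i
          · simp [X, D]
          · rw [Function.update_of_ne (fun h => Fin.succ_ne_zero i (S.formal_injective h))]
            exact S'.inst_formal D' i
        · have hWX : W ≠ X := by rintro rfl; exact hW ⟨0, rfl⟩
          rw [S.inst_of_notMem _ hW, Function.update_of_ne hWX]
          refine S'.inst_of_notMem _ ?_
          rintro ⟨i, hi⟩
          exact hW ⟨i.succ, hi⟩
      refine ⟨D, Fin.cases ?_ fun i => ?_⟩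
      · obtain ⟨Y, hY⟩ := Infinite.exists_notMem_finset
          ((S.rhs 0).FV.biUnion fun W => (S'.inst D' W).FV)
        have hY' : ∀ W ∈ (S.rhs 0).FV, W ≠ X → Y ∉ (S'.inst D' W).FV := fun W hW _ h =>
          hY (Finset.mem_biUnion.2 ⟨W, hW, h⟩)
        have h1 : Provable (M.subst (S'.inst D')) _ := .mu_rename (S'.inst D') hY'
        refine h1.trans ((Provable.R1 Y _).trans ?_)
        rw [← hinst]
        unfold subst₁
        rw [subst_subst]
        have h2 : ∀ {W}, W ∈ (S.rhs 0).FV → W ≠ X → Y ∉ ((S'.inst D' W).nf).FV := by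
          intro W hW hWX
          simpa [Expr.nf, FV_subst, FV] using hY' W hW hWX
        refine Provable.trans (.of_eq (subst_congr _ (ρ := Function.update
          (fun W => (S'.inst D' W).nf) X (Expr.mu Y ((S.rhs 0).subst
            (Function.update (fun W => (S'.inst D' W).nf) X (Expr.var Y))))) fun W hW => ?_)) (Provable.subst _ fun W => ?_)
        rotate_left
        · by_cases hWX : W = X
          · subst hWX
            rw [Function.update_self, Function.update_self]
            exact h1.symm
          · simp only [Function.update_of_ne hWX]
            exact (Provable.nf _).symm
        · by_cases hWX : W = X
          · subst hWX; simp [Expr.subst]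
          · simp only [Function.update_of_ne hWX]
            exact (subst₁_of_notMem _ (h2 hW hWX)).trans (nf_nf _)
      · refine (hD' i).trans (.of_eq ?_)
        change ((S.rhs i.succ).subst₁ X M).subst (S'.inst D') = _
        rw [subst_subst₁, hinst]

/-- The right-hand sides of a standard system, taken apart: `S.rhs i` is `core i` or, if `i` is
looping, `τ*(core i)`. -/
structure StandardForm (S : EqSystem V A n) where
  core : Fin n → Expr V A
  simple : ∀ i, IsSimpleSum (· ∈ Set.range S.formal) (core i)
  looping : Fin n → Prop
  rhs_eq : ∀ i, ¬ looping i → S.rhs i = core i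
  rhs_eq_loop : ∀ i, looping i → ∃ Y, Y ∉ (core i).FV ∧ S.rhs i = loop Y (core i)
  guarded : S.IsGuarded

theorem IsStandard.exists_form {S : EqSystem V A n} (h : S.IsStandard) :
    Nonempty S.StandardForm := by
  have key : ∀ i, ∃ (G : Expr V A) (l : Prop), IsSimpleSum (· ∈ Set.range S.formal) G ∧
      (¬ l → S.rhs i = G) ∧ (l → ∃ Y, Y ∉ G.FV ∧ S.rhs i = loop Y G) := by
    intro i
    rcases h.2 i with h1 | ⟨G, h1, h2⟩
    · exact ⟨_, False, h1, fun _ => rfl, False.elim⟩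
    · exact ⟨G, True, h1, fun h => absurd trivial h, fun _ => h2⟩
  choose G l h1 h2 h3 using key
  exact ⟨⟨G, h1, l, h2, h3, h.1⟩⟩

/-- A family of `α`-normal forms that satisfies the equations up to rooted bisimilarity. -/
def IsModel (S : EqSystem V A n) (D : Fin n → Expr V A) : Prop :=
  (∀ i, (D i).nf = D i) ∧ ∀ i, Rooted (D i) ((S.rhs i).subst (S.inst D))

theorem IsSolution.isModel {S : EqSystem V A n} {D : Fin n → Expr V A} (h : S.IsSolution D) :
    S.IsModel fun i => (D i).nf := by
  refine ⟨fun i => nf_nf _, fun i => ?_⟩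
  have h1 : (S.rhs i).subst (S.inst fun i => (D i).nf) = ((S.rhs i).subst (S.inst D)).nf := by
    unfold nf
    rw [subst_subst]
    exact subst_congr _ fun X _ => (S.inst_nf D X).symm
  rw [h1]
  exact (Rooted.nf _).symm.trans ((h i).rooted.trans (Rooted.nf _))

/-! ### The graph of a standard system and uniqueness of its models -/

namespace StandardForm

variable {S : EqSystem V A n} (s : S.StandardForm)

/-- `a.X_j` is a summand of the right-hand side for `X_i`. -/
def Edge (i : Fin n) (a : Act A) (j : Fin n) : Prop :=
  Step (s.core i) a (Expr.var (S.formal j))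

/-- `X_j` can be reached from `X_i` by silent summands. -/
def Reach : Fin n → Fin n → Prop := Relation.ReflTransGen fun i j => s.Edge i Act.tau j

theorem step_core {i : Fin n} {a : Act A} {K : Expr V A} (h : Step (s.core i) a K) :
    ∃ j, s.Edge i a j ∧ K = Expr.var (S.formal j) := by
  obtain ⟨_, ⟨j, rfl⟩, _, rfl⟩ := (s.simple i).mem_FV_of_pre h
  exact ⟨j, h, rfl⟩

theorem unguarded_of_edge {i j : Fin n} (h : s.Edge i Act.tau j) : S.Unguarded i j := by
  refine ⟨_, .single ?_, .var _⟩
  by_cases hl : s.looping i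
  · obtain ⟨Y, hY, hr⟩ := s.rhs_eq_loop i hl
    rw [hr]
    refine Step.mu (.sum_right _ ?_)
    have h1 := (s.simple i).step_subst (Function.update var Y (loop Y (s.core i))) h
    obtain ⟨X, _, hX, h2⟩ := (s.simple i).mem_FV_of_pre h
    cases h2
    rwa [Function.update_of_ne (fun h => hY (by rwa [← h]))] at h1
  · rw [s.rhs_eq i hl]; exact h

theorem wellFounded : WellFounded fun j i => s.Edge i Act.tau j :=
  Subrelation.wf (fun h => s.unguarded_of_edge h) s.guarded

variable {D : Fin n → Expr V A}

theorem step_core_subst {i : Fin n} {a : Act A} {T : Expr V A} (hD : ∀ i, (D i).nf = D i) :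
    Step ((s.core i).subst (S.inst D)) a T ↔ ∃ j, s.Edge i a j ∧ T = D j := by
  rw [step_subst_iff (S.normal_inst hD)]
  constructor
  · rintro (⟨K, h, rfl⟩ | ⟨W, h, h'⟩)
    · obtain ⟨j, h1, rfl⟩ := s.step_core h
      exact ⟨j, h1, S.inst_formal D j⟩
    · rw [S.inst_of_notMem D ((s.simple i).of_exposes h).1] at h'
      simp at h'
  · rintro ⟨j, h, rfl⟩
    exact .inl ⟨_, h, (S.inst_formal D j).symm⟩

theorem exposes_core_subst {i : Fin n} {X : V} (hD : ∀ i, (D i).nf = D i) :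
    Exposes ((s.core i).subst (S.inst D)) X ↔ Exposes (s.core i) X := by
  rw [exposes_subst_iff (S.normal_inst hD)]
  constructor
  · rintro ⟨W, h, h'⟩
    rw [S.inst_of_notMem D ((s.simple i).of_exposes h).1, exposes_var_iff] at h'
    exact h' ▸ h
  · intro h
    exact ⟨X, h, by rw [S.inst_of_notMem D ((s.simple i).of_exposes h).1]; exact .var X⟩

/-- The loop variable is not free in the core, so the only move besides the edges is the silent one
back to the same instance. The graph with its looping nodes thus describes the instance exactly. -/
theorem step_rhs {i : Fin n} {a : Act A} {T : Expr V A} (hD : ∀ i, (D i).nf = D i) :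
    Step ((S.rhs i).subst (S.inst D)) a T ↔ (∃ j, s.Edge i a j ∧ T = D j) ∨
      (s.looping i ∧ a = Act.tau ∧ T = (S.rhs i).subst (S.inst D)) := by
  by_cases hl : s.looping i
  · obtain ⟨Y, hY, hr⟩ := s.rhs_eq_loop i hl
    have hYne : ∀ {W}, W ∈ (s.core i).FV → W ≠ Y := fun hW h => hY (by rwa [← h])
    rw [hr]
    unfold loop
    rw [step_mu_subst_iff (S.normal_inst hD)]
    constructor
    · rintro (⟨K, h, rfl⟩ | ⟨W, hW, h, h'⟩)
      · rcases step_sum_iff.1 h with h | h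
        · obtain ⟨rfl, rfl⟩ := step_pre_iff.1 h
          exact .inr ⟨hl, rfl, by simp [Expr.subst]⟩
        · obtain ⟨X, -, hX, rfl⟩ := (s.simple i).mem_FV_of_pre h
          obtain ⟨j, h1, h2⟩ := s.step_core h
          cases h2
          refine .inl ⟨j, h1, ?_⟩
          rw [Expr.subst, Function.update_of_ne (hYne hX), S.inst_formal]
      · simp only [exposes_sum_iff, not_exposes_pre, false_or] at h
        rw [S.inst_of_notMem D ((s.simple i).of_exposes h).1] at h'
        simp at h'
    · rintro (⟨j, h, rfl⟩ | ⟨_, rfl, rfl⟩)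
      · refine .inl ⟨_, .sum_right _ h, ?_⟩
        obtain ⟨X, -, hX, h2⟩ := (s.simple i).mem_FV_of_pre h
        cases h2
        rw [Expr.subst, Function.update_of_ne (hYne hX), S.inst_formal]
      · exact .inl ⟨_, .sum_left _ (.pre _ _), by simp [Expr.subst]⟩
  · rw [s.rhs_eq i hl, s.step_core_subst hD]
    simp [hl]

theorem exposes_rhs {i : Fin n} {X : V} (hD : ∀ i, (D i).nf = D i) :
    Exposes ((S.rhs i).subst (S.inst D)) X ↔ Exposes (s.core i) X := by
  by_cases hl : s.looping i
  · obtain ⟨Y, hY, hr⟩ := s.rhs_eq_loop i hl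
    rw [hr]
    unfold loop
    rw [exposes_mu_subst_iff (S.normal_inst hD)]
    simp only [exposes_sum_iff, not_exposes_pre, false_or]
    constructor
    · rintro ⟨W, _, h, h'⟩
      rw [S.inst_of_notMem D ((s.simple i).of_exposes h).1, exposes_var_iff] at h'
      exact h' ▸ h
    · intro h
      refine ⟨X, ?_, h, by rw [S.inst_of_notMem D ((s.simple i).of_exposes h).1]; exact .var X⟩
      rintro rfl
      exact hY ((s.simple i).of_exposes h).2
  · rw [s.rhs_eq i hl, s.exposes_core_subst hD]

theorem tauStar_rhs {i : Fin n} {K : Expr V A} (hD : ∀ i, (D i).nf = D i)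
    (h : TauStar ((S.rhs i).subst (S.inst D)) K) :
    K = (S.rhs i).subst (S.inst D) ∨ ∃ j, s.Edge i Act.tau j ∧ TauStar (D j) K := by
  induction h with
  | refl => exact .inl rfl
  | tail _ hs ih =>
    rcases ih with rfl | ⟨j, h1, h2⟩
    · rcases (s.step_rhs hD).1 hs with ⟨j, h1, rfl⟩ | ⟨_, _, rfl⟩
      · exact .inr ⟨j, h1, .refl _⟩
      · exact .inl rfl
    · exact .inr ⟨j, h1, (h2.tail hs).star⟩

/-- Induction along the silent edges: seen through the equation, a silent path from `D i` either
stays at the right-hand side, at most circling in its loop, or takes an edge to a smaller index. -/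
theorem reach_of_tauStar (hD : S.IsModel D) (i : Fin n) : ∀ {K : Expr V A}, TauStar (D i) K →
    ∃ j, s.Reach i j ∧ DivBisimilar K (D j) := by
  induction i using s.wellFounded.induction with
  | _ i ih =>
    intro K hK
    obtain ⟨K', h1, h2⟩ := (hD.2 i).divBisimilar.star hK
    rcases s.tauStar_rhs hD.1 h1 with rfl | ⟨j, h3, h4⟩
    · exact ⟨i, .refl, h2.trans (hD.2 i).divBisimilar.symm⟩
    · obtain ⟨l, h5, h6⟩ := ih j h3 h4
      exact ⟨l, .head h3 h5, h2.trans h6⟩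

/-- The inert alternative covers both a step of the silent loop and a step that the right-hand side
answers by idling; every other step is an edge of some reachable index. -/
theorem edge_of_step (hD : S.IsModel D) (i : Fin n) : ∀ {K K' : Expr V A} {a : Act A},
    TauStar (D i) K → Step K a K' → ∃ j, s.Reach i j ∧ DivBisimilar K (D j) ∧
      ((a = Act.tau ∧ DivBisimilar K' (D j)) ∨ ∃ l, s.Edge j a l ∧ DivBisimilar K' (D l)) := by
  induction i using s.wellFounded.induction with
  | _ i ih =>
    intro K K' a hK hs
    have hDi := (hD.2 i).divBisimilar
    obtain ⟨K₁, h1, h2⟩ := hDi.star hK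
    rcases h2.divBranching.1.1 a K' hs with ⟨rfl, K₂, h3, h4, h5⟩ | ⟨K₂, K₃, h3, h4, h5, h6⟩
    · obtain ⟨K₃, h6, h7⟩ := hDi.symm.star (h1.trans h3)
      obtain ⟨j, h8, h9⟩ := s.reach_of_tauStar hD i h6
      exact ⟨j, h8, h4.trans (h7.trans h9), .inl ⟨rfl, h5.trans (h7.trans h9)⟩⟩
    · rcases s.tauStar_rhs hD.1 (h1.trans h3) with rfl | ⟨j, h7, h8⟩
      · refine ⟨i, .refl, h5.trans hDi.symm, ?_⟩
        rcases (s.step_rhs hD.1).1 h4 with ⟨l, h7, rfl⟩ | ⟨_, rfl, rfl⟩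
        · exact .inr ⟨l, h7, h6⟩
        · exact .inl ⟨rfl, h6.trans hDi.symm⟩
      · obtain ⟨l, h9, h10, h11⟩ := ih j h7 h8 h4
        refine ⟨l, .head h7 h9, h5.trans h10, ?_⟩
        rcases h11 with ⟨rfl, h11⟩ | ⟨m, h11, h12⟩
        · exact .inl ⟨rfl, h6.trans h11⟩
        · exact .inr ⟨m, h11, h6.trans h12⟩

theorem exposes_of_exposes (hD : S.IsModel D) (i : Fin n) : ∀ {K : Expr V A} {X : V},
    TauStar (D i) K → Exposes K X →
      ∃ j, s.Reach i j ∧ DivBisimilar K (D j) ∧ Exposes (s.core j) X := by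
  induction i using s.wellFounded.induction with
  | _ i ih =>
    intro K X hK hX
    have hDi := (hD.2 i).divBisimilar
    obtain ⟨K₁, h1, h2⟩ := hDi.star hK
    obtain ⟨K₂, h3, h4, h5⟩ := h2.divBranching.1.2 X hX
    rcases s.tauStar_rhs hD.1 (h1.trans h3) with rfl | ⟨j, h7, h8⟩
    · exact ⟨i, .refl, h4.trans hDi.symm, (s.exposes_rhs hD.1).1 h5⟩
    · obtain ⟨l, h9, h10, h11⟩ := ih j h7 h8 h5
      exact ⟨l, .head h7 h9, h4.trans h10, h11⟩

theorem step_of_edge (hD : S.IsModel D) {i j : Fin n} {a : Act A} (h : s.Edge i a j) :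
    ∃ K, Step (D i) a K ∧ DivBisimilar (D j) K :=
  (hD.2 i).2.1 a (D j) ((s.step_rhs hD.1).2 (.inl ⟨j, h, rfl⟩))

theorem tauStar_of_reach (hD : S.IsModel D) {i j : Fin n} (h : s.Reach i j) :
    ∃ K, TauStar (D i) K ∧ DivBisimilar (D j) K := by
  induction h with
  | refl => exact ⟨_, .refl _, .refl _⟩
  | tail _ h ih =>
    obtain ⟨K, h1, h2⟩ := ih
    obtain ⟨K', h3, h4⟩ := s.step_of_edge hD h
    obtain ⟨K'', h5, h6⟩ := h2.star (.single h3)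
    exact ⟨K'', h1.trans h5, h4.trans h6⟩

/-- A divergence either uses a silent edge or circles in the loop of `i`. In the first case the run
is bisimilar, from some point on, to a diverging `D l` with `l` strictly below `i`, and induction
applies after bringing `W` to a partner of `D' l`. In the second case `i` loops in both models. -/
theorem diverges_half (s : S.StandardForm) {D' : Fin n → Expr V A}
    (hD : S.IsModel D) (hD' : S.IsModel D')
    (i : Fin n) : ∀ {U W : Expr V A}, DivBisimilar U (D i) → DivBisimilar W (D' i) →
    ∀ run : ℕ → Expr V A, run 0 = U → (∀ k, TauStep (run k) (run (k + 1))) →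
    ∃ k W', TauPlus W W' ∧ ∃ j, DivBisimilar (run k) (D j) ∧ DivBisimilar W' (D' j) := by
  induction i using s.wellFounded.transGen.induction with
  | _ i ih =>
    intro U W hU hW run h0 hr
    have hDi := (hD.2 i).divBisimilar
    have hDi' := (hD'.2 i).divBisimilar
    obtain ⟨k, K, h1, h2⟩ := (hU.trans hDi).divBranching.2 run h0 hr
    obtain ⟨K₁, h3, h4⟩ := h1.exists_head
    have key : ∀ j, s.Edge i Act.tau j → TauStar (D j) K →
        ∃ k W', TauPlus W W' ∧ ∃ j, DivBisimilar (run k) (D j) ∧ DivBisimilar W' (D' j) := by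
      intro j hj hK
      obtain ⟨l, h5, h6⟩ := s.reach_of_tauStar hD j hK
      obtain ⟨K', h7, h8⟩ := s.step_of_edge hD' hj
      obtain ⟨K'', h9, h10⟩ := s.tauStar_of_reach hD' h5
      obtain ⟨K₃, h11, h12⟩ := h8.star h9
      obtain ⟨W₁, h13, h14⟩ := hW.symm.star (TauStar.head h7 h11).star
      have hlt : Relation.TransGen (fun j i => s.Edge i Act.tau j) l i :=
        Relation.TransGen.tail' (Relation.ReflTransGen.swap _ _ h5) hj
      obtain ⟨m, W', h15, h16⟩ := ih l hlt (h2.trans h6)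
        (h14.symm.trans (h12.symm.trans h10.symm)) (fun m => run (k + m)) rfl fun m => hr (k + m)
      exact ⟨k + m, W', h13.trans_plus h15, h16⟩
    rcases (s.step_rhs hD.1).1 h3 with ⟨j, h5, rfl⟩ | ⟨hl, _, rfl⟩
    · exact key j h5 h4
    · obtain ⟨m, W', h5, h6⟩ := (hW.trans hDi').symm.divBranching.2
        (fun _ => (S.rhs i).subst (S.inst D')) rfl
        fun _ => (s.step_rhs hD'.1).2 (.inr ⟨hl, rfl, rfl⟩)
      -- The run on the other side is the constant one in the loop of `i`. All its members are
      -- bisimilar to `D' i`, so the start of the given run serves as partner.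
      exact ⟨0, W', h5, i, h0 ▸ hU, h6.symm.trans hDi'.symm⟩

/-- The indices carry the simulation: a move of `U` is traced to the graph, the graph is realised in
`D'`, and `W` follows by bisimilarity. -/
theorem unique_half (s : S.StandardForm) {D' : Fin n → Expr V A}
    (hD : S.IsModel D) (hD' : S.IsModel D')
    {U W : Expr V A} (h : ∃ i, DivBisimilar U (D i) ∧ DivBisimilar W (D' i)) :
    DivBranching (fun U W => ∃ i, DivBisimilar U (D i) ∧ DivBisimilar W (D' i)) U W := by
  obtain ⟨i, hU, hW⟩ := h
  have hreach : ∀ {j}, s.Reach i j → ∃ W', TauStar W W' ∧ DivBisimilar W' (D' j) := by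
    intro j hj
    obtain ⟨K, h1, h2⟩ := s.tauStar_of_reach hD' hj
    obtain ⟨W', h3, h4⟩ := hW.symm.star h1
    exact ⟨W', h3, h4.symm.trans h2.symm⟩
  refine ⟨⟨fun a U' hs => ?_, fun X hX => ?_⟩, fun run h0 hr => ?_⟩
  · rcases hU.divBranching.1.1 a U' hs with ⟨rfl, K, h1, h2, h3⟩ | ⟨K, K', h1, h2, h3, h4⟩
    · obtain ⟨j, h4, h5⟩ := s.reach_of_tauStar hD i h1
      obtain ⟨W', h6, h7⟩ := hreach h4
      exact .inl ⟨rfl, W', h6, ⟨j, h2.trans h5, h7⟩, ⟨j, h3.trans h5, h7⟩⟩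
    · obtain ⟨j, h5, h6, h7⟩ := s.edge_of_step hD i h1 h2
      obtain ⟨W', h8, h9⟩ := hreach h5
      rcases h7 with ⟨rfl, h7⟩ | ⟨l, h10, h11⟩
      · exact .inl ⟨rfl, W', h8, ⟨j, h3.trans h6, h9⟩, ⟨j, h4.trans h7, h9⟩⟩
      · obtain ⟨K₁, h12, h13⟩ := s.step_of_edge hD' h10
        rcases h9.symm.divBranching.1.1 a K₁ h12 with
          ⟨rfl, W'', h14, h15, h16⟩ | ⟨W'', W₃, h14, h15, h16, h17⟩
        · exact .inl ⟨rfl, W'', h8.trans h14, ⟨j, h3.trans h6, h15.symm⟩,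
            ⟨l, h4.trans h11, h16.symm.trans h13.symm⟩⟩
        · exact .inr ⟨W'', W₃, h8.trans h14, h15, ⟨j, h3.trans h6, h16.symm⟩,
            ⟨l, h4.trans h11, h17.symm.trans h13.symm⟩⟩
  · obtain ⟨K, h1, h2, h3⟩ := hU.divBranching.1.2 X hX
    obtain ⟨j, h5, h6, h7⟩ := s.exposes_of_exposes hD i h1 h3
    obtain ⟨W', h8, h9⟩ := hreach h5
    obtain ⟨W'', h10, h11, h12⟩ := (h9.trans (hD'.2 j).divBisimilar).symm.divBranching.1.2 X
      ((s.exposes_rhs hD'.1).2 h7)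
    exact ⟨W'', h8.trans h10, ⟨j, h2.trans h6, h11.symm.trans (hD'.2 j).divBisimilar.symm⟩, h12⟩
  · exact s.diverges_half hD hD' i hU hW run h0 hr

/-- Models of a standard system are unique up to bisimilarity. -/
theorem model_unique (s : S.StandardForm) {D' : Fin n → Expr V A}
    (hD : S.IsModel D) (hD' : S.IsModel D')
    (i : Fin n) : DivBisimilar (D i) (D' i) := by
  refine divBisimilar_of_bis
    (R := fun U W => ∃ i, DivBisimilar U (D i) ∧ DivBisimilar W (D' i)) ?_
    (.inl ⟨i, .refl _, .refl _⟩)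
  intro U W h
  refine ⟨(s.unique_half hD hD' h).mono fun _ _ h => .inl h,
    (s.unique_half hD' hD ?_).mono ?_⟩
  · obtain ⟨i, h1, h2⟩ := h; exact ⟨i, h2, h1⟩
  · rintro U W ⟨i, h1, h2⟩; exact .inr (.inl ⟨i, h2, h1⟩)

/-- Existence of a solution excludes that the universally quantified `S.Equiv` holds vacuously;
uniqueness makes the choice of solutions irrelevant. -/
theorem equiv_iff (s : S.StandardForm) (hD : S.IsModel D) (i j : Fin n) :
    S.Equiv i j ↔ DivBisimilar (D i) (D j) := by
  have key : ∀ {E : Expr V A} {i : Fin n}, S.Solves i E → DivBisimilar E (D i) := by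
    rintro _ i ⟨D', hD', rfl⟩
    exact (Rooted.nf _).divBisimilar.trans (s.model_unique hD'.isModel hD i)
  constructor
  · intro h
    obtain ⟨D', hD'⟩ := S.exists_isSolution
    have h1 := h _ _ ⟨D', hD', rfl⟩ ⟨D', hD', rfl⟩
    exact (key ⟨D', hD', rfl⟩).symm.trans (h1.trans (key ⟨D', hD', rfl⟩))
  · intro h E E' hE hE'
    exact (key hE).trans (h.trans (key hE').symm)

/-! ### Variables without inert silent edges represent their class -/

section NoInertEdges

variable {i j : Fin n}

/-- A silent path that leaves the class and returns is excluded by stuttering. So a path that ends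
in the class cannot begin with an edge and can at most circle in the loop. -/
theorem eq_rhs_of_tauStar (hD : S.IsModel D)
    (hi : ∀ l, s.Edge i Act.tau l → ¬ DivBisimilar (D l) (D i)) {K : Expr V A}
    (h : TauStar ((S.rhs i).subst (S.inst D)) K) (hK : DivBisimilar K (D i)) :
    K = (S.rhs i).subst (S.inst D) := by
  rcases s.tauStar_rhs hD.1 h with h | ⟨l, h1, h2⟩
  · exact h
  · exfalso
    have hDi := (hD.2 i).divBisimilar
    refine hi l h1 ((hDi.trans (DivBisimilar.stutter (.single ?_) h2
      (hDi.symm.trans hK.symm))).symm)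
    exact (s.step_rhs hD.1).2 (.inl ⟨l, h1, rfl⟩)

/-- Before answering, `X_i` may only make silent steps inside its class, hence none that changes the
expression. The answer is therefore an edge of `X_i` itself, the loop being excluded because the
given edge is not inert. -/
theorem edge_of_equiv (hD : S.IsModel D) (hij : DivBisimilar (D i) (D j))
    (hi : ∀ l, s.Edge i Act.tau l → ¬ DivBisimilar (D l) (D i)) {a : Act A} {l : Fin n}
    (h : s.Edge j a l) (hl : ¬ (a = Act.tau ∧ DivBisimilar (D l) (D i))) :
    ∃ l', s.Edge i a l' ∧ DivBisimilar (D l) (D l') := by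
  have hDi := (hD.2 i).divBisimilar
  have hDj := (hD.2 j).divBisimilar
  have hji := hDj.symm.trans (hij.symm.trans hDi)
  rcases hji.divBranching.1.1 a (D l) ((s.step_rhs hD.1).2 (.inl ⟨l, h, rfl⟩)) with
    ⟨rfl, K, _, h2, h3⟩ | ⟨K, K', h1, h2, h3, h4⟩
  · exact absurd ⟨rfl, h3.trans (h2.symm.trans (hDj.symm.trans hij.symm))⟩ hl
  · obtain rfl := s.eq_rhs_of_tauStar hD hi h1 (h3.symm.trans (hDj.symm.trans hij.symm))
    rcases (s.step_rhs hD.1).1 h2 with ⟨l', h5, rfl⟩ | ⟨_, rfl, rfl⟩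
    · exact ⟨l', h5, h4⟩
    · exact absurd ⟨rfl, h4.trans hDi.symm⟩ hl

theorem exposes_of_equiv (hD : S.IsModel D) (hij : DivBisimilar (D i) (D j))
    (hi : ∀ l, s.Edge i Act.tau l → ¬ DivBisimilar (D l) (D i)) {X : V}
    (h : Exposes (s.core j) X) : Exposes (s.core i) X := by
  have hDi := (hD.2 i).divBisimilar
  have hDj := (hD.2 j).divBisimilar
  have hji := hDj.symm.trans (hij.symm.trans hDi)
  obtain ⟨K, h1, h2, h3⟩ := hji.divBranching.1.2 X ((s.exposes_rhs hD.1).2 h)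
  obtain rfl := s.eq_rhs_of_tauStar hD hi h1 (h2.symm.trans (hDj.symm.trans hij.symm))
  exact (s.exposes_rhs hD.1).1 h3

/-- The divergence of `X_j` stays in the class, so `X_i` has a non-empty silent path inside the
class; by stuttering its first step is not an edge and must be the loop. This is where preservation
of divergence enters. -/
theorem looping_of_equiv (hD : S.IsModel D) (hij : DivBisimilar (D i) (D j))
    (hi : ∀ l, s.Edge i Act.tau l → ¬ DivBisimilar (D l) (D i)) (h : s.looping j) :
    s.looping i := by
  have hDi := (hD.2 i).divBisimilar
  have hDj := (hD.2 j).divBisimilar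
  have hji := hDj.symm.trans (hij.symm.trans hDi)
  obtain ⟨k, K, h1, h2⟩ := hji.divBranching.2 (fun _ => (S.rhs j).subst (S.inst D)) rfl
    fun _ => (s.step_rhs hD.1).2 (.inr ⟨h, rfl, rfl⟩)
  obtain ⟨K₁, h3, h4⟩ := h1.exists_head
  rcases (s.step_rhs hD.1).1 h3 with ⟨l, h5, rfl⟩ | ⟨hl, _⟩
  · exfalso
    refine hi l h5 ((hDi.trans (DivBisimilar.stutter (.single h3) h4 (hji.symm.trans h2))).symm)
  · exact hl

end NoInertEdges

end StandardForm

/-! ### Deriving the equations of a class from that of a representative -/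

namespace StandardForm

variable {S : EqSystem V A n} (s : S.StandardForm)

theorem provable_rhs_loop {i : Fin n} (hl : s.looping i) (σ : V → Expr V A) {Z : V}
    (hZ : Z ∉ ((s.core i).subst σ).FV) :
    Provable ((S.rhs i).subst σ) (loop Z ((s.core i).subst σ)) := by
  obtain ⟨Y, hY, hr⟩ := s.rhs_eq_loop i hl
  rw [hr]
  exact .loop_subst σ hY hZ

theorem provable_rhs_congr {i j : Fin n} (hij : s.looping i ↔ s.looping j) {σ ρ : V → Expr V A}
    (h : Provable ((s.core i).subst σ) ((s.core j).subst ρ)) :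
    Provable ((S.rhs i).subst σ) ((S.rhs j).subst ρ) := by
  by_cases hl : s.looping i
  · obtain ⟨Z, hZ⟩ := Infinite.exists_notMem_finset
      (((s.core i).subst σ).FV ∪ ((s.core j).subst ρ).FV)
    simp only [Finset.mem_union, not_or] at hZ
    exact (s.provable_rhs_loop hl σ hZ.1).trans <| (Provable.loop Z h).trans
      (s.provable_rhs_loop (hij.1 hl) ρ hZ.2).symm
  · rw [s.rhs_eq i hl, s.rhs_eq j fun h => hl (hij.2 h)]
    exact h

theorem absorbs_edges {B : Fin n → Expr V A} {G T : Expr V A}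
    (hG : IsSimpleSum (· ∈ Set.range S.formal) G)
    (h : ∀ a l, Step G a (Expr.var (S.formal l)) → Absorbs T (Expr.pre a (B l)))
    (h' : ∀ X, X ∉ Set.range S.formal → Exposes G X → Absorbs T (Expr.var X)) :
    Absorbs T (G.subst (S.inst B)) := by
  refine hG.absorbs (fun a X hX => ?_) fun X hX => ?_
  · obtain ⟨_, ⟨l, rfl⟩, _, h1⟩ := hG.mem_FV_of_pre hX
    cases h1
    rw [S.inst_formal]
    exact h a l hX
  · have h1 := (hG.of_exposes hX).1
    rw [S.inst_of_notMem _ h1]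
    exact h' X h1 hX

theorem absorbs_of_edge {j l : Fin n} {a : Act A} (B : Fin n → Expr V A) (h : s.Edge j a l) :
    Absorbs ((s.core j).subst (S.inst B)) (Expr.pre a (B l)) := by
  have h1 := (s.simple j).absorbs_pre (S.inst B) h
  rwa [S.inst_formal] at h1

theorem absorbs_of_exposes {j : Fin n} {X : V} (B : Fin n → Expr V A)
    (h : Exposes (s.core j) X) : Absorbs ((s.core j).subst (S.inst B)) (Expr.var X) := by
  have h1 := (s.simple j).absorbs_var (S.inst B) h
  rwa [S.inst_of_notMem _ ((s.simple j).of_exposes h).1] at h1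

/-- Formal variables occur in the cores only under prefixes, where `a.τ.B = a.B`. -/
theorem provable_rhs_inst_tau (s : S.StandardForm) (B : Fin n → Expr V A) (i : Fin n) :
    Provable ((S.rhs i).subst (S.inst B))
      ((S.rhs i).subst (S.inst fun j => Expr.pre Act.tau (B j))) := by
  refine s.provable_rhs_congr Iff.rfl (Absorbs.antisymm ?_ ?_)
  · refine absorbs_edges (s.simple i) (fun a l h => ?_) fun X _ h =>
      s.absorbs_of_exposes B h
    exact (s.absorbs_of_edge B h).trans (.of_provable (Provable.pre_tau a _).symm)
  · refine absorbs_edges (s.simple i) (fun a l h => ?_) fun X _ h =>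
      s.absorbs_of_exposes _ h
    exact (s.absorbs_of_edge _ h).trans (.of_provable (Provable.pre_tau a _))

/-- If `X_i` has no inert silent summands and is equivalent to `X_j`, then a value that satisfies
the equation for `X_i` satisfies that for `X_j` after a silent step. -/
theorem provable_tau_of_equiv {D : Fin n → Expr V A} (hD : S.IsModel D) {i j : Fin n}
    (hij : DivBisimilar (D i) (D j))
    (hi : ∀ l, s.Edge i Act.tau l → ¬ DivBisimilar (D l) (D i)) {B : Fin n → Expr V A}
    (hB : ∀ k l, DivBisimilar (D k) (D l) → B k = B l)
    (hBi : Provable (B i) ((S.rhs i).subst (S.inst B))) :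
    Provable (Expr.pre Act.tau (B j)) (Expr.pre Act.tau ((S.rhs j).subst (S.inst B))) := by
  rw [← hB i j hij]
  -- If `X_j` has no inert edge either, the situation is symmetric, and the two cores absorb each
  -- other's summands.
  by_cases hj : ∀ l, s.Edge j Act.tau l → ¬ DivBisimilar (D l) (D j)
  · refine .pre_congr _ (hBi.trans (s.provable_rhs_congr
      ⟨s.looping_of_equiv hD hij.symm hj, s.looping_of_equiv hD hij hi⟩
      (Absorbs.antisymm ?_ ?_)))
    · refine absorbs_edges (s.simple j) (fun a l h => ?_) fun X _ h =>
        s.absorbs_of_exposes B (s.exposes_of_equiv hD hij hi h)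
      obtain ⟨l', h1, h2⟩ := s.edge_of_equiv hD hij hi h
        (by rintro ⟨rfl, h1⟩; exact hj l h (h1.trans hij))
      rw [hB l l' h2]
      exact s.absorbs_of_edge B h1
    · refine absorbs_edges (s.simple i) (fun a l h => ?_) fun X _ h =>
        s.absorbs_of_exposes B (s.exposes_of_equiv hD hij.symm hj h)
      obtain ⟨l', h1, h2⟩ := s.edge_of_equiv hD hij.symm hj h
        (by rintro ⟨rfl, h1⟩; exact hi l h (h1.trans hij.symm))
      rw [hB l l' h2]
      exact s.absorbs_of_edge B h1
  · push Not at hj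
    obtain ⟨l₀, hl₀, hl₀'⟩ := hj
    -- `H` is the non-inert part of the core of `X_j`. All inert edges contribute the same summand
    -- `τ.(B i)`, which is present because of `l₀`; this gives `hC`.
    obtain ⟨H, h1, h2, h3⟩ := (s.simple j).exists_filter
      fun a X => a = Act.tau ∧ ∃ l, X = S.formal l ∧ DivBisimilar (D l) (D i)
    have hPH : Absorbs ((s.core i).subst (S.inst B)) (H.subst (S.inst B)) := by
      refine absorbs_edges h1 (fun a l h => ?_) fun X _ h =>
        s.absorbs_of_exposes B (s.exposes_of_equiv hD hij hi ((h3 X).1 h))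
      obtain ⟨h4, h5⟩ := (h2 _ _).1 h
      obtain ⟨l', h6, h7⟩ := s.edge_of_equiv hD hij hi h4
        (by rintro ⟨rfl, h6⟩; exact h5 ⟨rfl, l, rfl, h6⟩)
      rw [hB l l' h7]
      exact s.absorbs_of_edge B h6
    have hC : Provable ((s.core j).subst (S.inst B))
        (Expr.sum (Expr.pre Act.tau (B i)) (H.subst (S.inst B))) := by
      refine Absorbs.antisymm (.sum ?_ ?_) ?_
      · rw [← hB l₀ i (hl₀'.trans hij.symm)]
        exact s.absorbs_of_edge B hl₀
      · exact absorbs_edges h1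
          (fun a l h => s.absorbs_of_edge B ((h2 _ _).1 h).1) fun X _ h =>
          s.absorbs_of_exposes B ((h3 X).1 h)
      · refine absorbs_edges (s.simple j) (fun a l h => ?_) fun X hX h => ?_
        · by_cases hp : a = Act.tau ∧ DivBisimilar (D l) (D i)
          · obtain ⟨rfl, hl⟩ := hp
            rw [hB l i hl]
            exact .sum_left _ _
          · have h4 := h1.absorbs_pre (S.inst B) ((h2 a (S.formal l)).2 ⟨h, by
              rintro ⟨ha, l', h5, h6⟩
              exact hp ⟨ha, by rwa [S.formal_injective h5]⟩⟩)
            rw [S.inst_formal] at h4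
            exact (Absorbs.sum_right _ _).trans h4
        · have h4 := h1.absorbs_var (S.inst B) ((h3 X).2 h)
          rw [S.inst_of_notMem _ hX] at h4
          exact (Absorbs.sum_right _ _).trans h4
    obtain ⟨Z, hZ⟩ := Infinite.exists_notMem_finset (((s.core i).subst (S.inst B)).FV ∪
      (((s.core j).subst (S.inst B)).FV ∪ ((B i).FV ∪ (H.subst (S.inst B)).FV)))
    simp only [Finset.mem_union, not_or] at hZ
    by_cases hlj : s.looping j
    · have hli := s.looping_of_equiv hD hij hi hlj
      refine Provable.symm (.trans (.pre_congr _ ((s.provable_rhs_loop hlj _ hZ.2.1).trans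
        (.loop Z hC))) ?_)
      exact .tau_loop_absorb hZ.1 (hBi.trans (s.provable_rhs_loop hli _ hZ.1)) hPH
        hZ.2.2.1 hZ.2.2.2
    · rw [s.rhs_eq j hlj]
      refine Provable.symm (.trans (.pre_congr _ hC) (.tau_absorb ?_))
      -- Here `X_i` may loop although `X_j` does not; unfolding its loop once exhibits the core as a
      -- summand.
      refine (Absorbs.of_provable hBi).trans (Absorbs.trans ?_ hPH)
      by_cases hli : s.looping i
      · exact (Absorbs.of_provable ((s.provable_rhs_loop hli _ hZ.1).trans
          (.loop_unfold hZ.1))).trans (.sum_right _ _)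
      · rw [s.rhs_eq i hli]; exact .refl _

end StandardForm

/-! ### The quotient system and the theorem -/

theorem QuotientChoice.provable_rep {S : EqSystem V A n} {m : ℕ} (q : S.QuotientChoice m)
    {B : Fin m → Expr V A} (hB : q.system.IsSolution B) (k : Fin m) :
    Provable (B k) ((S.rhs (q.rep k)).subst (S.inst fun i => B (q.idx i))) := by
  refine (hB k).trans (.of_eq ?_)
  change ((S.rhs (q.rep k)).subst _).subst _ = _
  rw [subst_subst]
  refine subst_congr _ fun X hX => ?_
  by_cases h : X ∈ Set.range S.formal
  · obtain ⟨i, rfl⟩ := h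
    rw [S.inst_formal, S.inst_formal]
    exact q.system.inst_formal B (q.idx i)
  · rw [S.inst_of_notMem _ h, S.inst_of_notMem _ h]
    refine q.system.inst_of_notMem B ?_
    rintro ⟨l, rfl⟩
    -- A variable of the right-hand side that is not formal must survive the second substitution
    -- too; the new variables were chosen not free there.
    exact q.newVar_notMem l _ hX

/-- The solutions of the quotient system provide solutions of `τ(S)`. -/
theorem QuotientChoice.isSolution_tau {S : EqSystem V A n} (hS : S.IsStandard) {m : ℕ}
    (q : S.QuotientChoice m) {B : Fin m → Expr V A} (hB : q.system.IsSolution B) :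
    S.tau.IsSolution fun k => Expr.pre Act.tau (B (q.idx k)) := by
  obtain ⟨s⟩ := hS.exists_form
  obtain ⟨D, hD⟩ := S.exists_isSolution
  have hE := s.equiv_iff hD.isModel
  intro j
  refine Provable.trans (s.provable_tau_of_equiv hD.isModel (i := q.rep (q.idx j)) (j := j)
    (B := fun i => B (q.idx i)) ?_ ?_ ?_ ?_)
    (.pre_congr _ (s.provable_rhs_inst_tau (fun i => B (q.idx i)) j))
  · rw [← hE, ← q.idx_eq_iff, q.idx_rep]
  · intro l hl h
    exact q.rep_bottom _ l (s.unguarded_of_edge hl) ((hE _ _).2 h.symm)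
  · intro k l h
    rw [← hE, ← q.idx_eq_iff] at h
    simp only [h]
  · have h := q.provable_rep hB (q.idx j)
    simpa only [q.idx_rep] using h

theorem IsStandard.exists_quotientChoice {S : EqSystem V A n} (hS : S.IsStandard) :
    ∃ m, Nonempty (S.QuotientChoice m) := by
  obtain ⟨s⟩ := hS.exists_form
  obtain ⟨D, hD⟩ := S.exists_isSolution
  have hE := s.equiv_iff hD.isModel
  let r : Setoid (Fin n) := ⟨S.Equiv, ⟨fun i => (hE i i).2 (.refl _),
    fun h => (hE _ _).2 ((hE _ _).1 h).symm,
    fun h h' => (hE _ _).2 (((hE _ _).1 h).trans ((hE _ _).1 h'))⟩⟩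
  let e := Finite.equivFin (Quotient r)
  have hidx : ∀ i j, e (Quotient.mk r i) = e (Quotient.mk r j) ↔ S.Equiv i j := fun i j => by
    rw [e.apply_eq_iff_eq]; exact Quotient.eq
  have hrep : ∀ k, ∃ i, e (Quotient.mk r i) = k ∧ S.IsBottom i := by
    intro k
    obtain ⟨i₀, hi₀⟩ := Quotient.exists_rep (e.symm k)
    -- A member of the class that is minimal for the guardedness order is a bottom variable.
    obtain ⟨i, hi, hmin⟩ := hS.1.has_min {i | e (Quotient.mk r i) = k}
      ⟨i₀, by simp [hi₀]⟩
    refine ⟨i, hi, fun j hj hij => hmin j ?_ hj⟩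
    exact ((hidx i j).2 hij).symm.trans hi
  choose rep hrep using hrep
  let F : Finset V := Finset.univ.image S.formal ∪ Finset.univ.biUnion fun i => (S.rhs i).FV
  have : Infinite {X // X ∉ F} := F.finite_toSet.infinite_compl.to_subtype
  let z := Infinite.natEmbedding {X // X ∉ F}
  have hz : ∀ k, (z k : V) ∉ F := fun k => (z k).2
  refine ⟨_, ⟨{ idx := fun i => e (Quotient.mk r i)
                idx_eq_iff := hidx
                rep := rep
                idx_rep := fun k => (hrep k).1
                rep_bottom := fun k => (hrep k).2
                newVar := fun k => (z k : V)
                newVar_injective := fun k l h =>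
                  Fin.val_injective (z.injective (Subtype.val_injective h))
                newVar_ne := fun k i h => hz k (Finset.mem_union_left _ (h ▸
                  Finset.mem_image_of_mem _ (Finset.mem_univ i)))
                newVar_notMem := fun k i h => hz k (Finset.mem_union_right _
                  (Finset.mem_biUnion.2 ⟨i, Finset.mem_univ i, h⟩)) }⟩⟩

end EqSystem

end FiniteState

theorem mainTheorem3 {V : Type u} {A : Type v} [DecidableEq V] [Infinite V] [Infinite A]
    {n : ℕ} (S : FiniteState.EqSystem V A n) (hS : S.IsStandard)
    (i j : Fin n) (hij : S.Equiv i j) :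
    S.tau.HasCommonSolution i j ∧
    (∃ m, Nonempty (S.QuotientChoice m)) ∧
    ∀ (m : ℕ) (q : S.QuotientChoice m),
      (∃ B, q.system.IsSolution B) ∧
      ∀ B, q.system.IsSolution B →
        S.tau.IsSolution (fun k => FiniteState.Expr.pre FiniteState.Act.tau (B (q.idx k))) ∧
        S.tau.Solves i (FiniteState.Expr.pre FiniteState.Act.tau (B (q.idx i))) ∧
        S.tau.Solves j (FiniteState.Expr.pre FiniteState.Act.tau (B (q.idx i))) := by
  have key : ∀ {m : ℕ} (q : S.QuotientChoice m) {B : Fin m → FiniteState.Expr V A},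
      q.system.IsSolution B →
        S.tau.IsSolution (fun k => FiniteState.Expr.pre FiniteState.Act.tau (B (q.idx k))) ∧
        S.tau.Solves i (FiniteState.Expr.pre FiniteState.Act.tau (B (q.idx i))) ∧
        S.tau.Solves j (FiniteState.Expr.pre FiniteState.Act.tau (B (q.idx i))) := by
    intro m q B hB
    have h := q.isSolution_tau hS hB
    exact ⟨h, ⟨_, h, rfl⟩, ⟨_, h, by rw [(q.idx_eq_iff i j).2 hij]⟩⟩
  refine ⟨?_, hS.exists_quotientChoice, fun m q => ⟨q.system.exists_isSolution, fun B => key q⟩⟩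
  obtain ⟨m, ⟨q⟩⟩ := hS.exists_quotientChoice
  obtain ⟨B, hB⟩ := q.system.exists_isSolution
  exact ⟨_, (key q hB).2⟩
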